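/- Let $n\ge 1$ and let $\mathbb{R}_n$ be the real Clifford algebra with units $e_1,\dots,e_n$, $e_i^2=-1$, $e_ie_j=-e_je_i$ $(i\neq j)$, basis $(e_A)_{A\subseteq\{1,\dots,n\}}$ and $|\sum_A s_Ae_A|^2=\sum_A s_A^2$; let $\mathbb{R}^{n+1}\subseteq\mathbb{R}_n$ be the paravectors $s=s_0+s_1e_1+\dots+s_ne_n$, $\overline{s}=s_0-s_1e_1-\dots-s_ne_n$, and $\mathbb{S}=\{s\in\mathbb{R}^{n+1}: s_0=0,\ |s|=1\}$. For $0<\omega<\frac{\pi}{2}$ put $I_\omega=(-\omega,\omega)\cup(\pi-\omega,\pi+\omega)$ and $$D_\omega=\{te^{J\phi}: t>0,\ J\in\mathbb{S},\ \phi\in I_\omega\}\subseteq\mathbb{R}^{n+1}.$$ Let $V=V_{\mathbb{R}}\otimes\mathbb{R}_n$ for a real Banach space $V_{\mathbb{R}}$, with $\|\sum_A v_A\otimes e_A\|^2=\sum_A\|v_A\|^2$ and with left and right multiplication by $\mathbb{R}_n$. Let $T$ be a closed right-linear operator in $V$ with two-sided linear domain. For a polynomial $p=p_0+\dots+p_Ns^N$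 of degree $N$ with real coefficients put $p[T]=p_0+p_1T+\dots+p_NT^N$ with domain $\operatorname{dom}(T^N)$, and put $Q_s[T]=T^2-2s_0T+|s|^2$ for $s\in\mathbb{R}^{n+1}$. Let $\rho_S(T)$ be the set of all $s\in\mathbb{R}^{n+1}$ for which $Q_s[T]$ has an everywhere defined bounded inverse, $\sigma_S(T)=\mathbb{R}^{n+1}\setminus\rho_S(T)$, and $S_L^{-1}(s,T)=Q_s[T]^{-1}\overline{s}-TQ_s[T]^{-1}$ for $s\in\rho_S(T)$. Here the product of an operator $A$ and $a\in\mathbb{R}_n$ is $(Aa)(v)=A(av)$. Assume that $T$ is bisectorial of angle $\omega\in(0,\frac{\pi}{2})$: $\sigma_S(T)\subseteq\overline{D_\omega}$, and for every $\varphi\in(\omega,\frac{\pi}{2})$ there is $C_\varphi\ge 0$ with $\|S_L^{-1}(s,T)\|\le C_\varphi/|s|$ for all $s\in\mathbb{R}^{n+1}\setminus(D_\varphi\cup\{0\})$. For $\theta\in(0,\frac{\pi}{2})$, a function $f:D_\theta\to\mathbb{R}_n$ is left slice hyperholomorphic if $f(x+Jy)=f_0(x,y)+Jf_1(x,y)$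 for all $J\in\mathbb{S}$ and all $(x,y)$ with $x+\mathbb{S}y\subseteq D_\theta$, where $f_0,f_1$ are continuously differentiable $\mathbb{R}_n$-valued functions, $f_0$ is even and $f_1$ is odd in $y$, $\partial_xf_0=\partial_yf_1$ and $\partial_yf_0=-\partial_xf_1$; it is intrinsic if $f_0,f_1$ are real valued. Let $\mathcal{SH}_L^0(D_\theta)$ (resp. $\mathcal{N}^0(D_\theta)$) be the set of all bounded left slice hyperholomorphic (resp. intrinsic) $f$ on $D_\theta$ with $\int_0^\infty|f(te^{J\phi})|\frac{dt}{t}<\infty$ for all $J\in\mathbb{S}$, $\phi\in I_\theta$. Let $\mathcal{SH}_L^{\rm bnd}(D_\theta)$ (resp. $\mathcal{N}^{\rm bnd}(D_\theta)$) be the set of all functions $$f(s)=f_\infty+\frac{1}{1+s^2}(f_0-f_\infty)+\widetilde f(s),\qquad s\in D_\theta,$$ with $f_0,f_\infty\in\mathbb{R}_n$, $\widetilde f\in\mathcal{SH}_L^0(D_\theta)$ (resp. $f_0,f_\infty\in\mathbb{R}$, $\widetilde f\in\mathcal{N}^0(D_\theta)$). For $\theta\in(\omega,\frac{\pi}{2})$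 and $f\in\mathcal{SH}_L^{\rm bnd}(D_\theta)$ the extended $\omega$-functional calculus is $$f(T)=f_\infty+(1+T^2)^{-1}(f_0-f_\infty)+\frac{1}{2\pi}\int_{\partial D_\varphi\cap\mathbb{C}_J}S_L^{-1}(s,T)\,ds_J\,\widetilde f(s),$$ where $\varphi\in(\omega,\theta)$ and $J\in\mathbb{S}$ are arbitrary, $\mathbb{C}_J=\{x+Jy: x,y\in\mathbb{R}\}$, $ds_J=\gamma'(t)J^{-1}dt$, and the boundary is parametrized by $\gamma_\pm(t)=\pm|t|e^{-\operatorname{sgn}(t)J\varphi}$, $t\in\mathbb{R}$. **Theorem.** Let $p,q$ be polynomials with real coefficients such that $\deg q\ge\deg p$ and $q$ has no zeros in $\overline{D_\omega}$. Then $q[T]:\operatorname{dom}(q[T])\to V$ is bijective, and there is $\theta\in(\omega,\frac{\pi}{2})$ such that $q$ has no zeros in $D_\theta$, $\frac pq\in\mathcal{N}^{\rm bnd}(D_\theta)$, and $$\Big(\frac pq\Big)(T)=p[T]\,q[T]^{-1},$$ where $(\frac pq)(T)$ is a bounded operator given by the extended $\omega$-functional calculus (the integral converges absolutely, and the value is the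 same for all $\varphi\in(\omega,\theta)$ and $J\in\mathbb{S}$), and the equality includes that the right-hand side is everywhere defined. -/

import Mathlib

open scoped symmDiff Polynomial
open MeasureTheory

namespace CliffordCalculus

/-! ### The Clifford algebra `ℝ_n` and Clifford modules -/

/-- The Clifford module `V = X ⊗ ℝ_n` over a real Banach space `X`: families `(v_A)` of vectors of
`X`, indexed by the subsets `A` of the `n` generators, with norm `‖v‖² = ∑_A ‖v_A‖²`. -/
abbrev CliffMod (n : ℕ) (X : Type*) : Type _ := PiLp 2 (fun _ : Finset (Fin n) => X)

/-- The real Clifford algebra `ℝ_n`: `s = ∑_A s_A e_A`, with `|s|² = ∑_A s_A²`. -/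
abbrev Cl (n : ℕ) : Type := CliffMod n ℝ

/-- The sign in `e_A e_B = sgn A B • e_{A ∆ B}`: one factor `-1` for every pair `i ∈ A`, `j ∈ B`
with `j < i` (a transposition) or `j = i` (from `e_i² = -1`). -/
def sgn {n : ℕ} (A B : Finset (Fin n)) : ℝ :=
  ∏ i ∈ A, ∏ j ∈ B, if j ≤ i then -1 else 1

section Sign

variable {n : ℕ}

theorem prod_symmDiff_sign {g : Fin n → ℝ} (hg : ∀ i, g i * g i = 1) (A B : Finset (Fin n)) :
    ∏ i ∈ A ∆ B, g i = (∏ i ∈ A, g i) * ∏ i ∈ B, g i := by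
  have h1 : A ∆ B = (A \ B) ∪ (B \ A) := rfl
  have hd : Disjoint (A \ B) (B \ A) := disjoint_sdiff_sdiff
  have hi : (∏ i ∈ A ∩ B, g i) * ∏ i ∈ A ∩ B, g i = 1 := by
    rw [← Finset.prod_mul_distrib]; exact Finset.prod_eq_one fun i _ => hg i
  have hA : ∏ i ∈ A, g i = (∏ i ∈ A ∩ B, g i) * ∏ i ∈ A \ B, g i :=
    (Finset.prod_inter_mul_prod_sdiff A B g).symm
  have hB : ∏ i ∈ B, g i = (∏ i ∈ A ∩ B, g i) * ∏ i ∈ B \ A, g i := by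
    rw [Finset.inter_comm]; exact (Finset.prod_inter_mul_prod_sdiff B A g).symm
  rw [h1, Finset.prod_union hd, hA, hB]
  linear_combination (-(∏ i ∈ A \ B, g i) * ∏ i ∈ B \ A, g i) * hi

theorem sgn_symmDiff_left (A B C : Finset (Fin n)) : sgn (A ∆ B) C = sgn A C * sgn B C := by
  refine prod_symmDiff_sign (fun i => ?_) A B
  rw [← Finset.prod_mul_distrib]
  exact Finset.prod_eq_one fun j _ => by split_ifs <;> norm_num

theorem sgn_symmDiff_right (A B C : Finset (Fin n)) : sgn A (B ∆ C) = sgn A B * sgn A C := by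
  unfold sgn
  rw [← Finset.prod_mul_distrib]
  refine Finset.prod_congr rfl fun i _ => prod_symmDiff_sign (fun j => ?_) B C
  split_ifs <;> norm_num

@[simp] theorem sgn_empty_left (A : Finset (Fin n)) : sgn ∅ A = 1 := by simp [sgn]

@[simp] theorem sgn_empty_right (A : Finset (Fin n)) : sgn A ∅ = 1 := by simp [sgn]

end Sign

section Module

variable {n : ℕ} {X : Type*} [NormedAddCommGroup X] [NormedSpace ℝ X]

/-- Left multiplication `s v = ∑_{A,B} (s_B v_A) ⊗ (e_B e_A)`, written by components
(`B ∆ A = C` means `A = B ∆ C`), as a bounded operator on the Clifford module. -/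
noncomputable def lmul (s : Cl n) : CliffMod n X →L[ℝ] CliffMod n X :=
  ((PiLp.continuousLinearEquiv 2 ℝ (fun _ : Finset (Fin n) => X)).symm :
      (Finset (Fin n) → X) →L[ℝ] CliffMod n X).comp
    (ContinuousLinearMap.pi fun C =>
      ∑ B, (s B * sgn B (B ∆ C)) • PiLp.proj 2 (fun _ : Finset (Fin n) => X) (B ∆ C))

/-- Right multiplication `v s = ∑_{A,B} (v_A s_B) ⊗ (e_A e_B)`, written by components. -/
noncomputable def rmul (v : CliffMod n X) (s : Cl n) : CliffMod n X :=
  WithLp.toLp 2 fun C => ∑ B, (s B * sgn (C ∆ B) B) • v (C ∆ B)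

theorem lmul_apply (s : Cl n) (v : CliffMod n X) (C : Finset (Fin n)) :
    lmul s v C = ∑ B, (s B * sgn B (B ∆ C)) • v (B ∆ C) := by
  simp [lmul]

theorem lmul_lmul (s t : Cl n) (v : CliffMod n X) : lmul s (lmul t v) = lmul (lmul s t) v := by
  ext C
  simp only [lmul_apply, Finset.smul_sum, Finset.sum_mul, Finset.sum_smul, smul_smul, smul_eq_mul]
  rw [Finset.sum_comm' (t' := Finset.univ) (s' := fun _ => Finset.univ) (by simp)]
  symm
  rw [Finset.sum_comm]
  symm
  rw [Finset.sum_comm]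
  refine Finset.sum_congr rfl fun B _ => ?_
  refine Fintype.sum_equiv (Equiv.ofBijective (fun D => B ∆ D)
    (Function.Involutive.bijective fun D => by simp)) _ _ fun D => ?_
  have h : D ∆ (B ∆ C) = (B ∆ D) ∆ C := by
    rw [← symmDiff_assoc, symmDiff_comm D B]
  simp only [Equiv.ofBijective_apply, h, symmDiff_symmDiff_cancel_left]
  congr 1
  have h2 : B ∆ C = D ∆ ((B ∆ D) ∆ C) := by rw [← h]; simp
  rw [h2, sgn_symmDiff_right, sgn_symmDiff_left]
  ring

noncomputable instance : Mul (Cl n) := ⟨fun s t => lmul s t⟩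

noncomputable instance : One (Cl n) := ⟨WithLp.toLp 2 (Pi.single ∅ 1)⟩

theorem mul_def (s t : Cl n) : s * t = lmul s t := rfl

theorem mul_apply (s t : Cl n) (C : Finset (Fin n)) :
    (s * t) C = ∑ B, (s B * sgn B (B ∆ C)) * t (B ∆ C) := by
  rw [mul_def, lmul_apply]; rfl

theorem one_apply (C : Finset (Fin n)) : (1 : Cl n) C = if C = ∅ then 1 else 0 := by
  change (Pi.single ∅ 1 : Finset (Fin n) → ℝ) C = _
  rw [Pi.single_apply]

theorem one_lmul (v : CliffMod n X) : lmul (1 : Cl n) v = v := by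
  ext C
  rw [lmul_apply, Finset.sum_eq_single ∅]
  · have h : (∅ : Finset (Fin n)) ∆ C = C := by rw [← Finset.bot_eq_empty, bot_symmDiff]
    rw [h]; simp [one_apply]
  · intro B _ hB; simp [one_apply, hB]
  · simp

noncomputable instance : Ring (Cl n) :=
  { (inferInstance : AddCommGroup (Cl n)) with
    mul := (· * ·)
    one := 1
    left_distrib := fun s t u => by simp [mul_def]
    right_distrib := fun s t u => by
      ext C; simp [mul_apply, add_mul, Finset.sum_add_distrib]
    zero_mul := fun s => by ext C; simp [mul_apply]
    mul_zero := fun s => by simp [mul_def]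
    mul_assoc := fun s t u => by simp only [mul_def, lmul_lmul]
    one_mul := fun s => one_lmul s
    mul_one := fun s => by
      ext C
      rw [mul_apply, Finset.sum_eq_single C]
      · simp [one_apply]
      · intro B _ hB
        have : B ∆ C ≠ ∅ := by
          rw [← Finset.bot_eq_empty]; simpa using hB
        simp [one_apply, this]
      · simp }

noncomputable instance : Algebra ℝ (Cl n) :=
  Algebra.ofModule
    (fun r s t => by
      ext C
      simp only [mul_apply, PiLp.smul_apply, smul_eq_mul, Finset.mul_sum]
      exact Finset.sum_congr rfl fun _ _ => by ring)
    (fun r s t => by simp [mul_def])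

/-- The basis vector `e_A`. -/
noncomputable def basisVec (A : Finset (Fin n)) : Cl n := WithLp.toLp 2 (Pi.single A 1)

theorem basisVec_apply (A C : Finset (Fin n)) :
    basisVec A C = if C = A then (1 : ℝ) else 0 := by
  change (Pi.single A 1 : Finset (Fin n) → ℝ) C = _
  rw [Pi.single_apply]

theorem basisVec_mul (A B : Finset (Fin n)) :
    basisVec A * basisVec B = sgn A B • basisVec (A ∆ B) := by
  ext C
  rw [mul_apply, Finset.sum_eq_single A]
  · have h : A ∆ C = B ↔ C = A ∆ B := by
      constructor
      · rintro rfl; simp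
      · rintro rfl; simp
    by_cases hC : C = A ∆ B
    · subst hC; simp [basisVec_apply]
    · simp [basisVec_apply, h, hC]
  · intro D _ hD; simp [basisVec_apply, hD]
  · simp

/-- The relation `e_i² = -1`. -/
theorem gen_sq (i : Fin n) : basisVec {i} * basisVec {i} = (-1 : Cl n) := by
  rw [basisVec_mul, symmDiff_self, Finset.bot_eq_empty]
  have h : (basisVec ∅ : Cl n) = 1 := rfl
  simp [sgn, h]

/-- The relation `e_i e_j = - e_j e_i` for `i ≠ j`. -/
theorem gen_anticomm {i j : Fin n} (h : i ≠ j) :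
    (basisVec {i} * basisVec {j} : Cl n) = -(basisVec {j} * basisVec {i}) := by
  rw [basisVec_mul, basisVec_mul, symmDiff_comm]
  rcases lt_or_gt_of_ne h with h' | h' <;> simp [sgn, h'.le, not_le.mpr h']

/-- `e_A` is the product of its generators in increasing order. -/
theorem gen_mul {i : Fin n} {A : Finset (Fin n)} (h : ∀ j ∈ A, i < j) :
    (basisVec {i} * basisVec A : Cl n) = basisVec (insert i A) := by
  have hi : i ∉ A := fun hA => lt_irrefl _ (h i hA)
  have h1 : ({i} : Finset (Fin n)) ∆ A = insert i A := by
    rw [Disjoint.symmDiff_eq_sup (by simpa using hi)]; rfl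
  have h2 : sgn ({i} : Finset (Fin n)) A = 1 := by
    rw [sgn, Finset.prod_singleton]
    exact Finset.prod_eq_one fun j hj => if_neg (not_le.mpr (h j hj))
  rw [basisVec_mul, h1, h2, one_smul]

end Module

/-- The conjugate `s̄ = ∑_A (-1)^{|A|(|A|+1)/2} s_A e_A`. -/
noncomputable def conj {n : ℕ} (s : Cl n) : Cl n :=
  WithLp.toLp 2 fun A => (-1) ^ (A.card * (A.card + 1) / 2) * s A

/-- The paravectors `s_0 + s_1 e_1 + ⋯ + s_n e_n`, that is `ℝ^{n+1}` inside `ℝ_n`. -/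
def Para (n : ℕ) : Set (Cl n) := {s | ∀ A, 1 < A.card → s A = 0}

/-- The sphere `𝕊` of purely imaginary paravectors of modulus one. -/
def Sph (n : ℕ) : Set (Cl n) := {s | s ∈ Para n ∧ s ∅ = 0 ∧ ‖s‖ = 1}

/-! ### Double sectors and slice hyperholomorphic functions -/

/-- The point `t e^{Jφ} = t (cos φ + J sin φ)` of the plane `ℂ_J`. -/
noncomputable def pol {n : ℕ} (J : Cl n) (t φ : ℝ) : Cl n :=
  t • (Real.cos φ • (1 : Cl n) + Real.sin φ • J)

/-- `I_ω = (-ω, ω) ∪ (π - ω, π + ω)`. -/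
def angles (ω : ℝ) : Set ℝ := Set.Ioo (-ω) ω ∪ Set.Ioo (Real.pi - ω) (Real.pi + ω)

/-- The open double sector `D_ω`: the nonzero paravectors whose argument, in some plane `ℂ_J`
that contains them, lies in `I_ω`. -/
def dblSector (n : ℕ) (ω : ℝ) : Set (Cl n) :=
  {s | ∃ J ∈ Sph n, ∃ t : ℝ, 0 < t ∧ ∃ φ ∈ angles ω, s = pol J t φ}

/-- The parameter set `{(x, y) | x + 𝕊 y ⊆ U}`. -/
def params {n : ℕ} (U : Set (Cl n)) : Set (ℝ × ℝ) :=
  {z | ∀ J ∈ Sph n, z.1 • (1 : Cl n) + z.2 • J ∈ U}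

/-- `f_0, f_1` are components of the left slice hyperholomorphic function `f` on the axially
symmetric open set `U` of paravectors. Only the values of `f` on `U` matter. -/
structure IsSliceDecomp {n : ℕ} (U : Set (Cl n)) (f : Cl n → Cl n) (f₀ f₁ : ℝ × ℝ → Cl n) :
    Prop where
  smooth₀ : ContDiffOn ℝ 1 f₀ (params U)
  smooth₁ : ContDiffOn ℝ 1 f₁ (params U)
  repr : ∀ z ∈ params U, ∀ J ∈ Sph n, f (z.1 • (1 : Cl n) + z.2 • J) = f₀ z + J * f₁ z
  even₀ : ∀ z ∈ params U, f₀ (z.1, -z.2) = f₀ z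
  odd₁ : ∀ z ∈ params U, f₁ (z.1, -z.2) = -f₁ z
  cr₁ : ∀ z ∈ params U, fderiv ℝ f₀ z (1, 0) = fderiv ℝ f₁ z (0, 1)
  cr₂ : ∀ z ∈ params U, fderiv ℝ f₀ z (0, 1) = -fderiv ℝ f₁ z (1, 0)

/-- `𝒮ℋ_L(U)`: left slice hyperholomorphic functions. -/
def SHL {n : ℕ} (U : Set (Cl n)) : Set (Cl n → Cl n) :=
  {f | ∃ f₀ f₁, IsSliceDecomp U f f₀ f₁}

/-- `𝒩(U)`: intrinsic functions, those with real valued components. -/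
def Intr {n : ℕ} (U : Set (Cl n)) : Set (Cl n → Cl n) :=
  {f | ∃ f₀ f₁, IsSliceDecomp U f f₀ f₁ ∧
    ∀ z ∈ params U, (∃ a : ℝ, f₀ z = algebraMap ℝ (Cl n) a) ∧
      ∃ b : ℝ, f₁ z = algebraMap ℝ (Cl n) b}

/-- `f` is bounded on `D_θ` and `∫_0^∞ |f(t e^{Jφ})| dt / t < ∞` on every ray of `D_θ`. -/
def HasDecay {n : ℕ} (θ : ℝ) (f : Cl n → Cl n) : Prop :=
  (∃ C : ℝ, ∀ s ∈ dblSector n θ, ‖f s‖ ≤ C) ∧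
    ∀ J ∈ Sph n, ∀ φ ∈ angles θ,
      IntegrableOn (fun t : ℝ => ‖f (pol J t φ)‖ / t) (Set.Ioi 0)

/-- `𝒮ℋ_L^0(D_θ)`. -/
def SHLzero (n : ℕ) (θ : ℝ) : Set (Cl n → Cl n) :=
  {f | f ∈ SHL (dblSector n θ) ∧ HasDecay θ f}

/-- `𝒩^0(D_θ)`. -/
def Nzero (n : ℕ) (θ : ℝ) : Set (Cl n → Cl n) :=
  {f | f ∈ Intr (dblSector n θ) ∧ HasDecay θ f}

/-- `f(s) = c_∞ + (1 + s²)⁻¹ (c_0 - c_∞) + g(s)` on `D_θ`. -/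
def IsBndDecomp {n : ℕ} (θ : ℝ) (f : Cl n → Cl n) (c₀ c_inf : Cl n) (g : Cl n → Cl n) : Prop :=
  ∀ s ∈ dblSector n θ, f s = c_inf + Ring.inverse (1 + s ^ 2) * (c₀ - c_inf) + g s

/-- `𝒮ℋ_L^bnd(D_θ)`. -/
def SHLbnd (n : ℕ) (θ : ℝ) : Set (Cl n → Cl n) :=
  {f | ∃ c₀ c_inf : Cl n, ∃ g ∈ SHLzero n θ, IsBndDecomp θ f c₀ c_inf g}

/-- `𝒩^bnd(D_θ)`. -/
def Nbnd (n : ℕ) (θ : ℝ) : Set (Cl n → Cl n) :=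
  {f | ∃ a₀ a_inf : ℝ, ∃ g ∈ Nzero n θ,
    IsBndDecomp θ f (algebraMap ℝ (Cl n) a₀) (algebraMap ℝ (Cl n) a_inf) g}

/-- The rational function `p / q` of a paravector variable (for real `p`, `q` the values `p(s)`
and `q(s)` lie in one plane `ℂ_J`, and `q(s)` is invertible as soon as it is nonzero). -/
noncomputable def ratFun {n : ℕ} (p q : ℝ[X]) (s : Cl n) : Cl n :=
  Polynomial.aeval s p * Ring.inverse (Polynomial.aeval s q)

/-! ### Operators -/

section Operators

variable {n : ℕ} {X : Type*} [NormedAddCommGroup X] [NormedSpace ℝ X]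

/-- `𝒦(V)`: closed right-linear operators with two-sided linear domain. -/
structure IsClosedOperator (T : CliffMod n X →ₗ.[ℝ] CliffMod n X) : Prop where
  lmul_mem : ∀ (s : Cl n) (v : CliffMod n X), v ∈ T.domain → lmul s v ∈ T.domain
  rmul_mem : ∀ (s : Cl n) (v : CliffMod n X), v ∈ T.domain → rmul v s ∈ T.domain
  map_rmul : ∀ (s : Cl n) (v : T.domain), T ⟨rmul v s, rmul_mem s v v.2⟩ = rmul (T v) s
  closed : T.IsClosed

variable {E : Type*} [NormedAddCommGroup E] [NormedSpace ℝ E]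

/-- The product `S T` of partially defined operators, with its natural domain
`{v ∈ dom T | T v ∈ dom S}`. -/
def opMul (S T : E →ₗ.[ℝ] E) : E →ₗ.[ℝ] E where
  domain :=
    { carrier := {v | ∃ h : v ∈ T.domain, T ⟨v, h⟩ ∈ S.domain}
      add_mem' := by
        rintro a b ⟨ha, ha'⟩ ⟨hb, hb'⟩
        refine ⟨T.domain.add_mem ha hb, ?_⟩
        have := S.domain.add_mem ha' hb'
        rwa [← LinearPMap.map_add] at this
      zero_mem' := ⟨T.domain.zero_mem, by
        have h : T ⟨0, T.domain.zero_mem⟩ = 0 := LinearPMap.map_zero T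
        rw [h]; exact S.domain.zero_mem⟩
      smul_mem' := by
        rintro c a ⟨ha, ha'⟩
        refine ⟨T.domain.smul_mem c ha, ?_⟩
        have := S.domain.smul_mem c ha'
        rwa [← LinearPMap.map_smul] at this }
  toFun :=
    { toFun := fun v => S ⟨T ⟨v, v.2.1⟩, v.2.2⟩
      map_add' := fun a b => by
        rw [← LinearPMap.map_add]
        congr 1
        exact Subtype.ext (LinearPMap.map_add T ⟨a, a.2.1⟩ ⟨b, b.2.1⟩)
      map_smul' := fun c a => by
        rw [RingHom.id_apply, ← LinearPMap.map_smul]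
        congr 1
        exact Subtype.ext (LinearPMap.map_smul T c ⟨a, a.2.1⟩) }

/-- An everywhere defined bounded operator, seen as a partially defined operator. -/
def everywhere (B : E →L[ℝ] E) : E →ₗ.[ℝ] E := (B : E →ₗ[ℝ] E).toPMap ⊤

/-- The powers `T^k`, with `dom T^{k+1} = {v ∈ dom T^k | T^k v ∈ dom T}`. -/
def opPow (T : E →ₗ.[ℝ] E) : ℕ → (E →ₗ.[ℝ] E)
  | 0 => everywhere (ContinuousLinearMap.id ℝ E)
  | k + 1 => opMul T (opPow T k)

/-- The polynomial functional calculus `p[T] = ∑_{k ≤ N} p_k T^k`, `N = deg p`; the domain of this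
sum is the intersection of the domains of the `T^k`, which is `dom T^N`. -/
noncomputable def polyOp (T : E →ₗ.[ℝ] E) (p : ℝ[X]) : E →ₗ.[ℝ] E :=
  ∑ k ∈ Finset.range (p.natDegree + 1), p.coeff k • opPow T k

/-- The operator is everywhere defined and bounded. -/
def IsBoundedOp (A : E →ₗ.[ℝ] E) : Prop := ∃ B : E →L[ℝ] E, everywhere B = A

open Classical in
/-- The bounded operator given by an everywhere defined bounded `A` (zero for other `A`). -/
noncomputable def toBounded (A : E →ₗ.[ℝ] E) : E →L[ℝ] E :=
  if h : IsBoundedOp A then h.choose else 0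

/-- `A` is injective and its inverse is everywhere defined and bounded. (The inverse of a
right-linear operator is again right-linear.) -/
def HasBoundedInverse (A : E →ₗ.[ℝ] E) : Prop :=
  Function.Injective A.toFun ∧ IsBoundedOp A.inverse

/-- `Q_s[T] = T² - 2 s_0 T + |s|²`, with domain `dom T²`. -/
noncomputable def Qop (T : CliffMod n X →ₗ.[ℝ] CliffMod n X) (s : Cl n) :
    CliffMod n X →ₗ.[ℝ] CliffMod n X :=
  polyOp T (Polynomial.X ^ 2 - Polynomial.C (2 * s ∅) * Polynomial.X + Polynomial.C (‖s‖ ^ 2))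

/-- The `S`-resolvent set. -/
def resolventSet (T : CliffMod n X →ₗ.[ℝ] CliffMod n X) : Set (Cl n) :=
  {s | s ∈ Para n ∧ HasBoundedInverse (Qop T s)}

/-- The `S`-spectrum. -/
def SSpectrum (T : CliffMod n X →ₗ.[ℝ] CliffMod n X) : Set (Cl n) := Para n \ resolventSet T

/-- The left `S`-resolvent operator `S_L⁻¹(s, T) = Q_s[T]⁻¹ s̄ - T Q_s[T]⁻¹`. -/
noncomputable def SLres (T : CliffMod n X →ₗ.[ℝ] CliffMod n X) (s : Cl n) :
    CliffMod n X →L[ℝ] CliffMod n X :=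
  toBounded (opMul (Qop T s).inverse (everywhere (lmul (conj s))) - opMul T (Qop T s).inverse)

/-- Bisectorial operators of angle `ω`. -/
structure IsBisectorial (T : CliffMod n X →ₗ.[ℝ] CliffMod n X) (ω : ℝ) : Prop where
  closedOp : IsClosedOperator T
  spectrum_subset : SSpectrum T ⊆ closure (dblSector n ω)
  resolvent_bound : ∀ φ ∈ Set.Ioo ω (Real.pi / 2), ∃ C : ℝ, 0 ≤ C ∧
    ∀ s ∈ Para n \ (dblSector n φ ∪ {0}), ‖SLres T s‖ ≤ C / ‖s‖

/-! ### The `ω`-functional calculus and its extension -/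

/-- The two branches `γ_±(t) = ± |t| e^{-sgn(t) J φ}`, `t ∈ ℝ`, of the positively oriented
boundary `∂D_φ ∩ ℂ_J`; `ε = ± 1`. -/
noncomputable def contour (J : Cl n) (φ ε t : ℝ) : Cl n :=
  ε • pol J |t| (-(Real.sign t * φ))

/-- The integrand `S_L⁻¹(γ(t), T) (γ'(t) / J) f(γ(t))`; an operator `A` times a Clifford number
`a` is `v ↦ A (a v)`. -/
noncomputable def omegaIntegrand (T : CliffMod n X →ₗ.[ℝ] CliffMod n X) (J : Cl n) (φ : ℝ)
    (f : Cl n → Cl n) (ε t : ℝ) : CliffMod n X →L[ℝ] CliffMod n X :=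
  (SLres T (contour J φ ε t)).comp
    (lmul (deriv (contour J φ ε) t * Ring.inverse J * f (contour J φ ε t)))

/-- The integral `(1 / 2π) ∫_{∂D_φ ∩ ℂ_J} S_L⁻¹(s, T) ds_J f(s)`. -/
noncomputable def omegaCalc (T : CliffMod n X →ₗ.[ℝ] CliffMod n X) (J : Cl n) (φ : ℝ)
    (f : Cl n → Cl n) : CliffMod n X →L[ℝ] CliffMod n X :=
  (1 / (2 * Real.pi)) • ((∫ t, omegaIntegrand T J φ f 1 t) + ∫ t, omegaIntegrand T J φ f (-1) t)

/-- `F` is the operator `f(T)` of the extended `ω`-functional calculus on `D_θ` of the bisectorial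
operator `T` of angle `ω`: `f` belongs to `𝒮ℋ_L^bnd(D_θ)`, and for every (in fact the unique)
decomposition `f = c_∞ + (1 + s²)⁻¹ (c_0 - c_∞) + g`, every angle `φ ∈ (ω, θ)` and every imaginary
unit `J`, the integral that defines `g(T)` converges absolutely and
`F = c_∞ + (1 + T²)⁻¹ (c_0 - c_∞) + g(T)`. -/
def IsExtendedCalculus (T : CliffMod n X →ₗ.[ℝ] CliffMod n X) (ω θ : ℝ) (f : Cl n → Cl n)
    (F : CliffMod n X →L[ℝ] CliffMod n X) : Prop :=
  f ∈ SHLbnd n θ ∧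
    ∀ c₀ c_inf : Cl n, ∀ g ∈ SHLzero n θ, IsBndDecomp θ f c₀ c_inf g →
      ∀ φ ∈ Set.Ioo ω θ, ∀ J ∈ Sph n,
        Integrable (omegaIntegrand T J φ g 1) ∧ Integrable (omegaIntegrand T J φ g (-1)) ∧
          F = lmul c_inf +
            (toBounded (polyOp T (1 + Polynomial.X ^ 2)).inverse).comp (lmul (c₀ - c_inf)) +
            omegaCalc T J φ g

end Operators

end CliffordCalculus

open CliffordCalculus

open CliffordCalculus

/-! Put `Q = q (1 + X²)`. Its zeros lie off the closed double sector of half-angle `ω`. That sector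
contains the real axis, so the zeros form conjugate pairs and `Q` is a constant times real
quadratics `X² - 2 Re(z) X + |z|²`, each of which has a bounded inverse at `T` because `z`
corresponds to a point of the `S`-resolvent set. Hence every `v` is `Q[T] u` with `u` in the domain
of `T ^ deg Q` (`exists_orbit_of_roots`), and operators can be compared on such `v`. All domain
questions are carried by the finite orbit `w k = T ^ k u`, on which a polynomial `r` takes the value
`evalSeq w r`.

Subtracting the values of `p / q` at `0` and `∞` gives `p (1 + X²) = c_∞ Q + (c₀ - c_∞) q + X R`
with `deg R ≤ deg q`. The first two terms are elementary, so it remains to see that the contour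
integral for `X R / Q` sends `Q[T] u` to `(X R)[T] u` (`omegaCalc_evalSeq`).

On each branch of the contour, the contributions of `s` and of its conjugate are added. Left
multiplication by `J` cancels, and under a real functional `ℓ` there remains twice the real part of
a scalar integral along one ray of the upper half plane (`planeOp_add_conj`). Its kernel is
`resFun`, a substitute for `ℓ ((s - T)⁻¹ ·)` built from `Q_s[T]⁻¹` and `T Q_s[T]⁻¹`. It is
holomorphic in `s` off the sector, by real forms of the resolvent identity.

The scalar problem is solved in `IsResolventSeq.rayIntegral_eq`. Write `f_r` for the kernel applied
to `r[T] u`. Since `s f_k - f_{k+1} = ℓ (w k)`, one has `(P / Q) f_Q = f_P + N / Q` with a real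
polynomial `N` of degree less than `deg Q`, for `P = X R`. The term `f_P` is holomorphic outside the
sector, so its integrals over the rays of arguments `φ` and `π - φ` can be moved onto each other.
The term `N / Q` is holomorphic inside the sector, so its integrals can be moved to the real axis,
where they are real. Both terms decay only like `1 / s`. After the corrections that make this
legitimate, a multiple of `1 / (1 + s²)` remains, and it produces exactly `π ℓ (P[T] u)`.

The value found this way involves neither `φ` nor `J`, which gives the independence of the choices.
The decomposition of a function of `SHLbnd` is unique because `dt / t` is not integrable at `0` or
at `∞`. -/

namespace CliffordCalculus

/-! ### Values of polynomials at sequences -/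

section EvalSeq

variable {E : Type*} [AddCommGroup E] [Module ℝ E]

/-- `∑ p_k w_k`, the value of `p` at the sequence of its would-be powers. -/
noncomputable def evalSeq (w : ℕ → E) : ℝ[X] →ₗ[ℝ] E :=
  Polynomial.lsum fun k => LinearMap.toSpanSingleton ℝ E (w k)

theorem evalSeq_apply (w : ℕ → E) (p : ℝ[X]) :
    evalSeq w p = ∑ k ∈ Finset.range (p.natDegree + 1), p.coeff k • w k := by
  rw [evalSeq, Polynomial.lsum_apply, Polynomial.sum_over_range]
  · simp
  · simp

theorem evalSeq_apply_of_le (w : ℕ → E) {p : ℝ[X]} {N : ℕ} (hN : p.natDegree ≤ N) :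
    evalSeq w p = ∑ k ∈ Finset.range (N + 1), p.coeff k • w k := by
  rw [evalSeq, Polynomial.lsum_apply, Polynomial.sum_over_range' _ _ (N + 1) (by omega)]
  · simp
  · simp

@[simp] theorem evalSeq_monomial (w : ℕ → E) (k : ℕ) (c : ℝ) :
    evalSeq w (Polynomial.monomial k c) = c • w k := by
  simp [evalSeq, Polynomial.lsum_apply]

theorem evalSeq_X_mul (w : ℕ → E) (p : ℝ[X]) :
    evalSeq w (Polynomial.X * p) = evalSeq (fun k => w (k + 1)) p := by
  induction p using Polynomial.induction_on' with
  | add p q hp hq => rw [mul_add, map_add, map_add, hp, hq]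
  | monomial k c => rw [Polynomial.X_mul_monomial, evalSeq_monomial, evalSeq_monomial]

theorem evalSeq_C_mul (w : ℕ → E) (c : ℝ) (p : ℝ[X]) :
    evalSeq w (Polynomial.C c * p) = c • evalSeq w p := by
  rw [← Polynomial.smul_eq_C_mul, map_smul]

end EvalSeq

/-! ### Graphs of products, sums, powers and polynomials of a partially defined operator -/

section Orbits

variable {E : Type*} [NormedAddCommGroup E] [NormedSpace ℝ E] {T : E →ₗ.[ℝ] E}

theorem mem_graph_opMul {A B : E →ₗ.[ℝ] E} {v u : E} :
    (v, u) ∈ (opMul A B).graph ↔ ∃ m, (v, m) ∈ B.graph ∧ (m, u) ∈ A.graph := by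
  simp only [LinearPMap.mem_graph_iff]
  constructor
  · rintro ⟨⟨y, h1, h2⟩, rfl, rfl⟩
    exact ⟨B ⟨y, h1⟩, ⟨⟨y, h1⟩, rfl, rfl⟩, ⟨_, h2⟩, rfl, rfl⟩
  · rintro ⟨m, ⟨y, rfl, rfl⟩, ⟨z, hz, rfl⟩⟩
    refine ⟨⟨y, y.2, hz ▸ z.2⟩, rfl, ?_⟩
    change A ⟨B ⟨y, y.2⟩, _⟩ = A z
    congr 1
    exact Subtype.ext hz.symm

theorem mem_graph_everywhere {B : E →L[ℝ] E} {v u : E} :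
    (v, u) ∈ (everywhere B).graph ↔ B v = u := by
  simp only [LinearPMap.mem_graph_iff]
  constructor
  · rintro ⟨y, rfl, rfl⟩; rfl
  · rintro rfl; exact ⟨⟨v, trivial⟩, rfl, rfl⟩

theorem mem_graph_add {A B : E →ₗ.[ℝ] E} {v u : E} :
    (v, u) ∈ (A + B).graph ↔ ∃ a b, (v, a) ∈ A.graph ∧ (v, b) ∈ B.graph ∧ u = a + b := by
  simp only [LinearPMap.mem_graph_iff]
  constructor
  · rintro ⟨y, rfl, rfl⟩
    exact ⟨_, _, ⟨⟨y, y.2.1⟩, rfl, rfl⟩, ⟨⟨y, y.2.2⟩, rfl, rfl⟩, LinearPMap.add_apply A B y⟩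
  · rintro ⟨a, b, ⟨y, rfl, rfl⟩, ⟨z, hz, rfl⟩, rfl⟩
    refine ⟨⟨y, y.2, hz ▸ z.2⟩, rfl, ?_⟩
    rw [LinearPMap.add_apply]
    congr 2
    exact Subtype.ext hz.symm

theorem mem_graph_sub {A B : E →ₗ.[ℝ] E} {v u : E} :
    (v, u) ∈ (A - B).graph ↔ ∃ a b, (v, a) ∈ A.graph ∧ (v, b) ∈ B.graph ∧ u = a - b := by
  simp only [LinearPMap.mem_graph_iff]
  constructor
  · rintro ⟨y, rfl, rfl⟩
    exact ⟨_, _, ⟨⟨y, y.2.1⟩, rfl, rfl⟩, ⟨⟨y, y.2.2⟩, rfl, rfl⟩, LinearPMap.sub_apply A B y⟩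
  · rintro ⟨a, b, ⟨y, rfl, rfl⟩, ⟨z, hz, rfl⟩, rfl⟩
    refine ⟨⟨y, y.2, hz ▸ z.2⟩, rfl, ?_⟩
    rw [LinearPMap.sub_apply]
    congr 2
    exact Subtype.ext hz.symm

theorem mem_graph_smul {A : E →ₗ.[ℝ] E} {c : ℝ} {v u : E} :
    (v, u) ∈ (c • A).graph ↔ ∃ a, (v, a) ∈ A.graph ∧ u = c • a := by
  simp only [LinearPMap.mem_graph_iff]
  constructor
  · rintro ⟨y, rfl, rfl⟩
    exact ⟨_, ⟨⟨y, y.2⟩, rfl, rfl⟩, LinearPMap.smul_apply c A y⟩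
  · rintro ⟨a, ⟨y, rfl, rfl⟩, rfl⟩
    exact ⟨⟨y, y.2⟩, rfl, LinearPMap.smul_apply c A _⟩

theorem mem_graph_sum {A : ℕ → E →ₗ.[ℝ] E} {c : ℕ → ℝ} (N : ℕ) {v u : E} :
    (v, u) ∈ (∑ k ∈ Finset.range N, c k • A k).graph ↔
      ∃ m : ℕ → E, (∀ k < N, (v, m k) ∈ (A k).graph) ∧ u = ∑ k ∈ Finset.range N, c k • m k := by
  induction N generalizing u with
  | zero =>
    simp only [Finset.range_zero, Finset.sum_empty, LinearPMap.mem_graph_iff]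
    constructor
    · rintro ⟨y, rfl, rfl⟩
      exact ⟨0, by simp, rfl⟩
    · rintro ⟨m, -, rfl⟩
      exact ⟨⟨v, trivial⟩, rfl, rfl⟩
  | succ N ih =>
    rw [Finset.sum_range_succ, mem_graph_add]
    constructor
    · rintro ⟨a, b, ha, hb, rfl⟩
      obtain ⟨m, hm, rfl⟩ := ih.1 ha
      obtain ⟨b, hb, rfl⟩ := mem_graph_smul.1 hb
      refine ⟨Function.update m N b, fun k hk => ?_, ?_⟩
      · rcases Nat.lt_succ_iff_lt_or_eq.1 hk with h | rfl
        · rw [Function.update_of_ne h.ne]; exact hm k h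
        · rwa [Function.update_self]
      · rw [Finset.sum_range_succ, Function.update_self]
        congr 1
        refine Finset.sum_congr rfl fun k hk => ?_
        rw [Function.update_of_ne (Finset.mem_range.1 hk).ne]
    · rintro ⟨m, hm, rfl⟩
      exact ⟨_, _, ih.2 ⟨m, fun k hk => hm k (hk.trans (Nat.lt_succ_self N)), rfl⟩,
        mem_graph_smul.2 ⟨_, hm N (Nat.lt_succ_self N), rfl⟩, Finset.sum_range_succ _ _⟩

/-- `w 0, T (w 0), …, T ^ N (w 0)` are the first `N + 1` terms of `w`. -/
def IsOrbit (T : E →ₗ.[ℝ] E) (N : ℕ) (w : ℕ → E) : Prop := ∀ i < N, (w i, w (i + 1)) ∈ T.graph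

theorem IsOrbit.mono {N M : ℕ} {w : ℕ → E} (h : IsOrbit T N w) (hM : M ≤ N) : IsOrbit T M w :=
  fun i hi => h i (hi.trans_le hM)

theorem mem_graph_opPow {k : ℕ} {v u : E} :
    (v, u) ∈ (opPow T k).graph ↔ ∃ w, IsOrbit T k w ∧ w 0 = v ∧ w k = u := by
  induction k generalizing u with
  | zero =>
    rw [opPow, mem_graph_everywhere]
    constructor
    · rintro rfl
      exact ⟨fun _ => v, fun i hi => absurd hi (Nat.not_lt_zero i), rfl, rfl⟩
    · rintro ⟨w, -, rfl, rfl⟩; rfl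
  | succ k ih =>
    rw [opPow, mem_graph_opMul]
    constructor
    · rintro ⟨m, h1, h2⟩
      obtain ⟨w, hw, rfl, rfl⟩ := ih.1 h1
      refine ⟨Function.update w (k + 1) u, fun i hi => ?_, ?_, by simp⟩
      · rcases Nat.lt_succ_iff_lt_or_eq.1 hi with h | rfl
        · rw [Function.update_of_ne (by omega), Function.update_of_ne (by omega)]
          exact hw i h
        · rw [Function.update_of_ne (by omega), Function.update_self]
          exact h2
      · rw [Function.update_of_ne (by omega)]
    · rintro ⟨w, hw, rfl, rfl⟩
      exact ⟨w k, ih.2 ⟨w, hw.mono k.le_succ, rfl, rfl⟩, hw k k.lt_succ_self⟩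

/-- This replaces sums of unbounded operators by finite orbits: afterwards only the graph of `T` and
linear combinations of the terms of `w` occur. Terms of `w` beyond index `natDegree` are arbitrary
and have no influence. -/
theorem mem_graph_polyOp {p : ℝ[X]} {v u : E} :
    (v, u) ∈ (polyOp T p).graph ↔
      ∃ w, IsOrbit T p.natDegree w ∧ w 0 = v ∧ evalSeq w p = u := by
  rw [polyOp, mem_graph_sum]
  constructor
  · rintro ⟨m, hm, rfl⟩
    obtain ⟨w, hw, rfl, hwN⟩ := mem_graph_opPow.1 (hm p.natDegree p.natDegree.lt_succ_self)
    refine ⟨w, hw, rfl, ?_⟩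
    rw [evalSeq_apply]
    refine Finset.sum_congr rfl fun k hk => ?_
    have hk' := Finset.mem_range.1 hk
    rw [(opPow T k).mem_graph_snd_inj (hm k hk')
      (mem_graph_opPow.2 ⟨w, hw.mono (Nat.lt_succ_iff.1 hk'), rfl, rfl⟩) rfl]
  · rintro ⟨w, hw, rfl, rfl⟩
    exact ⟨w, fun k hk => mem_graph_opPow.2 ⟨w, hw.mono (Nat.lt_succ_iff.1 hk), rfl, rfl⟩,
      evalSeq_apply w p⟩

/-- The graph of `T` applied to a polynomial in `T`. -/
theorem IsOrbit.evalSeq_mem_graph {N : ℕ} {w : ℕ → E} (hw : IsOrbit T N w) {p : ℝ[X]}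
    (hp : p.natDegree < N) : (evalSeq w p, evalSeq w (Polynomial.X * p)) ∈ T.graph := by
  rw [evalSeq_X_mul, evalSeq_apply, evalSeq_apply]
  have : (∑ k ∈ Finset.range (p.natDegree + 1), p.coeff k • (w k, w (k + 1))) ∈ T.graph :=
    Submodule.sum_mem _ fun k hk => Submodule.smul_mem _ _ (hw k (by
      have := Finset.mem_range.1 hk; omega))
  convert this using 1
  rw [Prod.ext_iff]
  simp [Prod.fst_sum, Prod.snd_sum]

theorem mem_graph_inverse {A : E →ₗ.[ℝ] E} (hA : Function.Injective A.toFun) {v u : E} :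
    (v, u) ∈ A.inverse.graph ↔ (u, v) ∈ A.graph := by
  rw [LinearPMap.inverse_graph (LinearMap.ker_eq_bot.2 hA)]
  simp

theorem injective_iff_graph {A : E →ₗ.[ℝ] E} :
    Function.Injective A.toFun ↔ ∀ u, (u, (0 : E)) ∈ A.graph → u = 0 := by
  rw [injective_iff_map_eq_zero]
  constructor
  · intro h u hu
    obtain ⟨y, rfl, hy⟩ := (LinearPMap.mem_graph_iff A).1 hu
    exact congrArg Subtype.val (h y hy)
  · intro h u hu
    exact Subtype.ext (h u ((LinearPMap.mem_graph_iff A).2 ⟨u, rfl, hu⟩))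

theorem surjective_iff_graph {A : E →ₗ.[ℝ] E} :
    Function.Surjective A.toFun ↔ ∀ v, ∃ u, (u, v) ∈ A.graph := by
  constructor
  · intro h v
    obtain ⟨y, hy⟩ := h v
    exact ⟨y, (LinearPMap.mem_graph_iff A).2 ⟨y, rfl, hy⟩⟩
  · intro h v
    obtain ⟨u, hu⟩ := h v
    obtain ⟨y, -, hy⟩ := (LinearPMap.mem_graph_iff A).1 hu
    exact ⟨y, hy⟩

theorem everywhere_injective : Function.Injective (everywhere : (E →L[ℝ] E) → E →ₗ.[ℝ] E) := by
  intro A B h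
  ext v
  have : (v, A v) ∈ (everywhere B).graph := h ▸ mem_graph_everywhere.2 rfl
  exact (mem_graph_everywhere.1 this).symm

theorem toBounded_everywhere (B : E →L[ℝ] E) : toBounded (everywhere B) = B := by
  have h : IsBoundedOp (everywhere B) := ⟨B, rfl⟩
  rw [toBounded, dif_pos h]
  exact everywhere_injective h.choose_spec

theorem eq_everywhere_iff {A : E →ₗ.[ℝ] E} {B : E →L[ℝ] E} :
    everywhere B = A ↔ ∀ v, (v, B v) ∈ A.graph := by
  constructor
  · rintro rfl v
    exact mem_graph_everywhere.2 rfl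
  · intro h
    refine LinearPMap.eq_of_le_of_domain_eq (LinearPMap.le_of_le_graph ?_) ?_
    · rintro ⟨v, u⟩ hv
      rw [← mem_graph_everywhere.1 hv]; exact h v
    · refine (eq_top_iff.2 fun v _ => ?_).symm
      exact LinearPMap.mem_domain_of_mem_graph (h v)

theorem toBounded_eq {A : E →ₗ.[ℝ] E} {B : E →L[ℝ] E} (h : ∀ v, (v, B v) ∈ A.graph) :
    toBounded A = B := by
  rw [← eq_everywhere_iff.2 h, toBounded_everywhere]

end Orbits

/-! ### Inverses of real quadratic polynomials of an operator -/

section Quadratic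

variable {E : Type*} [NormedAddCommGroup E] [NormedSpace ℝ E] {T : E →ₗ.[ℝ] E}

/-- `R = (T² - 2 a T + b)⁻¹` and `S = T R`. -/
structure QuadInv (T : E →ₗ.[ℝ] E) (a b : ℝ) (R S : E →L[ℝ] E) : Prop where
  graph₁ : ∀ v, (R v, S v) ∈ T.graph
  graph₂ : ∀ v, (S v, v + (2 * a) • S v - b • R v) ∈ T.graph
  left_inv : ∀ u u₁ u₂, (u, u₁) ∈ T.graph → (u₁, u₂) ∈ T.graph → R (u₂ - (2 * a) • u₁ + b • u) = u

/-- The real quadratic polynomial `X² - 2 a X + b`. -/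
noncomputable def quadPoly (a b : ℝ) : ℝ[X] :=
  Polynomial.X ^ 2 - Polynomial.C (2 * a) * Polynomial.X + Polynomial.C b

theorem natDegree_quadPoly (a b : ℝ) : (quadPoly a b).natDegree = 2 := by
  unfold quadPoly; compute_degree!

theorem monic_quadPoly (a b : ℝ) : (quadPoly a b).Monic := by
  unfold quadPoly; monicity!

theorem evalSeq_quadPoly_mul (a b : ℝ) (w : ℕ → E) (p : ℝ[X]) :
    evalSeq w (quadPoly a b * p) =
      evalSeq (fun k => w (k + 2) - (2 * a) • w (k + 1) + b • w k) p := by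
  induction p using Polynomial.induction_on' with
  | add p q hp hq => rw [mul_add, map_add, map_add, hp, hq]
  | monomial k c =>
    have h : quadPoly a b * Polynomial.monomial k c = Polynomial.monomial (k + 2) c -
        Polynomial.C (2 * a) * Polynomial.monomial (k + 1) c +
        Polynomial.C b * Polynomial.monomial k c := by
      rw [← Polynomial.X_mul_monomial, ← Polynomial.X_mul_monomial, quadPoly]
      ring
    rw [h, map_add, map_sub, evalSeq_C_mul, evalSeq_C_mul]
    simp only [evalSeq_monomial, smul_add, smul_sub]
    rw [smul_comm c, smul_comm c b]

theorem evalSeq_quadPoly (a b : ℝ) (w : ℕ → E) :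
    evalSeq w (quadPoly a b) = w 2 - (2 * a) • w 1 + b • w 0 := by
  have := evalSeq_quadPoly_mul a b w 1
  rw [mul_one] at this
  rw [this, ← Polynomial.C_1, ← Polynomial.monomial_zero_left, evalSeq_monomial, one_smul]

theorem mem_graph_quadPoly {a b : ℝ} {u v : E} :
    (u, v) ∈ (polyOp T (quadPoly a b)).graph ↔
      ∃ u₁ u₂, (u, u₁) ∈ T.graph ∧ (u₁, u₂) ∈ T.graph ∧ u₂ - (2 * a) • u₁ + b • u = v := by
  rw [mem_graph_polyOp, natDegree_quadPoly]
  simp only [evalSeq_quadPoly]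
  constructor
  · rintro ⟨w, hw, rfl, rfl⟩
    exact ⟨w 1, w 2, hw 0 (by norm_num), hw 1 (by norm_num), rfl⟩
  · rintro ⟨u₁, u₂, h1, h2, rfl⟩
    refine ⟨fun k => match k with | 0 => u | 1 => u₁ | _ => u₂, fun i hi => ?_, rfl, rfl⟩
    interval_cases i
    · exact h1
    · exact h2

/-- The operators `R` and `S` exist when the quadratic polynomial has a bounded inverse. -/
theorem exists_quadInv [CompleteSpace E] (hT : T.IsClosed) {a b : ℝ}
    (h : HasBoundedInverse (polyOp T (quadPoly a b))) : ∃ R S, QuadInv T a b R S := by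
  obtain ⟨hinj, R, hR⟩ := h
  have key : ∀ v, ∃ u₁ u₂, (R v, u₁) ∈ T.graph ∧ (u₁, u₂) ∈ T.graph ∧
      u₂ - (2 * a) • u₁ + b • R v = v := fun v =>
    mem_graph_quadPoly.1 ((mem_graph_inverse hinj).1 (eq_everywhere_iff.1 hR v))
  have hdom : ∀ v, R v ∈ T.domain := fun v => by
    obtain ⟨u₁, -, h, -⟩ := key v
    exact LinearPMap.mem_domain_of_mem_graph h
  let S₀ : E →ₗ[ℝ] E := T.toFun ∘ₗ (R : E →ₗ[ℝ] E).codRestrict T.domain hdom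
  have hS₀ : ∀ v, (R v, S₀ v) ∈ T.graph := fun v => T.mem_graph ⟨R v, hdom v⟩
  -- The graph of `S₀ = T R` is the preimage of the closed graph of `T` under `(v, u) ↦ (R v, u)`,
  -- so the closed graph theorem applies.
  have hcont : Continuous S₀ := by
    refine LinearMap.continuous_of_isClosed_graph S₀ ?_
    have : (S₀.graph : Set (E × E)) = (fun x : E × E => (R x.1, x.2)) ⁻¹'
        (T.graph : Set (E × E)) := by
      ext ⟨v, u⟩
      simp only [SetLike.mem_coe, LinearMap.mem_graph_iff, Set.mem_preimage]
      constructor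
      · rintro rfl; exact hS₀ v
      · intro hu; exact T.mem_graph_snd_inj hu (hS₀ v) rfl
    rw [this]
    exact IsClosed.preimage (by fun_prop) hT
  refine ⟨R, ⟨S₀, hcont⟩, hS₀, fun v => ?_, fun u u₁ u₂ h1 h2 => ?_⟩
  · obtain ⟨u₁, u₂, h1, h2, h3⟩ := key v
    have e1 : u₁ = S₀ v := T.mem_graph_snd_inj h1 (hS₀ v) rfl
    have e2 : u₂ = v + (2 * a) • S₀ v - b • R v := by rw [← e1]; nth_rw 1 [← h3]; abel
    change (S₀ v, v + (2 * a) • S₀ v - b • R v) ∈ T.graph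
    rw [← e2, ← e1]; exact h2
  · have h3 : (u, u₂ - (2 * a) • u₁ + b • u) ∈ (polyOp T (quadPoly a b)).graph :=
      mem_graph_quadPoly.2 ⟨u₁, u₂, h1, h2, rfl⟩
    have h4 := (mem_graph_inverse hinj).2 h3
    exact (polyOp T (quadPoly a b)).inverse.mem_graph_snd_inj (eq_everywhere_iff.1 hR _) h4 rfl

/-! ### Commutation relations and resolvent identities for the inverses of real quadratics in `T`.
-/

namespace QuadInv

variable {a b a' b' : ℝ} {R S R' S' : E →L[ℝ] E}

theorem injective (h : QuadInv T a b R S) : Function.Injective (polyOp T (quadPoly a b)).toFun :=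
  injective_iff_graph.2 fun u hu => by
    obtain ⟨u₁, u₂, h1, h2, h3⟩ := mem_graph_quadPoly.1 hu
    have := h.left_inv u u₁ u₂ h1 h2
    rwa [h3, map_zero, eq_comm] at this

theorem mem_graph_inverse_quadPoly (h : QuadInv T a b R S) (v : E) :
    (v, R v) ∈ (polyOp T (quadPoly a b)).inverse.graph :=
  (mem_graph_inverse h.injective).2
    (mem_graph_quadPoly.2 ⟨_, _, h.graph₁ v, h.graph₂ v, by abel⟩)

theorem toBounded_inverse (h : QuadInv T a b R S) :
    toBounded (polyOp T (quadPoly a b)).inverse = R :=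
  toBounded_eq h.mem_graph_inverse_quadPoly

theorem toBounded_resolvent (h : QuadInv T a b R S) (L : E →L[ℝ] E) :
    toBounded (opMul (polyOp T (quadPoly a b)).inverse (everywhere L) -
      opMul T (polyOp T (quadPoly a b)).inverse) = R.comp L - S :=
  toBounded_eq fun v => mem_graph_sub.2 ⟨R (L v), S v,
    mem_graph_opMul.2 ⟨L v, mem_graph_everywhere.2 rfl, h.mem_graph_inverse_quadPoly _⟩,
    mem_graph_opMul.2 ⟨R v, h.mem_graph_inverse_quadPoly v, h.graph₁ v⟩, rfl⟩

/-- `R` commutes with `T`: applying `T² - 2aT + b` to `S u` telescopes to `u'`, so `left_inv` at `S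
u` gives the claim. -/
theorem comm (h : QuadInv T a b R S) {u u' : E} (hu : (u, u') ∈ T.graph) : R u' = S u := by
  have h1 : (v : E) → (R v, S v) ∈ T.graph := h.graph₁
  set c := u + (2 * a) • S u - b • R u with hc
  have h2 : (c, u' + (2 * a) • c - b • S u) ∈ T.graph := by
    have := T.graph.sub_mem (T.graph.add_mem hu (T.graph.smul_mem (2 * a) (h.graph₂ u)))
      (T.graph.smul_mem b (h1 u))
    exact this
  have h3 := h.left_inv (S u) c _ (h.graph₂ u) h2
  rw [← h3]
  congr 1
  abel

theorem map_graph (h : QuadInv T a b R S) {u u' : E} (hu : (u, u') ∈ T.graph) :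
    (R u, R u') ∈ T.graph := by
  rw [h.comm hu]; exact h.graph₁ u

theorem map_graph' (h : QuadInv T a b R S) {u u' : E} (hu : (u, u') ∈ T.graph) :
    (S u, S u') ∈ T.graph := by
  rw [← h.comm hu]; exact h.graph₁ u'

theorem R_R (h : QuadInv T a b R S) (h' : QuadInv T a' b' R' S') (v : E) : R (R' v) = R' (R v) := by
  have := h.left_inv _ _ _ (h'.map_graph (h.graph₁ v)) (h'.map_graph (h.graph₂ v))
  rw [← this]
  simp only [map_add, map_sub, map_smul]
  abel

theorem R_S (h : QuadInv T a b R S) (h' : QuadInv T a' b' R' S') (v : E) : R (S' v) = S (R' v) :=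
  h.comm (h'.graph₁ v)

theorem R_S_swap (h : QuadInv T a b R S) (h' : QuadInv T a' b' R' S') (v : E) :
    R (S' v) = R' (S v) := by
  rw [h.R_S h']
  exact T.mem_graph_snd_inj (h.graph₁ _) (h'.map_graph (h.graph₁ v)) (h.R_R h' v)

theorem S_S (h : QuadInv T a b R S) (h' : QuadInv T a' b' R' S') (v : E) : S (S' v) = S' (S v) :=
  T.mem_graph_snd_inj (h.map_graph' (h'.graph₁ v)) (h'.graph₁ (S v))
    (by rw [← h.R_S h', h.R_S_swap h'])

theorem R_eq (h : QuadInv T a b R S) (h' : QuadInv T a' b' R' S') (v : E) :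
    R v = S (S' v) - (2 * a') • R (S' v) + b' • R (R' v) := by
  rw [← h.comm (h'.graph₂ v)]
  simp only [map_add, map_sub, map_smul]
  abel

/-- Computing `S T S' v` in two ways, with each factor's own quadratic relation, gives a resolvent
identity in real form. Together with `R_sub_R` it yields continuity and then holomorphy in the
spectral parameter. -/
theorem S_sub_S (h : QuadInv T a b R S) (h' : QuadInv T a' b' R' S') (v : E) :
    S v - S' v = (2 * (a - a')) • S (S' v) + (b' - b) • R (S' v) := by
  have h1 := T.mem_graph_snd_inj (h.map_graph' (h'.graph₂ v)) (h'.map_graph' (h.graph₂ v))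
    (h.S_S h' v)
  simp only [map_add, map_sub, map_smul] at h1
  rw [← h.S_S h', ← h.R_S h', ← h'.R_S h, ← h.R_S_swap h'] at h1
  have h2 : S v = S' v + (2 * a) • S (S' v) - b • R (S' v) - (2 * a') • S (S' v)
      + b' • R (S' v) := by rw [← h1]; abel
  rw [h2]
  module

theorem R_sub_R (h : QuadInv T a b R S) (h' : QuadInv T a' b' R' S') (v : E) :
    R v - R' v = (2 * (a - a')) • R (S' v) + (b' - b) • R (R' v) := by
  have h1 := h.R_eq h' v
  have h2 := h'.R_eq h v
  rw [← h.S_S h', ← h.R_S_swap h', ← h.R_R h'] at h2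
  have h3 : R v - R' v = (S (S' v) - (2 * a') • R (S' v) + b' • R (R' v)) -
      (S (S' v) - (2 * a) • R (S' v) + b • R (R' v)) := by rw [← h1, ← h2]
  rw [h3]
  module

end QuadInv

/-- A real polynomial in `T` is bijective when the quadratic factors coming from its complex roots
are boundedly invertible. -/
theorem exists_orbit_of_roots (q : ℝ[X]) (hq : q ≠ 0)
    (h : ∀ z : ℂ, Polynomial.aeval z q = 0 →
      z.im ≠ 0 ∧ ∃ R S, QuadInv T z.re (‖z‖ ^ 2) R S) :
    (∀ v, ∃ w, IsOrbit T q.natDegree w ∧ evalSeq w q = v) ∧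
      ∀ w, IsOrbit T q.natDegree w → evalSeq w q = 0 → w 0 = 0 := by
  induction hN : q.natDegree using Nat.strong_induction_on generalizing q with
  | _ N ih =>
  subst hN
  by_cases hdeg : q.natDegree = 0
  · obtain ⟨c, rfl⟩ := Polynomial.natDegree_eq_zero.1 hdeg
    have hc : c ≠ 0 := by rintro rfl; simp at hq
    have hev : ∀ w : ℕ → E, evalSeq w (Polynomial.C c) = c • w 0 := fun w => by
      rw [← Polynomial.monomial_zero_left, evalSeq_monomial]
    rw [hdeg]
    refine ⟨fun v => ⟨fun _ => c⁻¹ • v, fun i hi => absurd hi (Nat.not_lt_zero i), ?_⟩,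
      fun w _ hw => ?_⟩
    · rw [hev, smul_smul, mul_inv_cancel₀ hc, one_smul]
    · rw [hev] at hw
      exact (smul_eq_zero.1 hw).resolve_left hc
  · obtain ⟨z, hz⟩ := IsAlgClosed.exists_aeval_eq_zero ℂ q
      (fun h0 => hdeg (Polynomial.natDegree_eq_of_degree_eq_some h0))
    obtain ⟨him, R, S, hRS⟩ := h z hz
    -- A non-real root of a real polynomial comes with its conjugate, so their common quadratic
    -- splits off and the degree drops by two.
    obtain ⟨q', rfl⟩ : quadPoly z.re (‖z‖ ^ 2) ∣ q :=
      Polynomial.quadratic_dvd_of_aeval_eq_zero_im_ne_zero q hz him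
    have hq' : q' ≠ 0 := right_ne_zero_of_mul hq
    have hnd : (quadPoly z.re (‖z‖ ^ 2) * q').natDegree = q'.natDegree + 2 := by
      rw [(monic_quadPoly _ _).natDegree_mul' hq', natDegree_quadPoly, add_comm]
    obtain ⟨ih1, ih2⟩ := ih q'.natDegree (by omega) q' hq'
      (fun x hx => h x (by rw [map_mul, hx, mul_zero])) rfl
    rw [hnd]
    refine ⟨fun v => ?_, fun w hw hw0 => ?_⟩
    · obtain ⟨w', hw', hv⟩ := ih1 v
      -- The pairs `(T ^ k R w'₀, T ^ (k+1) R w'₀)`. The quadratic relation forces each next term,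
      -- so this orbit reaches two steps further than that of `w'`, and applying the quadratic in
      -- the shift returns `w'` at every index.
      let f : ℕ → E × E := fun k => k.rec (R (w' 0), S (w' 0)) fun k x =>
        (x.2, w' k + (2 * z.re) • x.2 - (‖z‖ ^ 2) • x.1)
      have hf : ∀ k ≤ q'.natDegree, f k = (R (w' k), S (w' k)) := by
        intro k
        induction k with
        | zero => intro _; rfl
        | succ k ihk =>
          intro hk
          have h1 : f (k + 1) = ((f k).2, w' k + (2 * z.re) • (f k).2 - (‖z‖ ^ 2) • (f k).1) := rfl
          have hg := hw' k (by omega)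
          rw [h1, ihk (by omega)]
          refine Prod.ext (hRS.comm hg).symm ?_
          exact T.mem_graph_snd_inj (hRS.graph₂ (w' k)) (hRS.graph₁ (w' (k + 1)))
            (hRS.comm hg).symm
      have hstep : ∀ k, (f (k + 1)).1 = (f k).2 := fun k => rfl
      have hstep2 : ∀ k, (f (k + 2)).1 = w' k + (2 * z.re) • (f k).2 - (‖z‖ ^ 2) • (f k).1 :=
        fun k => rfl
      refine ⟨fun k => (f k).1, fun i hi => ?_, ?_⟩
      · change ((f i).1, (f (i + 1)).1) ∈ T.graph
        rcases Nat.lt_succ_iff_lt_or_eq.1 hi with hi | rfl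
        · rw [hstep, hf i (by omega)]
          exact hRS.graph₁ _
        · rw [hstep2, hstep, hf _ le_rfl]
          exact hRS.graph₂ _
      · rw [evalSeq_quadPoly_mul, ← hv]
        congr 1
        congr 1
        funext k
        simp only [hstep2, hstep]
        abel
    · rw [evalSeq_quadPoly_mul] at hw0
      have h0 := ih2 _ (fun i hi => ?_) hw0
      · have := hRS.left_inv _ _ _ (hw 0 (by omega)) (hw 1 (by omega))
        rw [← this]
        rw [h0, map_zero]
      · exact T.graph.add_mem (T.graph.sub_mem (hw (i + 2) (by omega))
          (T.graph.smul_mem _ (hw (i + 1) (by omega)))) (T.graph.smul_mem _ (hw i (by omega)))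

theorem polyOp_bijective {q : ℝ[X]} (hq : q ≠ 0)
    (h : ∀ z : ℂ, Polynomial.aeval z q = 0 →
      z.im ≠ 0 ∧ ∃ R S, QuadInv T z.re (‖z‖ ^ 2) R S) :
    Function.Bijective (polyOp T q).toFun := by
  obtain ⟨h1, h2⟩ := exists_orbit_of_roots q hq h
  refine ⟨injective_iff_graph.2 fun u hu => ?_, surjective_iff_graph.2 fun v => ?_⟩
  · obtain ⟨w, hw, rfl, hw0⟩ := mem_graph_polyOp.1 hu
    exact h2 w hw hw0
  · obtain ⟨w, hw, hv⟩ := h1 v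
    exact ⟨w 0, mem_graph_polyOp.2 ⟨w, hw, rfl, hv⟩⟩

end Quadratic

/-! ### Integrals along rays -/

section Rays

open Complex Filter Topology

/-- The integral of `F` along the ray of argument `α`. -/
noncomputable def rayIntegral (F : ℂ → ℂ) (α : ℝ) : ℂ :=
  ∫ t in Set.Ioi (0 : ℝ), F (t * exp (α * I)) * exp (α * I)

/-- `F` is holomorphic on the closed sector of the arguments in `[α, β]`, without its vertex, and
decays there. -/
def RayDecay (F : ℂ → ℂ) (α β : ℝ) : Prop :=
  ∃ C : ℝ, ∀ r : ℝ, 0 < r → ∀ y ∈ Set.Icc α β, DifferentiableAt ℂ F (r * exp (y * I)) ∧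
    ‖F (r * exp (y * I))‖ ≤ C / (1 + r ^ 2)

theorem norm_ray (t α : ℝ) (ht : 0 < t) : ‖(t : ℂ) * exp (α * I)‖ = t := by
  rw [norm_mul, norm_exp_ofReal_mul_I, mul_one, norm_real, Real.norm_of_nonneg ht.le]

theorem integrableOn_of_le_inv_one_add_sq {E : Type*} [NormedAddCommGroup E] {f : ℝ → E} {C : ℝ}
    (hc : ContinuousOn f (Set.Ioi 0)) (hf : ∀ t, 0 < t → ‖f t‖ ≤ C / (1 + t ^ 2)) :
    IntegrableOn f (Set.Ioi 0) := by
  refine Integrable.mono' (g := fun t => C * (1 + t ^ 2)⁻¹)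
    (integrable_inv_one_add_sq.const_mul C).integrableOn
    (hc.aestronglyMeasurable measurableSet_Ioi) ?_
  filter_upwards [ae_restrict_mem measurableSet_Ioi] with t ht
  rw [← div_eq_mul_inv]
  exact hf t ht

theorem RayDecay.integrableOn {F : ℂ → ℂ} {α β : ℝ} (h : RayDecay F α β) {y : ℝ}
    (hy : y ∈ Set.Icc α β) :
    IntegrableOn (fun t : ℝ => F (t * exp (y * I)) * exp (y * I)) (Set.Ioi 0) := by
  obtain ⟨C, hC⟩ := h
  refine integrableOn_of_le_inv_one_add_sq (C := C) (fun t ht => ?_) fun t ht => ?_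
  · refine ContinuousAt.continuousWithinAt ?_
    have h1 : ContinuousAt F ((t : ℂ) * exp (y * I)) := (hC t ht y hy).1.continuousAt
    have h2 : ContinuousAt (fun t : ℝ => (t : ℂ) * exp (y * I)) t := by fun_prop
    exact (ContinuousAt.comp (f := fun t : ℝ => (t : ℂ) * exp (y * I)) h1 h2).mul_const _
  · rw [norm_mul, norm_exp_ofReal_mul_I, mul_one]
    exact (hC t ht y hy).2

theorem image_exp_univ : Real.exp '' Set.univ = Set.Ioi 0 := by
  rw [Set.image_univ, Real.range_exp]

/-- The substitution `t = e^x` turns a sector into a horizontal strip, where Cauchy's theorem for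
rectangles is available. -/
theorem rayIntegral_eq_line (F : ℂ → ℂ) (α : ℝ) :
    rayIntegral F α = ∫ x : ℝ, F (exp (x + α * I)) * exp (x + α * I) := by
  rw [rayIntegral, ← image_exp_univ, integral_image_eq_integral_abs_deriv_smul MeasurableSet.univ
    (fun x _ => (Real.hasDerivAt_exp x).hasDerivWithinAt) Real.exp_injective.injOn,
    Measure.restrict_univ]
  refine integral_congr_ae (Eventually.of_forall fun x => ?_)
  simp only [abs_of_pos (Real.exp_pos x), exp_add, real_smul, ofReal_exp]
  ring

theorem integrable_line {F : ℂ → ℂ} {α : ℝ}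
    (h : IntegrableOn (fun t : ℝ => F (t * exp (α * I)) * exp (α * I)) (Set.Ioi 0)) :
    Integrable fun x : ℝ => F (exp (x + α * I)) * exp (x + α * I) := by
  rw [← image_exp_univ, integrableOn_image_iff_integrableOn_abs_deriv_smul MeasurableSet.univ
    (fun x _ => (Real.hasDerivAt_exp x).hasDerivWithinAt) Real.exp_injective.injOn,
    integrableOn_univ] at h
  refine h.congr (Eventually.of_forall fun x => ?_)
  simp only [abs_of_pos (Real.exp_pos x), exp_add, real_smul, ofReal_exp]
  ring

/-- Cauchy's theorem for a sector. -/
theorem RayDecay.rayIntegral_eq {F : ℂ → ℂ} {α β : ℝ} (h : RayDecay F α β) (hαβ : α ≤ β) :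
    rayIntegral F α = rayIntegral F β := by
  have hα := integrable_line (h.integrableOn (Set.left_mem_Icc.2 hαβ))
  have hβ := integrable_line (h.integrableOn (Set.right_mem_Icc.2 hαβ))
  rw [rayIntegral_eq_line, rayIntegral_eq_line]
  obtain ⟨C, hC⟩ := h
  set G : ℂ → ℂ := fun z => F (exp z) * exp z with hG
  have hexp : ∀ x y : ℝ, exp ((x : ℂ) + y * I) = (Real.exp x : ℝ) * exp (y * I) := fun x y => by
    rw [exp_add, ofReal_exp]
  have hbound : ∀ x : ℝ, ∀ y ∈ Set.Icc α β, ‖G (x + y * I)‖ ≤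
      C / (1 + Real.exp x ^ 2) * Real.exp x := by
    intro x y hy
    simp only [hG, hexp, norm_mul _ (_ * _ : ℂ)]
    rw [norm_ray _ _ (Real.exp_pos x)]
    exact mul_le_mul_of_nonneg_right (hC _ (Real.exp_pos x) y hy).2 (Real.exp_pos x).le
  have hC0 : 0 ≤ C := by
    have := (norm_nonneg _).trans (hC 1 one_pos α (Set.left_mem_Icc.2 hαβ)).2
    norm_num at this
    linarith
  -- The two bounds control the vertical sides of the rectangle, at `+∞` and at `-∞` respectively;
  -- both sides contribute `O(e^{-r})`.
  have hb1 : ∀ x : ℝ, C / (1 + Real.exp x ^ 2) * Real.exp x ≤ C * Real.exp (-x) := fun x => by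
    have := Real.exp_pos x
    rw [Real.exp_neg, div_mul_eq_mul_div, div_le_iff₀ (by positivity)]
    have : C * (Real.exp x)⁻¹ * (1 + Real.exp x ^ 2) = C * (Real.exp x)⁻¹ + C * Real.exp x := by
      field_simp
    rw [this]
    have : 0 ≤ C * (Real.exp x)⁻¹ := by positivity
    linarith
  have hb2 : ∀ x : ℝ, C / (1 + Real.exp x ^ 2) * Real.exp x ≤ C * Real.exp x := fun x => by
    have := Real.exp_pos x
    refine mul_le_mul_of_nonneg_right (div_le_self hC0 ?_) this.le
    nlinarith [sq_nonneg (Real.exp x)]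
  have hrect : ∀ r : ℝ, (∫ x in (-r)..r, G (x + α * I)) - (∫ x in (-r)..r, G (x + β * I)) =
      I • (∫ y in α..β, G ((-r : ℝ) + y * I)) - I • (∫ y in α..β, G (r + y * I)) := by
    intro r
    have := integral_boundary_rect_eq_zero_of_differentiableOn G ⟨-r, α⟩ ⟨r, β⟩ ?_
    · simp only at this
      linear_combination this
    · intro z hz
      rw [mem_reProdIm, Set.uIcc_of_le hαβ] at hz
      have h1 : exp z = (Real.exp z.re : ℝ) * exp (z.im * I) := by rw [← hexp, re_add_im]
      have h2 := (hC _ (Real.exp_pos z.re) z.im hz.2).1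
      rw [← h1] at h2
      refine DifferentiableAt.differentiableWithinAt ?_
      exact (DifferentiableAt.comp z h2 differentiableAt_exp).mul differentiableAt_exp
  have hl := intervalIntegral_tendsto_integral hα tendsto_neg_atTop_atBot tendsto_id
  have hr := intervalIntegral_tendsto_integral hβ tendsto_neg_atTop_atBot tendsto_id
  have hz : Tendsto (fun r : ℝ => I • (∫ y in α..β, G ((-r : ℝ) + y * I)) -
      I • (∫ y in α..β, G (r + y * I))) atTop (𝓝 0) := by
    have hlim : Tendsto (fun r : ℝ => 2 * (C * Real.exp (-r) * |β - α|)) atTop (𝓝 0) := by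
      have := ((Real.tendsto_exp_neg_atTop_nhds_zero.const_mul C).mul_const |β - α|).const_mul 2
      simpa using this
    refine squeeze_zero_norm (fun r => ?_) hlim
    have e1 : ‖∫ y in α..β, G ((-r : ℝ) + y * I)‖ ≤ C * Real.exp (-r) * |β - α| :=
      intervalIntegral.norm_integral_le_of_norm_le_const fun y hy => by
        rw [Set.uIoc_of_le hαβ] at hy
        exact (hbound _ y (Set.Ioc_subset_Icc_self hy)).trans (hb2 _)
    have e2 : ‖∫ y in α..β, G (r + y * I)‖ ≤ C * Real.exp (-r) * |β - α| :=
      intervalIntegral.norm_integral_le_of_norm_le_const fun y hy => by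
        rw [Set.uIoc_of_le hαβ] at hy
        exact (hbound _ y (Set.Ioc_subset_Icc_self hy)).trans (hb1 _)
    refine (norm_sub_le _ _).trans ?_
    rw [norm_smul, norm_smul, norm_I, one_mul, one_mul]
    linarith
  have := hl.sub hr
  refine sub_eq_zero.1 (tendsto_nhds_unique this ?_)
  refine hz.congr fun r => ?_
  exact (hrect r).symm

theorem integral_Ioi_inv_one_add_sq_complex :
    ∫ t in Set.Ioi (0 : ℝ), (1 / (1 + (t : ℂ) ^ 2)) = ((Real.pi / 2 : ℝ) : ℂ) := by
  have : ∀ t : ℝ, (1 / (1 + (t : ℂ) ^ 2)) = (((1 + t ^ 2)⁻¹ : ℝ) : ℂ) := fun t => by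
    push_cast; rw [one_div]
  simp_rw [this]
  rw [integral_complex_ofReal, integral_Ioi_inv_one_add_sq, Real.arctan_zero, sub_zero]

end Rays

/-! ### Rational functions on closed double sectors -/

section Sectors

open Complex Filter Topology

/-- The closed double sector of half-angle `θ` around the real axis in the complex plane. -/
def closedBisector (θ : ℝ) : Set ℂ := {z | Real.cos θ * ‖z‖ ≤ |z.re|}

theorem isClosed_closedBisector (θ : ℝ) : IsClosed (closedBisector θ) :=
  isClosed_le (by fun_prop) (by fun_prop)

/-- The nonzero points of the upper half plane outside the open double sector of half-angle `φ`. -/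
def outerSector (φ : ℝ) : Set ℂ := {z | 0 < z.im ∧ |z.re| ≤ Real.cos φ * ‖z‖}

theorem ray_re (r y : ℝ) : ((r : ℂ) * exp (y * I)).re = r * Real.cos y := by
  rw [re_ofReal_mul, exp_ofReal_mul_I_re]

theorem ray_im (r y : ℝ) : ((r : ℂ) * exp (y * I)).im = r * Real.sin y := by
  rw [im_ofReal_mul, exp_ofReal_mul_I_im]

theorem ray_mem_closedBisector_right {r y φ : ℝ} (hr : 0 < r) (hy : y ∈ Set.Icc 0 φ)
    (hφ : φ ≤ Real.pi) : (r : ℂ) * exp (y * I) ∈ closedBisector φ := by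
  rw [closedBisector, Set.mem_ofPred_eq, norm_ray r y hr, ray_re, abs_mul, abs_of_pos hr, mul_comm]
  exact mul_le_mul_of_nonneg_left
    ((Real.cos_le_cos_of_nonneg_of_le_pi hy.1 hφ hy.2).trans (le_abs_self _)) hr.le

theorem ray_mem_closedBisector_left {r y φ : ℝ} (hr : 0 < r)
    (hy : y ∈ Set.Icc (Real.pi - φ) Real.pi) (hφ : φ ≤ Real.pi) :
    (r : ℂ) * exp (y * I) ∈ closedBisector φ := by
  rw [closedBisector, Set.mem_ofPred_eq, norm_ray r y hr, ray_re, abs_mul, abs_of_pos hr, mul_comm]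
  have h := Real.cos_le_cos_of_nonneg_of_le_pi (by linarith) hy.2 hy.1
  rw [Real.cos_pi_sub] at h
  exact mul_le_mul_of_nonneg_left (le_trans (by linarith) (neg_le_abs _)) hr.le

theorem ray_mem_outerSector {r y φ : ℝ} (hr : 0 < r) (h0 : 0 < φ)
    (hy : y ∈ Set.Icc φ (Real.pi - φ)) : (r : ℂ) * exp (y * I) ∈ outerSector φ := by
  refine ⟨?_, ?_⟩
  · rw [ray_im]
    exact mul_pos hr (Real.sin_pos_of_pos_of_lt_pi (h0.trans_le hy.1) (by linarith [hy.2]))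
  · rw [norm_ray r y hr, ray_re, abs_mul, abs_of_pos hr, mul_comm]
    refine mul_le_mul_of_nonneg_right (abs_le.2 ⟨?_, ?_⟩) hr.le
    · rw [← Real.cos_pi_sub]
      exact Real.cos_le_cos_of_nonneg_of_le_pi (by linarith [hy.1]) (by linarith) hy.2
    · exact Real.cos_le_cos_of_nonneg_of_le_pi h0.le (by linarith [hy.2]) hy.1

/-- Near `a` the distance from `a` to `K` gives the bound; far away `‖z‖ ≤ ‖z - a‖ + ‖a‖` does. The
constant merges the two regimes. -/
theorem exists_le_norm_sub {K : Set ℂ} (hK : IsClosed K) {a : ℂ} (ha : a ∉ K) :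
    ∃ c > 0, ∀ z ∈ K, c * (1 + ‖z‖) ≤ ‖z - a‖ := by
  obtain ⟨d, hd, hball⟩ := Metric.isOpen_iff.1 hK.isOpen_compl a ha
  have hdist : ∀ z ∈ K, d ≤ ‖z - a‖ := fun z hz => by
    by_contra! h
    exact hball (by rwa [Metric.mem_ball, dist_eq_norm]) hz
  refine ⟨((1 + ‖a‖) / d + 1)⁻¹, by positivity, fun z hz => ?_⟩
  rw [inv_mul_le_iff₀ (by positivity)]
  have h1 : ‖z‖ ≤ ‖z - a‖ + ‖a‖ := by simpa using norm_add_le (z - a) a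
  have h2 : 1 + ‖a‖ ≤ (1 + ‖a‖) / d * ‖z - a‖ := by
    rw [div_mul_eq_mul_div, le_div_iff₀ hd]
    exact mul_le_mul_of_nonneg_left (hdist z hz) (by positivity)
  linarith

/-- Splitting `Q` into linear factors over `ℂ` reduces this to one factor `z - a` with `a` off `K`
at a time. -/
theorem exists_le_norm_eval {K : Set ℂ} (hK : IsClosed K) (Q : ℂ[X]) (hQ : ∀ z ∈ K, Q.eval z ≠ 0)
    (hQ0 : Q ≠ 0) : ∃ c > 0, ∀ z ∈ K, c * (1 + ‖z‖) ^ Q.natDegree ≤ ‖Q.eval z‖ := by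
  induction hN : Q.natDegree generalizing Q with
  | zero =>
    obtain ⟨a, rfl⟩ := Polynomial.natDegree_eq_zero.1 hN
    have ha : a ≠ 0 := by rintro rfl; simp at hQ0
    exact ⟨‖a‖, norm_pos_iff.2 ha, fun z _ => by simp⟩
  | succ N ih =>
    obtain ⟨a, ha⟩ := IsAlgClosed.exists_root Q (fun h0 => by
      have := Polynomial.natDegree_eq_of_degree_eq_some (n := 0) h0
      omega)
    obtain ⟨Q', rfl⟩ := Polynomial.dvd_iff_isRoot.2 ha
    have hQ'0 : Q' ≠ 0 := right_ne_zero_of_mul hQ0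
    have haK : a ∉ K := fun h => hQ a h ha
    rw [Polynomial.natDegree_mul (Polynomial.X_sub_C_ne_zero a) hQ'0,
      Polynomial.natDegree_X_sub_C] at hN
    obtain ⟨c, hc, h1⟩ := ih Q' (fun z hz h0 => hQ z hz (by simp [h0])) hQ'0 (by omega)
    obtain ⟨c', hc', h2⟩ := exists_le_norm_sub hK haK
    refine ⟨c' * c, by positivity, fun z hz => ?_⟩
    rw [Polynomial.eval_mul, norm_mul, Polynomial.eval_sub, Polynomial.eval_X, Polynomial.eval_C,
      pow_succ]
    calc c' * c * ((1 + ‖z‖) ^ N * (1 + ‖z‖))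
        = (c' * (1 + ‖z‖)) * (c * (1 + ‖z‖) ^ N) := by ring
      _ ≤ _ := mul_le_mul (h2 z hz) (h1 z hz) (by positivity) (norm_nonneg _)

theorem exists_le_norm_aeval {K : Set ℂ} (hK : IsClosed K) (Q : ℝ[X])
    (hQ : ∀ z ∈ K, Polynomial.aeval z Q ≠ 0) (hQ0 : Q ≠ 0) :
    ∃ c > 0, ∀ z ∈ K, c * (1 + ‖z‖) ^ Q.natDegree ≤ ‖Polynomial.aeval z Q‖ := by
  have h := exists_le_norm_eval hK (Q.map (algebraMap ℝ ℂ))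
    (fun z hz => by rw [Polynomial.eval_map_algebraMap]; exact hQ z hz)
    ((Polynomial.map_ne_zero_iff (algebraMap ℝ ℂ).injective).2 hQ0)
  simpa only [Polynomial.eval_map_algebraMap, Polynomial.natDegree_map] using h

theorem exists_norm_aeval_le (P : ℝ[X]) {d : ℕ} (hd : P.natDegree ≤ d) :
    ∃ C ≥ 0, ∀ z : ℂ, ‖Polynomial.aeval z P‖ ≤ C * (1 + ‖z‖) ^ d := by
  refine ⟨∑ k ∈ Finset.range (P.natDegree + 1), |P.coeff k|,
    Finset.sum_nonneg fun _ _ => abs_nonneg _, fun z => ?_⟩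
  rw [Polynomial.aeval_eq_sum_range, Finset.sum_mul]
  refine (norm_sum_le _ _).trans (Finset.sum_le_sum fun k hk => ?_)
  rw [norm_smul, norm_pow, Real.norm_eq_abs]
  refine mul_le_mul_of_nonneg_left ?_ (abs_nonneg _)
  have hk' := Finset.mem_range.1 hk
  calc ‖z‖ ^ k ≤ (1 + ‖z‖) ^ k := pow_le_pow_left₀ (norm_nonneg _) (by linarith) k
    _ ≤ (1 + ‖z‖) ^ d := pow_le_pow_right₀ (by linarith [norm_nonneg z]) (by omega)

/-- Growth of the rational function `P / Q` on a closed set without zeros of `Q`. -/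
theorem exists_norm_div_le {K : Set ℂ} (hK : IsClosed K) (P Q : ℝ[X])
    (hQ : ∀ z ∈ K, Polynomial.aeval z Q ≠ 0) (hQ0 : Q ≠ 0) {d e : ℕ} (hd : P.natDegree ≤ d)
    (he : d + e = Q.natDegree) :
    ∃ C ≥ 0, ∀ z ∈ K, ‖Polynomial.aeval z P / Polynomial.aeval z Q‖ ≤ C / (1 + ‖z‖) ^ e := by
  obtain ⟨c, hc, h1⟩ := exists_le_norm_aeval hK Q hQ hQ0
  obtain ⟨C, hC, h2⟩ := exists_norm_aeval_le P hd
  refine ⟨C / c, by positivity, fun z hz => ?_⟩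
  have hz1 : 0 < 1 + ‖z‖ := by positivity
  rw [norm_div, div_div, div_le_div_iff₀ (norm_pos_iff.2 (hQ z hz)) (by positivity)]
  calc ‖Polynomial.aeval z P‖ * (c * (1 + ‖z‖) ^ e)
      ≤ C * (1 + ‖z‖) ^ d * (c * (1 + ‖z‖) ^ e) :=
        mul_le_mul_of_nonneg_right (h2 z) (by positivity)
    _ = C * (c * (1 + ‖z‖) ^ Q.natDegree) := by rw [← he, pow_add]; ring
    _ ≤ _ := mul_le_mul_of_nonneg_left (h1 z hz) hC

theorem differentiableAt_aeval_div {P Q : ℝ[X]} {z : ℂ} (hz : Polynomial.aeval z Q ≠ 0) :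
    DifferentiableAt ℂ (fun s : ℂ => Polynomial.aeval s P / Polynomial.aeval s Q) z :=
  (P.differentiable_aeval z).div (Q.differentiable_aeval z) hz

theorem rayDecay_div {φ α β : ℝ} (P Q : ℝ[X])
    (hQ : ∀ z ∈ closedBisector φ, Polynomial.aeval z Q ≠ 0) (hQ0 : Q ≠ 0)
    (hd : P.natDegree + 2 ≤ Q.natDegree)
    (hαβ : ∀ r : ℝ, 0 < r → ∀ y ∈ Set.Icc α β, (r : ℂ) * exp (y * I) ∈ closedBisector φ) :
    RayDecay (fun s => Polynomial.aeval s P / Polynomial.aeval s Q) α β := by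
  obtain ⟨C, hC, h⟩ := exists_norm_div_le (isClosed_closedBisector φ) P Q hQ hQ0
    (d := Q.natDegree - 2) (e := 2) (by omega) (by omega)
  refine ⟨C, fun r hr y hy => ⟨differentiableAt_aeval_div (hQ _ (hαβ r hr y hy)), ?_⟩⟩
  refine (h _ (hαβ r hr y hy)).trans ?_
  rw [norm_ray r y hr]
  exact div_le_div_of_nonneg_left hC (by positivity) (by nlinarith)

theorem aeval_ofReal_im (P : ℝ[X]) (x : ℝ) : (Polynomial.aeval (x : ℂ) P).im = 0 := by
  have := Polynomial.aeval_algebraMap_apply ℂ x P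
  rw [coe_algebraMap] at this
  rw [this]; simp

/-- This disposes of whatever has been moved to the real axis: only imaginary parts of ray integrals
enter the final value. -/
theorem rayIntegral_im_zero {F : ℂ → ℂ} (hF : ∀ x : ℝ, (F x).im = 0) {α : ℝ}
    (hα : (exp (α * I)).im = 0) : (rayIntegral F α).im = 0 := by
  obtain ⟨x, hx⟩ : ∃ x : ℝ, exp (α * I) = x := ⟨_, Complex.ext (ofReal_re _).symm hα⟩
  have h : ∀ t : ℝ, F (t * x) * x = ((F (t * x) * x).re : ℂ) := fun t => by
    refine Complex.ext (ofReal_re _).symm ?_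
    rw [ofReal_im, mul_im, ofReal_im, mul_zero, zero_add, ← ofReal_mul, hF, zero_mul]
  rw [rayIntegral, hx, integral_congr_ae (Eventually.of_forall h), integral_complex_ofReal,
    ofReal_im]

end Sectors

/-! ### The scalar form of the rational functional calculus -/

section Scalar

open Complex Filter Topology

/-- The polynomials `h_k = ∑_{j < k} ℓ_{k - 1 - j} X ^ j`. -/
noncomputable def hornerPoly (l : ℕ → ℝ) : ℕ → ℝ[X]
  | 0 => 0
  | k + 1 => Polynomial.X * hornerPoly l k + Polynomial.C (l k)

theorem evalSeq_hornerPoly_X_mul (l : ℕ → ℝ) (P : ℝ[X]) :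
    evalSeq (hornerPoly l) (Polynomial.X * P) =
      Polynomial.X * evalSeq (hornerPoly l) P + Polynomial.C (evalSeq l P) := by
  induction P using Polynomial.induction_on' with
  | add p q hp hq => simp only [mul_add, map_add, hp, hq]; abel
  | monomial k c =>
    rw [Polynomial.X_mul_monomial, evalSeq_monomial, evalSeq_monomial, evalSeq_monomial,
      hornerPoly, smul_add, Polynomial.smul_C, mul_smul_comm]

/-- The numerator `Q h_P - P h_Q`. -/
noncomputable def crossPoly (l : ℕ → ℝ) (P Q : ℝ[X]) : ℝ[X] :=
  Q * evalSeq (hornerPoly l) P - P * evalSeq (hornerPoly l) Q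

theorem crossPoly_X_mul (l : ℕ → ℝ) (P Q : ℝ[X]) :
    crossPoly l (Polynomial.X * P) Q =
      Polynomial.X * crossPoly l P Q + Polynomial.C (evalSeq l P) * Q := by
  rw [crossPoly, crossPoly, evalSeq_hornerPoly_X_mul]
  ring

theorem hornerPoly_add_sub_mem (l : ℕ → ℝ) (b d : ℕ) :
    hornerPoly l (b + d) - Polynomial.X ^ d * hornerPoly l b ∈ Polynomial.degreeLT ℝ d := by
  rw [Polynomial.mem_degreeLT]
  induction d with
  | zero => simp
  | succ d ih =>
    have : hornerPoly l (b + (d + 1)) - Polynomial.X ^ (d + 1) * hornerPoly l b =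
        Polynomial.X * (hornerPoly l (b + d) - Polynomial.X ^ d * hornerPoly l b) +
          Polynomial.C (l (b + d)) := by
      rw [← add_assoc, hornerPoly]; ring
    rw [this]
    refine (Polynomial.degree_add_le _ _).trans_lt (max_lt ?_ ?_)
    · rw [Polynomial.degree_mul, Polynomial.degree_X, add_comm]
      push_cast
      exact WithBot.add_lt_add_right (by simp) ih
    · refine Polynomial.degree_C_le.trans_lt ?_
      exact_mod_cast Nat.succ_pos d

/-- For `b ≤ a`, `h_a` is `X ^ (a - b) h_b` plus a polynomial of degree less than `a - b`, so the
high-order terms of the two products cancel. -/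
theorem hornerPoly_cross_mem (l : ℕ → ℝ) {M a b : ℕ} (ha : a ≤ M) (hb : b ≤ M) :
    Polynomial.X ^ a * hornerPoly l b - Polynomial.X ^ b * hornerPoly l a ∈
      Polynomial.degreeLT ℝ M := by
  wlog hab : b ≤ a generalizing a b
  · rw [← neg_sub]
    exact Submodule.neg_mem _ (this hb ha (le_of_not_ge hab))
  obtain ⟨d, rfl⟩ := Nat.exists_eq_add_of_le hab
  have h := hornerPoly_add_sub_mem l b d
  have h2 : Polynomial.X ^ (b + d) * hornerPoly l b - Polynomial.X ^ b * hornerPoly l (b + d) =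
      -(Polynomial.X ^ b * (hornerPoly l (b + d) - Polynomial.X ^ d * hornerPoly l b)) := by
    rw [pow_add]; ring
  rw [h2]
  refine Submodule.neg_mem _ ?_
  rw [Polynomial.mem_degreeLT] at h ⊢
  rw [Polynomial.degree_mul, Polynomial.degree_X_pow]
  calc (b : WithBot ℕ) + _ < b + d := WithBot.add_lt_add_left (by simp) h
    _ ≤ M := by exact_mod_cast ha

/-- Each product may have degree up to `2M - 1`. Expanding bilinearly reduces the difference to
monomial pairs, where the cancellation brings the degree below `M`; hence `crossPoly l P Q / Q`
vanishes at infinity. -/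
theorem crossPoly_mem_degreeLT (l : ℕ → ℝ) {M : ℕ} {P Q : ℝ[X]} (hP : P.natDegree ≤ M)
    (hQ : Q.natDegree ≤ M) : crossPoly l P Q ∈ Polynomial.degreeLT ℝ M := by
  have key : ∀ R : ℝ[X], R.natDegree ≤ M →
      R = ∑ k ∈ Finset.range (M + 1), R.coeff k • (Polynomial.X ^ k : ℝ[X]) := fun R hR => by
    conv_lhs => rw [R.as_sum_range' (M + 1) (by omega)]
    exact Finset.sum_congr rfl fun k _ => by rw [← Polynomial.C_mul_X_pow_eq_monomial,
      Polynomial.smul_eq_C_mul]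
  have : crossPoly l P Q = ∑ a ∈ Finset.range (M + 1), ∑ b ∈ Finset.range (M + 1),
      (Q.coeff a * P.coeff b) • (Polynomial.X ^ a * hornerPoly l b -
        Polynomial.X ^ b * hornerPoly l a) := by
    rw [crossPoly, mul_comm P, evalSeq_apply_of_le _ hP, evalSeq_apply_of_le _ hQ]
    nth_rw 1 [key Q hQ]
    nth_rw 2 [key P hP]
    rw [Finset.sum_mul_sum, Finset.sum_mul_sum, ← Finset.sum_sub_distrib]
    refine Finset.sum_congr rfl fun a _ => ?_
    rw [← Finset.sum_sub_distrib]
    refine Finset.sum_congr rfl fun b _ => ?_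
    rw [smul_mul_smul_comm, smul_mul_smul_comm, smul_sub, mul_comm (hornerPoly l a)]
  rw [this]
  refine Submodule.sum_mem _ fun a ha => Submodule.sum_mem _ fun b hb => Submodule.smul_mem _ _ ?_
  exact hornerPoly_cross_mem l (Nat.lt_succ_iff.1 (Finset.mem_range.1 ha))
    (Nat.lt_succ_iff.1 (Finset.mem_range.1 hb))

/-- If `s f_k - f_{k+1} = ℓ_k`, then `∑ P_k f_k = P(s) f_0 - h_P(s)`. -/
theorem evalSeq_eq_of_recursion {f : ℕ → ℂ} {l : ℕ → ℝ} {s : ℂ} {M : ℕ}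
    (hf : ∀ k < M, s * f k - f (k + 1) = l k) {P : ℝ[X]} (hP : P.natDegree ≤ M) :
    evalSeq f P = Polynomial.aeval s P * f 0 - Polynomial.aeval s (evalSeq (hornerPoly l) P) := by
  have h : ∀ k ≤ M, f k = s ^ k * f 0 - Polynomial.aeval s (hornerPoly l k) := by
    intro k
    induction k with
    | zero => intro _; simp [hornerPoly]
    | succ k ih =>
      intro hk
      have h1 := hf k hk
      rw [ih (by omega)] at h1
      rw [hornerPoly, map_add, map_mul, Polynomial.aeval_X, Polynomial.aeval_C, coe_algebraMap]
      linear_combination -h1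
  rw [evalSeq_apply_of_le _ hP, evalSeq_apply_of_le _ hP, map_sum, Polynomial.aeval_eq_sum_range'
    (Nat.lt_succ_of_le hP), Finset.sum_mul, ← Finset.sum_sub_distrib]
  refine Finset.sum_congr rfl fun k hk => ?_
  rw [h k (Nat.lt_succ_iff.1 (Finset.mem_range.1 hk)), map_smul, smul_mul_assoc, smul_sub]

/-- Eliminating `f 0` between the formulas for `P` and for `Q` splits the integrand into a term
without the poles of `1 / Q` and a rational term without the singularities of `f`. The two can then
be integrated over opposite sides of the contour. -/
theorem evalSeq_cross {f : ℕ → ℂ} {l : ℕ → ℝ} {s : ℂ} {M : ℕ}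
    (hf : ∀ k < M, s * f k - f (k + 1) = l k) {P Q : ℝ[X]} (hP : P.natDegree ≤ M)
    (hQ : Q.natDegree ≤ M) (hs : Polynomial.aeval s Q ≠ 0) :
    Polynomial.aeval s P / Polynomial.aeval s Q * evalSeq f Q =
      evalSeq f P + Polynomial.aeval s (crossPoly l P Q) / Polynomial.aeval s Q := by
  rw [evalSeq_eq_of_recursion hf hP, evalSeq_eq_of_recursion hf hQ, crossPoly, map_sub, map_mul,
    map_mul]
  field_simp
  ring

theorem evalSeq_recursion {f : ℕ → ℂ} {l : ℕ → ℝ} {s : ℂ} {M : ℕ}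
    (hf : ∀ k < M, s * f k - f (k + 1) = l k) {P : ℝ[X]} (hP : P.natDegree < M) :
    s * evalSeq f P - evalSeq f (Polynomial.X * P) = evalSeq l P := by
  rw [evalSeq_X_mul, evalSeq_apply, evalSeq_apply, evalSeq_apply, Finset.mul_sum,
    ← Finset.sum_sub_distrib, ofReal_sum]
  refine Finset.sum_congr rfl fun k hk => ?_
  have := hf k (by have := Finset.mem_range.1 hk; omega)
  rw [smul_eq_mul, ofReal_mul, ← this, real_smul, real_smul]
  ring

end Scalar

/-! ### Evaluation of the scalar contour integral. -/

section ScalarMain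

open Complex Filter Topology

theorem natDegree_X_mul_le_succ (R : ℝ[X]) : (Polynomial.X * R).natDegree ≤ R.natDegree + 1 :=
  Polynomial.natDegree_mul_le.trans (by rw [Polynomial.natDegree_X, add_comm])

/-- The functions `f_k` behave like `s ↦ ℓ ((s - T)⁻¹ T ^ k w)`, with `l k = ℓ (T ^ k w)`. -/
structure IsResolventSeq (φ : ℝ) (M : ℕ) (l : ℕ → ℝ) (f : ℕ → ℂ → ℂ) : Prop where
  recursion : ∀ s ∈ outerSector φ, ∀ k < M, s * f k s - f (k + 1) s = l k
  differentiableAt : ∀ k, ∀ s ∈ outerSector φ, DifferentiableAt ℂ (f k) s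
  bound : ∀ k, ∃ C ≥ 0, ∀ s ∈ outerSector φ, ‖f k s‖ ≤ C / ‖s‖

namespace IsResolventSeq

variable {φ : ℝ} {M : ℕ} {l : ℕ → ℝ} {f : ℕ → ℂ → ℂ}

theorem differentiableAt_evalSeq (hf : IsResolventSeq φ M l f) (R : ℝ[X]) {s : ℂ}
    (hs : s ∈ outerSector φ) : DifferentiableAt ℂ (fun s => evalSeq (fun k => f k s) R) s := by
  simp only [evalSeq_apply]
  refine DifferentiableAt.fun_sum fun k _ => ?_
  simp only [real_smul]
  exact (hf.differentiableAt k s hs).const_mul _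

theorem bound_evalSeq (hf : IsResolventSeq φ M l f) (R : ℝ[X]) :
    ∃ C ≥ 0, ∀ s ∈ outerSector φ, ‖evalSeq (fun k => f k s) R‖ ≤ C / ‖s‖ := by
  choose C hC h using hf.bound
  refine ⟨∑ k ∈ Finset.range (R.natDegree + 1), |R.coeff k| * C k,
    Finset.sum_nonneg fun k _ => mul_nonneg (abs_nonneg _) (hC k), fun s hs => ?_⟩
  rw [evalSeq_apply, Finset.sum_div]
  refine (norm_sum_le _ _).trans (Finset.sum_le_sum fun k _ => ?_)
  rw [norm_smul, mul_div_assoc, Real.norm_eq_abs]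
  exact mul_le_mul_of_nonneg_left (h k s hs) (abs_nonneg _)

/-- The factor `X` removes the singularity `1 / |s|` at the origin: by the recursion the value is
`s` times an `O(1 / |s|)` term, minus a constant. -/
theorem bound_evalSeq_X_mul (hf : IsResolventSeq φ M l f) {R : ℝ[X]} (hR : R.natDegree < M) :
    ∃ C ≥ 0, ∀ s ∈ outerSector φ, ‖evalSeq (fun k => f k s) (Polynomial.X * R)‖ *
        (1 + ‖s‖) ≤ C := by
  obtain ⟨C, hC, h⟩ := hf.bound_evalSeq R
  obtain ⟨C', hC', h'⟩ := hf.bound_evalSeq (Polynomial.X * R)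
  refine ⟨C + |evalSeq l R| + C', by positivity, fun s hs => ?_⟩
  have hs0 : 0 < ‖s‖ := norm_pos_iff.2 fun h0 => by
    have := hs.1; rw [h0] at this; exact lt_irrefl _ this
  have h1 := evalSeq_recursion (hf.recursion s hs) hR
  have h2 : evalSeq (fun k => f k s) (Polynomial.X * R) =
      s * evalSeq (fun k => f k s) R - evalSeq l R := by rw [← h1]; ring
  have h3 : ‖evalSeq (fun k => f k s) (Polynomial.X * R)‖ ≤ C + |evalSeq l R| := by
    rw [h2]
    refine (norm_sub_le _ _).trans (add_le_add ?_ ?_)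
    · rw [norm_mul, mul_comm, ← le_div_iff₀ hs0]; exact h s hs
    · rw [norm_real, Real.norm_eq_abs]
  have h4 := (le_div_iff₀ hs0).1 (h' s hs)
  linarith [mul_add ‖evalSeq (fun k => f k s) (Polynomial.X * R)‖ 1 ‖s‖]

theorem one_add_norm_le (s : ℂ) (hs : 0 < s.im) : 1 + ‖s‖ ≤ 2 * ‖s + I‖ := by
  have h1 : 1 ≤ ‖s + I‖ := by
    refine le_trans ?_ (abs_im_le_norm _)
    rw [add_im, I_im, abs_of_pos (by linarith)]; linarith
  have h2 : ‖s‖ ≤ ‖s + I‖ := by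
    rw [norm_def, norm_def]
    refine Real.sqrt_le_sqrt ?_
    rw [normSq_apply, normSq_apply, add_re, add_im, I_re, I_im]
    nlinarith
  linarith

/-- With `P = X R`, the recursion rewrites the difference as `(f_{XP} + I f_P) / (s + I)`, which
gains the missing order of decay at infinity. The pole `-I` of the correction lies in the lower half
plane, away from `outerSector`. -/
theorem rayDecay_outer (hf : IsResolventSeq φ M l f) (hφ : 0 < φ) {R : ℝ[X]}
    (hR : R.natDegree + 1 < M) :
    RayDecay (fun s => evalSeq (fun k => f k s) (Polynomial.X * R) -
      evalSeq l (Polynomial.X * R) / (s + I)) φ (Real.pi - φ) := by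
  have hR' : (Polynomial.X * R).natDegree < M :=
    (natDegree_X_mul_le_succ R).trans_lt (by omega)
  obtain ⟨C, hC, h⟩ := hf.bound_evalSeq_X_mul (R := R) (by omega)
  obtain ⟨C', hC', h'⟩ := hf.bound_evalSeq_X_mul hR'
  refine ⟨2 * (C + C'), fun r hr y hy => ?_⟩
  have hs := ray_mem_outerSector hr hφ hy
  have hnorm := norm_ray r y hr
  set s : ℂ := (r : ℂ) * exp (y * I)
  have hsI := one_add_norm_le s hs.1
  have hsI0 : s + I ≠ 0 := fun h0 => by
    rw [h0, norm_zero] at hsI; linarith [norm_nonneg s]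
  refine ⟨(hf.differentiableAt_evalSeq _ hs).sub ((differentiableAt_const _).div
    (by fun_prop) hsI0), ?_⟩
  have h1 := evalSeq_recursion (hf.recursion s hs) hR'
  have h2 : evalSeq (fun k => f k s) (Polynomial.X * R) - evalSeq l (Polynomial.X * R) / (s + I) =
      (evalSeq (fun k => f k s) (Polynomial.X * (Polynomial.X * R)) +
        I * evalSeq (fun k => f k s) (Polynomial.X * R)) / (s + I) := by
    rw [← h1]; field_simp; ring
  simp only [h2]
  rw [norm_div, div_le_div_iff₀ (norm_pos_iff.2 hsI0) (by positivity)]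
  have h3 : ‖evalSeq (fun k => f k s) (Polynomial.X * (Polynomial.X * R)) +
        I * evalSeq (fun k => f k s) (Polynomial.X * R)‖ * (1 + r) ≤ C + C' := by
    have := norm_add_le (evalSeq (fun k => f k s) (Polynomial.X * (Polynomial.X * R)))
      (I * evalSeq (fun k => f k s) (Polynomial.X * R))
    rw [norm_mul, norm_I, one_mul] at this
    have e1 := h s hs
    have e2 := h' s hs
    rw [hnorm] at e1 e2
    nlinarith
  rw [hnorm] at hsI
  calc _ ≤ ‖evalSeq (fun k => f k s) (Polynomial.X * (Polynomial.X * R)) +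
        I * evalSeq (fun k => f k s) (Polynomial.X * R)‖ * ((1 + r) * (1 + r)) :=
        mul_le_mul_of_nonneg_left (by nlinarith) (norm_nonneg _)
    _ ≤ (C + C') * (1 + r) := by
        rw [← mul_assoc]; exact mul_le_mul_of_nonneg_right h3 (by linarith)
    _ ≤ (C + C') * (2 * ‖s + I‖) := mul_le_mul_of_nonneg_left hsI (by positivity)
    _ = _ := by ring

end IsResolventSeq

theorem natDegree_one_add_X_sq : (1 + Polynomial.X ^ 2 : ℝ[X]).natDegree = 2 := by
  compute_degree!

theorem one_add_X_sq_ne_zero : (1 + Polynomial.X ^ 2 : ℝ[X]) ≠ 0 := fun h => by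
  have := natDegree_one_add_X_sq
  rw [h, Polynomial.natDegree_zero] at this
  omega

theorem aeval_one_add_X_sq (z : ℂ) :
    Polynomial.aeval z (1 + Polynomial.X ^ 2 : ℝ[X]) = 1 + z ^ 2 := by
  simp

theorem one_add_sq_ne_zero {φ : ℝ} (hφ : φ ∈ Set.Ioo 0 (Real.pi / 2)) {z : ℂ}
    (hz : z ∈ closedBisector φ) : 1 + z ^ 2 ≠ 0 := by
  intro h
  have h1 : (z - I) * (z + I) = 0 := by linear_combination h - I_sq
  have hcos := Real.cos_pos_of_mem_Ioo ⟨by linarith [hφ.1, Real.pi_pos], hφ.2⟩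
  have h2 : z.re = 0 ∧ ‖z‖ = 1 := by
    rcases mul_eq_zero.1 h1 with h | h
    · rw [sub_eq_zero.1 h]; simp
    · rw [eq_neg_of_add_eq_zero_left h]; simp
  rw [closedBisector, Set.mem_ofPred_eq, h2.1, h2.2, abs_zero, mul_one] at hz
  linarith

/-- The correction `s / (1 + s²)` is real on the real axis and has no pole in the double sector.
Writing the numerator through `crossPoly l (X * P) Q` makes its degree visibly at most `deg Q`,
whereas the denominator has degree `deg Q + 2`. -/
theorem inner_decomp (l : ℕ → ℝ) {P Q : ℝ[X]} {s : ℂ} (hQ : Polynomial.aeval s Q ≠ 0)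
    (hs : 1 + s ^ 2 ≠ 0) :
    Polynomial.aeval s (crossPoly l P Q) / Polynomial.aeval s Q =
      Polynomial.aeval s (crossPoly l P Q + Polynomial.X * crossPoly l (Polynomial.X * P) Q) /
        Polynomial.aeval s (Q * (1 + Polynomial.X ^ 2)) - evalSeq l P * (s / (1 + s ^ 2)) := by
  rw [crossPoly_X_mul, map_add, map_mul, map_add, map_mul, map_mul, Polynomial.aeval_C, map_mul,
    aeval_one_add_X_sq, Polynomial.aeval_X, coe_algebraMap]
  field_simp
  ring

/-- The scalar form of the rational functional calculus. -/
theorem IsResolventSeq.rayIntegral_eq {φ : ℝ} {M : ℕ} {l : ℕ → ℝ} {f : ℕ → ℂ → ℂ}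
    (hf : IsResolventSeq φ M l f) (hφ : φ ∈ Set.Ioo 0 (Real.pi / 2)) {R Q : ℝ[X]}
    (hQM : Q.natDegree = M) (hR : R.natDegree + 1 < M)
    (hQ : ∀ z ∈ closedBisector φ, Polynomial.aeval z Q ≠ 0) (hQ0 : Q ≠ 0) :
    (rayIntegral (fun s => Polynomial.aeval s (Polynomial.X * R) / Polynomial.aeval s Q *
        evalSeq (fun k => f k s) Q) (Real.pi - φ) -
      rayIntegral (fun s => Polynomial.aeval s (Polynomial.X * R) / Polynomial.aeval s Q *
        evalSeq (fun k => f k s) Q) φ).im = Real.pi * evalSeq l (Polynomial.X * R) := by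
  have hpi := Real.pi_pos
  have hφ1 := hφ.1
  have hφ2 := hφ.2
  set P := Polynomial.X * R with hP
  have hPM : P.natDegree < M := (natDegree_X_mul_le_succ R).trans_lt (by omega)
  set D := Q * (1 + Polynomial.X ^ 2) with hD
  have hD0 : D ≠ 0 := mul_ne_zero hQ0 one_add_X_sq_ne_zero
  have hDdeg : D.natDegree = M + 2 := by
    rw [hD, Polynomial.natDegree_mul hQ0 one_add_X_sq_ne_zero, natDegree_one_add_X_sq, hQM]
  have hDK : ∀ z ∈ closedBisector φ, Polynomial.aeval z D ≠ 0 := fun z hz => by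
    rw [hD, map_mul, aeval_one_add_X_sq]
    exact mul_ne_zero (hQ z hz) (one_add_sq_ne_zero hφ hz)
  set N := crossPoly l P Q + Polynomial.X * crossPoly l (Polynomial.X * P) Q with hN
  -- `X * P` still has degree at most `M`, so both cross polynomials have degree below `M`; this is
  -- the reason for requiring `R.natDegree + 1 < M`.
  have hNdeg : N.natDegree ≤ M := by
    have h1 := crossPoly_mem_degreeLT l (M := M) hPM.le hQM.le
    have h2 := crossPoly_mem_degreeLT l (M := M) (P := Polynomial.X * P)
      ((natDegree_X_mul_le_succ P).trans hPM) hQM.le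
    rw [Polynomial.mem_degreeLT] at h1 h2
    refine Polynomial.natDegree_le_of_degree_le
        ((Polynomial.degree_add_le _ _).trans (max_le h1.le ?_))
    rw [Polynomial.degree_mul, Polynomial.degree_X, add_comm]
    exact Nat.WithBot.add_one_le_of_lt h2
  have hrayR : ∀ r : ℝ, 0 < r → ∀ y ∈ Set.Icc 0 φ, (r : ℂ) * exp (y * I) ∈ closedBisector φ :=
    fun r hr y hy => ray_mem_closedBisector_right hr hy (by linarith)
  have hrayL : ∀ r : ℝ, 0 < r → ∀ y ∈ Set.Icc (Real.pi - φ) Real.pi,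
      (r : ℂ) * exp (y * I) ∈ closedBisector φ :=
    fun r hr y hy => ray_mem_closedBisector_left hr hy (by linarith)
  have hone : (1 : ℝ[X]).natDegree + 2 ≤ (1 + Polynomial.X ^ 2 : ℝ[X]).natDegree := by
    rw [natDegree_one_add_X_sq, Polynomial.natDegree_one]
  have honeK : ∀ z ∈ closedBisector φ, Polynomial.aeval z (1 + Polynomial.X ^ 2 : ℝ[X]) ≠ 0 :=
    fun z hz => by rw [aeval_one_add_X_sq]; exact one_add_sq_ne_zero hφ hz
  set G₁ : ℂ → ℂ := fun s => evalSeq (fun k => f k s) P - evalSeq l P / (s + I) with hG₁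
  set G₂ : ℂ → ℂ := fun s => Polynomial.aeval s N / Polynomial.aeval s D with hG₂
  set G₃ : ℂ → ℂ := fun s => Polynomial.aeval s (1 : ℝ[X]) /
    Polynomial.aeval s (1 + Polynomial.X ^ 2 : ℝ[X]) with hG₃
  have d1 : RayDecay G₁ φ (Real.pi - φ) := hf.rayDecay_outer hφ1 hR
  have d2 : RayDecay G₂ 0 φ := rayDecay_div N D hDK hD0 (by omega) hrayR
  have d2' : RayDecay G₂ (Real.pi - φ) Real.pi := rayDecay_div N D hDK hD0 (by omega) hrayL
  have d3 : RayDecay G₃ 0 φ := rayDecay_div 1 _ honeK one_add_X_sq_ne_zero hone hrayR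
  have d3' : RayDecay G₃ (Real.pi - φ) Real.pi :=
    rayDecay_div 1 _ honeK one_add_X_sq_ne_zero hone hrayL
  -- The corrections for the outer and the inner term differ by `1 / (s + I) - s / (1 + s²) = -I /
  -- (1 + s²)`, which is the multiple of `G₃`.
  have hsplit : ∀ s ∈ outerSector φ, s ∈ closedBisector φ →
      Polynomial.aeval s P / Polynomial.aeval s Q * evalSeq (fun k => f k s) Q =
        G₁ s + G₂ s + (-I * evalSeq l P) * G₃ s := by
    intro s hs hs'
    have h0 : s + I ≠ 0 := fun h0 => by
      have h1 := congrArg im h0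
      rw [add_im, I_im, zero_im] at h1
      linarith [hs.1]
    have h1 := one_add_sq_ne_zero hφ hs'
    have h2 : 1 / (1 + s ^ 2) * (s - I) = 1 / (s + I) := by
      rw [div_mul_eq_mul_div, div_eq_div_iff h1 h0]
      linear_combination -I_sq
    rw [evalSeq_cross (hf.recursion s hs) hPM.le hQM.le (hQ s hs'), inner_decomp l (hQ s hs') h1]
    simp only [hG₁, hG₂, hG₃, aeval_one_add_X_sq, map_one]
    have h3 : (evalSeq l P : ℂ) / (s + I) = evalSeq l P * (1 / (1 + s ^ 2) * (s - I)) := by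
      rw [h2]; ring
    rw [h3]
    ring
  have hsum : ∀ y : ℝ, (∀ r : ℝ, 0 < r → (r : ℂ) * exp (y * I) ∈ outerSector φ) →
      (∀ r : ℝ, 0 < r → (r : ℂ) * exp (y * I) ∈ closedBisector φ) →
      IntegrableOn (fun t : ℝ => G₁ (t * exp (y * I)) * exp (y * I)) (Set.Ioi 0) →
      IntegrableOn (fun t : ℝ => G₂ (t * exp (y * I)) * exp (y * I)) (Set.Ioi 0) →
      IntegrableOn (fun t : ℝ => G₃ (t * exp (y * I)) * exp (y * I)) (Set.Ioi 0) →
      rayIntegral (fun s => Polynomial.aeval s P / Polynomial.aeval s Q *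
        evalSeq (fun k => f k s) Q) y =
        rayIntegral G₁ y + rayIntegral G₂ y + (-I * evalSeq l P) * rayIntegral G₃ y := by
    intro y ho hc i1 i2 i3
    simp only [rayIntegral]
    have e1 := integral_add i1 i2
    have e2 := integral_add (i1.add i2) (i3.const_mul (-I * evalSeq l P))
    simp only [Pi.add_apply] at e1 e2
    rw [e1, integral_const_mul] at e2
    rw [← e2]
    refine setIntegral_congr_fun measurableSet_Ioi fun t ht => ?_
    simp only [hsplit _ (ho t ht) (hc t ht)]
    ring
  -- The two rays of `G₁` are joined through the outer sector and cancel; those of `G₂` and `G₃` are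
  -- turned inwards to the arguments `0` and `π`.
  rw [hsum φ (fun r hr => ray_mem_outerSector hr hφ1 ⟨le_rfl, by linarith⟩)
      (fun r hr => hrayR r hr φ ⟨hφ1.le, le_rfl⟩)
      (d1.integrableOn ⟨le_rfl, by linarith⟩) (d2.integrableOn ⟨hφ1.le, le_rfl⟩)
      (d3.integrableOn ⟨hφ1.le, le_rfl⟩),
    hsum (Real.pi - φ) (fun r hr => ray_mem_outerSector hr hφ1 ⟨by linarith, le_rfl⟩)
      (fun r hr => hrayL r hr _ ⟨le_rfl, by linarith⟩)
      (d1.integrableOn ⟨by linarith, le_rfl⟩) (d2'.integrableOn ⟨le_rfl, by linarith⟩)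
      (d3'.integrableOn ⟨le_rfl, by linarith⟩),
    d1.rayIntegral_eq (by linarith), ← d2.rayIntegral_eq hφ1.le, d2'.rayIntegral_eq (by linarith),
    ← d3.rayIntegral_eq hφ1.le, d3'.rayIntegral_eq (by linarith)]
  have r0 : (rayIntegral G₂ 0).im = 0 := rayIntegral_im_zero
    (fun x => by simp only [hG₂]; rw [div_im, aeval_ofReal_im, aeval_ofReal_im]; simp) (by simp)
  have rpi : (rayIntegral G₂ Real.pi).im = 0 := rayIntegral_im_zero
    (fun x => by simp only [hG₂]; rw [div_im, aeval_ofReal_im, aeval_ofReal_im]; simp) (by simp)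
  -- The positive and negative half-axes give `π / 2` and `-π / 2`, the sign coming from the
  -- direction `exp (π I)`. So `G₃` contributes `-I ℓ_P (-π / 2 - π / 2) = I π ℓ_P`, the only
  -- imaginary part left.
  have k0 : rayIntegral G₃ 0 = ((Real.pi / 2 : ℝ) : ℂ) := by
    rw [← integral_Ioi_inv_one_add_sq_complex]
    simp [rayIntegral, hG₃]
  have kpi : rayIntegral G₃ Real.pi = -((Real.pi / 2 : ℝ) : ℂ) := by
    rw [← integral_Ioi_inv_one_add_sq_complex]
    simp [rayIntegral, hG₃, integral_neg]
  rw [k0, kpi]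
  simp only [add_im, sub_im, r0, rpi, mul_im, neg_im, neg_re, I_re, I_im, mul_re, ofReal_re,
    ofReal_im]
  ring

end ScalarMain

/-! ### Scalar resolvent functions of an operator -/

section ResolventFunctions

open Complex Filter Topology

variable {E : Type*} [NormedAddCommGroup E] [NormedSpace ℝ E] {T : E →ₗ.[ℝ] E}

/-- `(T² - 2 Re(z) T + |z|²)⁻¹`. -/
noncomputable def quadRes (T : E →ₗ.[ℝ] E) (z : ℂ) : E →L[ℝ] E :=
  toBounded (polyOp T (quadPoly z.re (‖z‖ ^ 2))).inverse

/-- `T (T² - 2 Re(z) T + |z|²)⁻¹`. -/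
noncomputable def mulQuadRes (T : E →ₗ.[ℝ] E) (z : ℂ) : E →L[ℝ] E :=
  toBounded (opMul T (polyOp T (quadPoly z.re (‖z‖ ^ 2))).inverse)

theorem QuadInv.quadRes {z : ℂ} {R S : E →L[ℝ] E} (h : QuadInv T z.re (‖z‖ ^ 2) R S) :
    QuadInv T z.re (‖z‖ ^ 2) (quadRes T z) (mulQuadRes T z) := by
  have h1 : CliffordCalculus.quadRes T z = R := h.toBounded_inverse
  have h2 : mulQuadRes T z = S := toBounded_eq fun v =>
    mem_graph_opMul.2 ⟨R v, h.mem_graph_inverse_quadPoly v, h.graph₁ v⟩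
  rwa [h1, h2]

/-- The resolvent estimates of a bisectorial operator outside a double sector. -/
structure ResolventBound (T : E →ₗ.[ℝ] E) (φ : ℝ) : Prop where
  quad : ∀ z ∈ outerSector φ, QuadInv T z.re (‖z‖ ^ 2) (quadRes T z) (mulQuadRes T z)
  bound : ∃ C ≥ 0, ∀ z ∈ outerSector φ, ‖quadRes T z‖ ≤ C / ‖z‖ ^ 2 ∧ ‖mulQuadRes T z‖ ≤ C / ‖z‖

theorem norm_pos_of_mem_outerSector {φ : ℝ} {z : ℂ} (hz : z ∈ outerSector φ) : 0 < ‖z‖ :=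
  norm_pos_iff.2 fun h0 => by
    have := hz.1; rw [h0] at this; exact lt_irrefl _ this

theorem outerSector_mem_nhds {φ φ' : ℝ} (h0 : 0 < φ') (h : φ' < φ) (hφ : φ < Real.pi / 2) {z : ℂ}
    (hz : z ∈ outerSector φ) : outerSector φ' ∈ 𝓝 z := by
  have h1 : IsOpen {z : ℂ | 0 < z.im} := isOpen_lt (by fun_prop) (by fun_prop)
  have h2 : IsOpen {z : ℂ | |z.re| < Real.cos φ' * ‖z‖} := isOpen_lt (by fun_prop) (by fun_prop)
  have hopen : IsOpen {z : ℂ | 0 < z.im ∧ |z.re| < Real.cos φ' * ‖z‖} := h1.and h2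
  refine mem_of_superset (hopen.mem_nhds ⟨hz.1, hz.2.trans_lt ?_⟩) fun x hx => ⟨hx.1, hx.2.le⟩
  exact mul_lt_mul_of_pos_right (Real.cos_lt_cos_of_nonneg_of_le_pi_div_two h0.le hφ.le h)
    (norm_pos_of_mem_outerSector hz)

namespace ResolventBound

variable {φ : ℝ}

/-- In the resolvent identities the scalar coefficients tend to zero as `z → z₀`, while the
operators they multiply stay bounded by the uniform estimates. -/
theorem continuousAt (h : ResolventBound T φ) {z₀ : ℂ} (hz₀ : outerSector φ ∈ 𝓝 z₀) :
    ContinuousAt (quadRes T) z₀ ∧ ContinuousAt (mulQuadRes T) z₀ := by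
  obtain ⟨C, hC, hb⟩ := h.bound
  have hz₀' := mem_of_mem_nhds hz₀
  have hpos := norm_pos_of_mem_outerSector hz₀'
  have hq₀ := h.quad z₀ hz₀'
  set R₀ := quadRes T z₀
  set S₀ := mulQuadRes T z₀
  have hR : ∀ z ∈ outerSector φ, quadRes T z - R₀ =
      (2 * (z.re - z₀.re)) • (quadRes T z).comp S₀ +
        (‖z₀‖ ^ 2 - ‖z‖ ^ 2) • (quadRes T z).comp R₀ := fun z hz => by
    ext v; exact (h.quad z hz).R_sub_R hq₀ v
  have hS : ∀ z ∈ outerSector φ, mulQuadRes T z - S₀ =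
      (2 * (z.re - z₀.re)) • (mulQuadRes T z).comp S₀ +
        (‖z₀‖ ^ 2 - ‖z‖ ^ 2) • (quadRes T z).comp S₀ := fun z hz => by
    ext v; exact (h.quad z hz).S_sub_S hq₀ v
  have key : ∀ (a b : ℝ) (A B A' B' : E →L[ℝ] E),
      ‖a • A.comp A' + b • B.comp B'‖ ≤ |a| * (‖A‖ * ‖A'‖) + |b| * (‖B‖ * ‖B'‖) := by
    intro a b A B A' B'
    refine (norm_add_le _ _).trans (add_le_add ?_ ?_) <;>
    · rw [norm_smul, Real.norm_eq_abs]
      exact mul_le_mul_of_nonneg_left (ContinuousLinearMap.opNorm_comp_le _ _) (abs_nonneg _)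
  have hc : ∀ A B : ℝ, ∀ i j : ℕ, Tendsto (fun z : ℂ => |2 * (z.re - z₀.re)| * (C / ‖z‖ ^ i * A) +
      |‖z₀‖ ^ 2 - ‖z‖ ^ 2| * (C / ‖z‖ ^ j * B)) (𝓝 z₀) (𝓝 0) := by
    intro A B i j
    have : ContinuousAt (fun z : ℂ => |2 * (z.re - z₀.re)| * (C / ‖z‖ ^ i * A) +
        |‖z₀‖ ^ 2 - ‖z‖ ^ 2| * (C / ‖z‖ ^ j * B)) z₀ := by
      have h1 : ‖z₀‖ ^ i ≠ 0 := (pow_pos hpos i).ne'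
      have h2 : ‖z₀‖ ^ j ≠ 0 := (pow_pos hpos j).ne'
      fun_prop (disch := assumption)
    have h3 := this.tendsto
    simpa using h3
  constructor
  · rw [ContinuousAt, tendsto_iff_norm_sub_tendsto_zero]
    refine squeeze_zero' (Eventually.of_forall fun _ => norm_nonneg _) ?_ (hc ‖S₀‖ ‖R₀‖ 2 2)
    filter_upwards [hz₀] with z hz
    rw [hR z hz]
    refine (key _ _ _ _ _ _).trans ?_
    have := (hb z hz).1
    gcongr
  · rw [ContinuousAt, tendsto_iff_norm_sub_tendsto_zero]
    refine squeeze_zero' (Eventually.of_forall fun _ => norm_nonneg _) ?_ (hc ‖S₀‖ ‖S₀‖ 1 2)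
    filter_upwards [hz₀] with z hz
    rw [hS z hz]
    refine (key _ _ _ _ _ _).trans ?_
    have h1 := (hb z hz).1
    have h2 := (hb z hz).2
    rw [← pow_one ‖z‖] at h2
    gcongr

end ResolventBound

/-- `ℓ ((s - T)⁻¹ u)`, written with the real operators `(T² - 2 Re(s) T + |s|²)⁻¹` and
`T (T² - 2 Re(s) T + |s|²)⁻¹`. -/
noncomputable def resFun (T : E →ₗ.[ℝ] E) (l : E →L[ℝ] ℝ) (s : ℂ) : E →ₗ[ℝ] ℂ where
  toFun u := (starRingEnd ℂ) s * l (quadRes T s u) - l (mulQuadRes T s u)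
  map_add' u v := by simp only [map_add, ofReal_add]; ring
  map_smul' c u := by
    simp only [map_smul, smul_eq_mul, ofReal_mul, RingHom.id_apply, real_smul]; ring

theorem resFun_apply (l : E →L[ℝ] ℝ) (s : ℂ) (u : E) :
    resFun T l s u = (starRingEnd ℂ) s * l (quadRes T s u) - l (mulQuadRes T s u) := rfl

theorem map_evalSeq {F : Type*} [AddCommGroup F] [Module ℝ F] (g : E →ₗ[ℝ] F) (w : ℕ → E)
    (p : ℝ[X]) : g (evalSeq w p) = evalSeq (fun k => g (w k)) p := by
  rw [evalSeq_apply, evalSeq_apply, map_sum]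
  simp only [map_smul]

theorem ofReal_norm_sq (z : ℂ) : ((‖z‖ ^ 2 : ℝ) : ℂ) = z * (starRingEnd ℂ) z := by
  rw [mul_conj, normSq_eq_norm_sq]

theorem ofReal_two_re (z : ℂ) : ((2 * z.re : ℝ) : ℂ) = z + (starRingEnd ℂ) z := by
  rw [add_conj]

namespace ResolventBound

variable {φ : ℝ}

/-- Formally `Q_s[T] = (s - T)(s̄ - T)`, so `(s̄ - T) Q_s[T]⁻¹` plays the role of `(s - T)⁻¹`. The
real operators and a complex-valued functional make this meaningful without complexifying the
module. -/
theorem resFun_recursion (h : ResolventBound T φ) (l : E →L[ℝ] ℝ) {s : ℂ} (hs : s ∈ outerSector φ)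
    {u u' : E} (hu : (u, u') ∈ T.graph) : s * resFun T l s u - resFun T l s u' = l u := by
  have hq := h.quad s hs
  have h1 : quadRes T s u' = mulQuadRes T s u := hq.comm hu
  have h2 : mulQuadRes T s u' = u + (2 * s.re) • mulQuadRes T s u - (‖s‖ ^ 2) • quadRes T s u :=
    T.mem_graph_snd_inj (hq.map_graph' hu) (hq.graph₂ u) rfl
  rw [resFun_apply, resFun_apply, h1, h2]
  simp only [map_add, map_sub, map_smul, smul_eq_mul, ofReal_add, ofReal_sub]
  rw [ofReal_mul, ofReal_mul (‖s‖ ^ 2), ofReal_two_re, ofReal_norm_sq]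
  ring

/-- This is the first resolvent identity: the bracket is `ℓ ((s̄ - T)(s̄₀ - T) Q_s[T]⁻¹ Q_{s₀}[T]⁻¹
u)`, expanded into real operators. -/
theorem resFun_sub (h : ResolventBound T φ) (l : E →L[ℝ] ℝ) {s s₀ : ℂ} (hs : s ∈ outerSector φ)
    (hs₀ : s₀ ∈ outerSector φ) (u : E) : resFun T l s u - resFun T l s₀ u =
      -(s - s₀) * ((starRingEnd ℂ) s * (starRingEnd ℂ) s₀ * l (quadRes T s (quadRes T s₀ u)) -
        ((starRingEnd ℂ) s + (starRingEnd ℂ) s₀) * l (quadRes T s (mulQuadRes T s₀ u)) +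
        l (mulQuadRes T s (mulQuadRes T s₀ u))) := by
  have hq := h.quad s hs
  have hq₀ := h.quad s₀ hs₀
  have h1 := hq.R_eq hq₀ u
  have h2 := hq.R_sub_R hq₀ u
  have h3 := hq.S_sub_S hq₀ u
  have e1 := congrArg (fun x => ((l x : ℝ) : ℂ)) h1
  have e2 := congrArg (fun x => ((l x : ℝ) : ℂ)) h2
  have e3 := congrArg (fun x => ((l x : ℝ) : ℂ)) h3
  simp only [map_add, map_sub, map_smul, smul_eq_mul, ofReal_add, ofReal_sub] at e1 e2 e3
  rw [ofReal_mul (2 * s₀.re), ofReal_mul (‖s₀‖ ^ 2), ofReal_two_re, ofReal_norm_sq] at e1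
  have e4 : ((2 * (s.re - s₀.re) : ℝ) : ℂ) =
      s + (starRingEnd ℂ) s - (s₀ + (starRingEnd ℂ) s₀) := by
    rw [← ofReal_two_re, ← ofReal_two_re, ← ofReal_sub]; congr 1; ring
  rw [ofReal_mul (2 * (s.re - s₀.re)), ofReal_mul
      (‖s₀‖ ^ 2 - ‖s‖ ^ 2), e4, ofReal_sub, ofReal_norm_sq, ofReal_norm_sq] at e2 e3
  rw [resFun_apply, resFun_apply]
  linear_combination ((starRingEnd ℂ) s - (starRingEnd ℂ) s₀) * e1 + (starRingEnd ℂ) s₀ * e2 - e3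

/-- By the resolvent identity the difference quotient is an explicit function `B` of `s`. Conjugates
occur in `B`, but continuity of `B` at `s₀` is enough for a complex derivative to exist. -/
theorem differentiableAt_resFun (h : ResolventBound T φ) (l : E →L[ℝ] ℝ) {s₀ : ℂ}
    (hs₀ : outerSector φ ∈ 𝓝 s₀) (u : E) : DifferentiableAt ℂ (fun s => resFun T l s u) s₀ := by
  obtain ⟨cR, cS⟩ := h.continuousAt hs₀
  set B : ℂ → ℂ := fun s => -((starRingEnd ℂ) s * (starRingEnd ℂ) s₀ *
        l (quadRes T s (quadRes T s₀ u)) -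
      ((starRingEnd ℂ) s + (starRingEnd ℂ) s₀) * l (quadRes T s (mulQuadRes T s₀ u)) +
        l (mulQuadRes T s (mulQuadRes T s₀ u))) with hB
  have e : ∀ v, ContinuousAt (fun s => ((l (quadRes T s v) : ℝ) : ℂ)) s₀ := fun v =>
    continuous_ofReal.continuousAt.comp (l.continuous.continuousAt.comp
      (f := fun s => quadRes T s v) (cR.clm_apply continuousAt_const))
  have e' : ∀ v, ContinuousAt (fun s => ((l (mulQuadRes T s v) : ℝ) : ℂ)) s₀ := fun v =>
    continuous_ofReal.continuousAt.comp (l.continuous.continuousAt.comp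
      (f := fun s => mulQuadRes T s v) (cS.clm_apply continuousAt_const))
  have hc : ContinuousAt (starRingEnd ℂ : ℂ → ℂ) s₀ := continuous_conj.continuousAt
  have hBc : ContinuousAt B s₀ :=
    ((((hc.mul_const _).mul (e _)).sub ((hc.add continuousAt_const).mul (e _))).add (e' _)).neg
  refine HasDerivAt.differentiableAt (f' := B s₀) (hasDerivAt_iff_tendsto_slope.2 ?_)
  refine (hBc.tendsto.mono_left nhdsWithin_le_nhds).congr' ?_
  filter_upwards [mem_nhdsWithin_of_mem_nhds hs₀, self_mem_nhdsWithin] with s hs hne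
  rw [slope_def_field, h.resFun_sub l hs (mem_of_mem_nhds hs₀), eq_div_iff (sub_ne_zero.2 hne)]
  simp only [hB]
  ring

theorem bound_resFun (h : ResolventBound T φ) (l : E →L[ℝ] ℝ) (u : E) :
    ∃ C ≥ 0, ∀ s ∈ outerSector φ, ‖resFun T l s u‖ ≤ C / ‖s‖ := by
  obtain ⟨C, hC, hb⟩ := h.bound
  refine ⟨2 * (‖l‖ * (C * ‖u‖)), by positivity, fun s hs => ?_⟩
  have hpos := norm_pos_of_mem_outerSector hs
  obtain ⟨h1, h2⟩ := hb s hs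
  have e : ∀ A : E →L[ℝ] E, ‖((l (A u) : ℝ) : ℂ)‖ ≤ ‖l‖ * (‖A‖ * ‖u‖) := fun A => by
    rw [norm_real]
    exact (l.le_opNorm _).trans (mul_le_mul_of_nonneg_left (A.le_opNorm u) (norm_nonneg _))
  have e1 : ‖(starRingEnd ℂ) s * l (quadRes T s u)‖ ≤ ‖s‖ * (‖l‖ * (C / ‖s‖ ^ 2 * ‖u‖)) := by
    rw [norm_mul, norm_conj]
    refine mul_le_mul_of_nonneg_left ((e _).trans ?_) hpos.le
    gcongr
  have e2 : ‖((l (mulQuadRes T s u) : ℝ) : ℂ)‖ ≤ ‖l‖ * (C / ‖s‖ * ‖u‖) := by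
    refine (e _).trans ?_
    gcongr
  rw [resFun_apply]
  refine (norm_sub_le _ _).trans ((add_le_add e1 e2).trans (le_of_eq ?_))
  field_simp
  ring

/-- Estimates at the smaller angle `φ'` hold on a neighbourhood of each point of `outerSector φ`,
including its boundary rays, where the integrals live. -/
theorem isResolventSeq {φ' : ℝ} (h : ResolventBound T φ') (h0 : 0 < φ') (hφ' : φ' < φ)
    (hφ : φ < Real.pi / 2) (l : E →L[ℝ] ℝ) {M : ℕ} {w : ℕ → E} (hw : IsOrbit T M w) :
    IsResolventSeq φ M (fun k => l (w k)) fun k s => resFun T l s (w k) where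
  recursion s hs k hk := h.resFun_recursion l
    (mem_of_mem_nhds (outerSector_mem_nhds h0 hφ' hφ hs)) (hw k hk)
  differentiableAt k s hs := h.differentiableAt_resFun l (outerSector_mem_nhds h0 hφ' hφ hs) _
  bound k := by
    obtain ⟨C, hC, hb⟩ := h.bound_resFun l (w k)
    exact ⟨C, hC, fun s hs => hb s (mem_of_mem_nhds (outerSector_mem_nhds h0 hφ' hφ hs))⟩

end ResolventBound

end ResolventFunctions

/-! ### The planes `ℂ_J` and double sectors of paravectors -/

section Planes

open Complex Filter Topology

variable {n : ℕ}

theorem para_eq_sum {J : Cl n} (hJ : J ∈ Sph n) : J = ∑ i, J {i} • (basisVec {i} : Cl n) := by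
  ext A
  rw [WithLp.ofLp_sum, Finset.sum_apply]
  simp only [PiLp.smul_apply, basisVec_apply, smul_eq_mul, mul_ite, mul_one, mul_zero]
  rcases lt_trichotomy A.card 1 with h | h | h
  · have hA : A = ∅ := Finset.card_eq_zero.1 (by omega)
    subst hA
    rw [hJ.2.1, Finset.sum_eq_zero]
    intro i _
    rw [if_neg (Finset.singleton_ne_empty i).symm]
  · obtain ⟨j, rfl⟩ := Finset.card_eq_one.1 h
    rw [Finset.sum_eq_single j]
    · simp
    · intro i _ hi
      rw [if_neg (fun h => hi (Finset.singleton_injective h).symm)]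
    · simp
  · rw [hJ.1 A h, Finset.sum_eq_zero]
    intro i _
    rw [if_neg]
    rintro rfl
    simp at h

/-- Symmetrising the double sum `∑ J_i J_j e_i e_j` cancels the terms with `i ≠ j` and leaves `2 J²
= -2 |J|²`. -/
theorem sph_mul_self {J : Cl n} (hJ : J ∈ Sph n) : J * J = -1 := by
  have hnorm : ∑ i, J {i} * J {i} = 1 := by
    have h1 : ‖J‖ ^ 2 = 1 := by rw [hJ.2.2, one_pow]
    rw [PiLp.norm_sq_eq_of_L2] at h1
    have h0 := Finset.sum_map Finset.univ
      (⟨fun i : Fin n => ({i} : Finset (Fin n)), Finset.singleton_injective⟩ :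
        Fin n ↪ Finset (Fin n)) (fun A => J A * J A)
    simp only [Function.Embedding.coeFn_mk] at h0
    rw [← h1, ← h0]
    simp only [Real.norm_eq_abs, pow_two, abs_mul_abs_self]
    refine Finset.sum_subset (Finset.subset_univ _) fun A _ hA => ?_
    have hA0 : J A = 0 := by
      rcases lt_trichotomy A.card 1 with h | h | h
      · rw [Finset.card_eq_zero.1 (by omega : A.card = 0)]; exact hJ.2.1
      · obtain ⟨j, rfl⟩ := Finset.card_eq_one.1 h
        exact absurd (Finset.mem_map.2 ⟨j, Finset.mem_univ j, rfl⟩) hA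
      · exact hJ.1 A h
    rw [hA0, mul_zero]
  have h2 : J * J = ∑ i, ∑ j, (J {i} * J {j}) • (basisVec {i} * basisVec {j} : Cl n) := by
    conv_lhs => rw [para_eq_sum hJ]
    rw [Finset.sum_mul_sum]
    exact Finset.sum_congr rfl fun i _ => Finset.sum_congr rfl fun j _ => smul_mul_smul_comm _ _ _ _
  have h3 : J * J = ∑ i, ∑ j, (J {i} * J {j}) • (basisVec {j} * basisVec {i} : Cl n) := by
    rw [h2, Finset.sum_comm]
    exact Finset.sum_congr rfl fun i _ => Finset.sum_congr rfl fun j _ => by rw [mul_comm (J {j})]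
  have h4 : J * J + J * J = (2 : ℝ) • (-1 : Cl n) := by
    nth_rw 1 [h2]
    rw [h3, ← Finset.sum_add_distrib]
    have : ∀ i : Fin n, (∑ j, (J {i} * J {j}) • (basisVec {i} * basisVec {j} : Cl n)) +
        (∑ j, (J {i} * J {j}) • (basisVec {j} * basisVec {i} : Cl n)) =
        (J {i} * J {i}) • (2 : ℝ) • (-1 : Cl n) := fun i => by
      rw [← Finset.sum_add_distrib, Finset.sum_eq_single i]
      · rw [gen_sq, two_smul, smul_add]
      · intro j _ hj
        rw [gen_anticomm hj, smul_neg, add_neg_cancel]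
      · simp
    rw [Finset.sum_congr rfl fun i _ => this i, ← Finset.sum_smul, hnorm, one_smul]
  rw [← two_smul ℝ (J * J)] at h4
  exact smul_right_injective _ (two_ne_zero' ℝ) h4

/-- The embedding of the complex plane onto `ℂ_J`. -/
noncomputable def planeEmb {J : Cl n} (hJ : J ∈ Sph n) : ℂ →ₐ[ℝ] Cl n :=
  Complex.lift ⟨J, sph_mul_self hJ⟩

variable {J : Cl n} (hJ : J ∈ Sph n)

theorem planeEmb_apply (z : ℂ) : planeEmb hJ z = z.re • (1 : Cl n) + z.im • J := by
  rw [planeEmb, Complex.lift_apply, Complex.liftAux_apply, Algebra.algebraMap_eq_smul_one]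

theorem planeEmb_coeff_empty (z : ℂ) : planeEmb hJ z ∅ = z.re := by
  rw [planeEmb_apply, PiLp.add_apply, PiLp.smul_apply, PiLp.smul_apply, hJ.2.1, one_apply]
  simp

theorem planeEmb_mem_para (z : ℂ) : planeEmb hJ z ∈ Para n := fun A hA => by
  rw [planeEmb_apply, PiLp.add_apply, PiLp.smul_apply, PiLp.smul_apply, hJ.1 A hA, one_apply,
    if_neg (by rintro rfl; simp at hA)]
  simp

theorem norm_planeEmb (z : ℂ) : ‖planeEmb hJ z‖ = ‖z‖ := by
  have h1 : ‖planeEmb hJ z‖ ^ 2 = ‖z‖ ^ 2 := by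
    rw [PiLp.norm_sq_eq_of_L2]
    have hA : ∀ A, ‖planeEmb hJ z A‖ ^ 2 =
        (if A = ∅ then z.re ^ 2 else 0) + z.im ^ 2 * ‖J A‖ ^ 2 := fun A => by
      rw [planeEmb_apply, PiLp.add_apply, PiLp.smul_apply, PiLp.smul_apply, one_apply,
        Real.norm_eq_abs, Real.norm_eq_abs, sq_abs, sq_abs, smul_eq_mul, smul_eq_mul]
      by_cases h : A = ∅
      · subst h
        rw [if_pos rfl, if_pos rfl, hJ.2.1]; ring
      · rw [if_neg h, if_neg h]; ring
    rw [Finset.sum_congr rfl fun A _ => hA A, Finset.sum_add_distrib, ← Finset.mul_sum,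
      ← PiLp.norm_sq_eq_of_L2, hJ.2.2, Finset.sum_ite_eq' Finset.univ, if_pos (Finset.mem_univ _),
      ← normSq_eq_norm_sq, normSq_apply]
    ring
  exact (pow_left_inj₀ (norm_nonneg _) (norm_nonneg _) two_ne_zero).1 h1

theorem conj_planeEmb (z : ℂ) : conj (planeEmb hJ z) = planeEmb hJ ((starRingEnd ℂ) z) := by
  ext A
  change (-1 : ℝ) ^ (A.card * (A.card + 1) / 2) * planeEmb hJ z A = _
  rcases lt_trichotomy A.card 1 with h | h | h
  · rw [Finset.card_eq_zero.1 (by omega : A.card = 0), planeEmb_coeff_empty, planeEmb_coeff_empty]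
    simp
  · have hne : A ≠ ∅ := by rintro rfl; simp at h
    rw [h, planeEmb_apply, planeEmb_apply]
    simp [one_apply, hne]
  · rw [planeEmb_mem_para hJ z A h, planeEmb_mem_para hJ _ A h, mul_zero]

theorem pol_eq_planeEmb (t φ : ℝ) : pol J t φ = planeEmb hJ (t * exp (φ * I)) := by
  rw [planeEmb_apply, ray_re, ray_im, pol, smul_add, smul_smul, smul_smul]

theorem aeval_planeEmb (z : ℂ) (p : ℝ[X]) :
    Polynomial.aeval (planeEmb hJ z) p = planeEmb hJ (Polynomial.aeval z p) :=
  Polynomial.aeval_algHom_apply (planeEmb hJ) z p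

theorem inverse_planeEmb (z : ℂ) : Ring.inverse (planeEmb hJ z) = planeEmb hJ z⁻¹ := by
  by_cases hz : z = 0
  · simp [hz]
  · have h1 : planeEmb hJ z * planeEmb hJ z⁻¹ = 1 := by
      rw [← map_mul, mul_inv_cancel₀ hz, map_one]
    have h2 : planeEmb hJ z⁻¹ * planeEmb hJ z = 1 := by
      rw [← map_mul, inv_mul_cancel₀ hz, map_one]
    exact Ring.inverse_unit ⟨_, _, h1, h2⟩

theorem planeEmb_I : planeEmb hJ I = J := by
  rw [planeEmb_apply]; simp

theorem ratFun_planeEmb (p q : ℝ[X]) (z : ℂ) :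
    ratFun p q (planeEmb hJ z) = planeEmb hJ (Polynomial.aeval z p / Polynomial.aeval z q) := by
  rw [ratFun, aeval_planeEmb, aeval_planeEmb, inverse_planeEmb, ← map_mul, div_eq_mul_inv]

theorem planeEmb_continuous : Continuous (planeEmb hJ) := by
  simp only [funext (planeEmb_apply hJ)]
  fun_prop

theorem exists_sph (hn : 1 ≤ n) : ∃ J : Cl n, J ∈ Sph n := by
  refine ⟨basisVec {⟨0, hn⟩}, fun A hA => ?_, ?_, ?_⟩
  · rw [basisVec_apply, if_neg (by rintro rfl; simp at hA)]
  · rw [basisVec_apply, if_neg (Finset.singleton_ne_empty _).symm]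
  · simp [basisVec]

theorem cos_lt_abs_cos_of_mem_angles {θ : ℝ} (hθ : θ ∈ Set.Ioo 0 (Real.pi / 2)) {φ : ℝ}
    (hφ : φ ∈ angles θ) :
    Real.cos θ < |Real.cos φ| := by
  have hpi := Real.pi_pos
  have hθ1 := hθ.1
  have hθ2 := hθ.2
  have key : ∀ x : ℝ, x ∈ Set.Ioo (-θ) θ → Real.cos θ < Real.cos x := fun x hx => by
    rw [← Real.cos_abs x]
    exact Real.cos_lt_cos_of_nonneg_of_le_pi (abs_nonneg x) (by linarith) (abs_lt.2 hx)
  rcases hφ with h | h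
  · exact (key φ h).trans_le (le_abs_self _)
  · have h1 := key (φ - Real.pi) ⟨by linarith [h.1], by linarith [h.2]⟩
    rw [Real.cos_sub_pi] at h1
    exact h1.trans_le (neg_le_abs _)

/-- Norm and scalar part determine membership, and they do not depend on the plane in which a
paravector is written. This lets every question about `dblSector` be decided in one plane. -/
theorem planeEmb_mem_dblSector {θ : ℝ} (hθ : θ ∈ Set.Ioo 0 (Real.pi / 2)) {z : ℂ} :
    planeEmb hJ z ∈ dblSector n θ ↔ Real.cos θ * ‖z‖ < |z.re| := by
  have hpi := Real.pi_pos
  have hθ1 := hθ.1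
  have hθ2 := hθ.2
  constructor
  · rintro ⟨K, hK, t, ht, φ, hφ, h⟩
    rw [pol_eq_planeEmb hK] at h
    have h1 : ‖z‖ = t := by rw [← norm_planeEmb hJ, h, norm_planeEmb, norm_ray _ _ ht]
    have h2 : z.re = t * Real.cos φ := by
      rw [← planeEmb_coeff_empty hJ, h, planeEmb_coeff_empty, ray_re]
    rw [h1, h2, abs_mul, abs_of_pos ht, mul_comm]
    exact mul_lt_mul_of_pos_left (cos_lt_abs_cos_of_mem_angles hθ hφ) ht
  · intro h
    have hz : z ≠ 0 := by rintro rfl; simp at h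
    have hpos : 0 < ‖z‖ := norm_pos_iff.2 hz
    have hc : z.re = ‖z‖ * Real.cos z.arg := by rw [cos_arg hz]; field_simp
    have hrep : planeEmb hJ z = pol J ‖z‖ z.arg := by
      rw [pol_eq_planeEmb hJ, norm_mul_exp_arg_mul_I]
    rw [hc, abs_mul, abs_of_pos hpos, mul_comm] at h
    have h' : Real.cos θ < |Real.cos z.arg| := lt_of_mul_lt_mul_left h hpos.le
    have ha := abs_arg_le_pi z
    rcases le_or_gt 0 (Real.cos z.arg) with h0 | h0
    · rw [abs_of_nonneg h0, ← Real.cos_abs z.arg] at h'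
      have : |z.arg| < θ := by
        by_contra! hc
        exact absurd (Real.cos_le_cos_of_nonneg_of_le_pi hθ1.le ha hc) (not_le.2 h')
      exact ⟨J, hJ, ‖z‖, hpos, z.arg, Or.inl (abs_lt.1 this), hrep⟩
    · rw [abs_of_neg h0, ← Real.cos_abs z.arg, ← Real.cos_pi_sub] at h'
      have hlt : Real.pi - |z.arg| < θ := by
        by_contra! hc
        exact absurd (Real.cos_le_cos_of_nonneg_of_le_pi hθ1.le
          (by linarith [abs_nonneg z.arg]) hc) (not_le.2 h')
      rcases le_or_gt 0 z.arg with h2 | h2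
      · rw [abs_of_nonneg h2] at hlt ha
        exact ⟨J, hJ, ‖z‖, hpos, z.arg, Or.inr ⟨by linarith, by linarith⟩, hrep⟩
      · rw [abs_of_neg h2] at hlt ha
        -- The principal argument is near `-π` here, whereas `angles` asks for a value near `+π`.
        refine ⟨J, hJ, ‖z‖, hpos, z.arg + 2 * Real.pi, Or.inr ⟨by linarith, by linarith⟩, ?_⟩
        rw [hrep, pol, pol, Real.cos_add_two_pi, Real.sin_add_two_pi]

theorem exists_planeEmb_of_mem_dblSector {θ : ℝ} {s : Cl n} (hs : s ∈ dblSector n θ) :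
    ∃ J, ∃ hJ : J ∈ Sph n, ∃ z : ℂ, s = planeEmb hJ z := by
  obtain ⟨J, hJ, t, -, φ, -, rfl⟩ := hs
  exact ⟨J, hJ, _, pol_eq_planeEmb hJ t φ⟩

theorem dblSector_subset {θ : ℝ} (hθ : θ ∈ Set.Ioo 0 (Real.pi / 2)) :
    dblSector n θ ⊆ {s | s ∈ Para n ∧ Real.cos θ * ‖s‖ ≤ |s ∅|} := by
  intro s hs
  obtain ⟨J, hJ, z, rfl⟩ := exists_planeEmb_of_mem_dblSector hs
  refine ⟨planeEmb_mem_para hJ z, ?_⟩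
  rw [norm_planeEmb, planeEmb_coeff_empty]
  exact ((planeEmb_mem_dblSector hJ hθ).1 hs).le

theorem isClosed_para : IsClosed (Para n) := by
  have : Para n = ⋂ A : Finset (Fin n), ⋂ _ : 1 < A.card, {s : Cl n | s A = 0} := by
    ext s; simp [Para]
  rw [this]
  exact isClosed_iInter fun A => isClosed_iInter fun _ =>
    isClosed_eq (by fun_prop) continuous_const

/-- Moving a point of the closed sector by `ε` along the real axis, away from zero, increases `|Re
z|` by `ε` and `‖z‖` by at most `ε`. As `cos θ < 1`, it enters the open sector; the vertex is
covered too. -/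
theorem planeEmb_mem_closure {θ : ℝ} (hθ : θ ∈ Set.Ioo 0 (Real.pi / 2)) {z : ℂ} :
    planeEmb hJ z ∈ closure (dblSector n θ) ↔ z ∈ closedBisector θ := by
  have hcos := Real.cos_lt_cos_of_nonneg_of_le_pi_div_two le_rfl hθ.2.le hθ.1
  rw [Real.cos_zero] at hcos
  have hcos0 := Real.cos_pos_of_mem_Ioo ⟨by linarith [hθ.1, Real.pi_pos], hθ.2⟩
  constructor
  · intro h
    have hcl : IsClosed {s : Cl n | s ∈ Para n ∧ Real.cos θ * ‖s‖ ≤ |s ∅|} := by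
      refine IsClosed.and isClosed_para ?_
      exact isClosed_le (by fun_prop) (by fun_prop)
    have := (closure_minimal (dblSector_subset hθ) hcl h).2
    rwa [norm_planeEmb, planeEmb_coeff_empty] at this
  · intro h
    obtain ⟨σ, hσ, hσ'⟩ : ∃ σ : ℝ, |σ| = 1 ∧ ∀ ε : ℝ, 0 < ε → |z.re + ε * σ| = |z.re| + ε := by
      rcases le_or_gt 0 z.re with h0 | h0
      · exact ⟨1, by simp, fun ε hε => by
          rw [abs_of_nonneg h0, abs_of_nonneg (by linarith), mul_one]⟩
      · exact ⟨-1, by simp, fun ε hε => by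
          rw [abs_of_neg h0, abs_of_neg (by linarith)]; ring⟩
    have hlim : Tendsto (fun ε : ℝ => planeEmb hJ (z + (ε * σ : ℝ))) (𝓝[>] 0)
        (𝓝 (planeEmb hJ z)) := by
      have hc : Continuous fun ε : ℝ => planeEmb hJ (z + (ε * σ : ℝ)) :=
        (planeEmb_continuous hJ).comp (by fun_prop)
      have := hc.tendsto 0
      simp only [zero_mul, ofReal_zero, add_zero] at this
      exact this.mono_left nhdsWithin_le_nhds
    refine mem_closure_of_tendsto hlim ?_
    filter_upwards [self_mem_nhdsWithin] with ε hε
    have hε' : (0 : ℝ) < ε := hε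
    rw [planeEmb_mem_dblSector hJ hθ, add_re, ofReal_re, hσ' ε hε']
    have h1 : ‖z + (ε * σ : ℝ)‖ ≤ ‖z‖ + ε := by
      refine (norm_add_le _ _).trans ?_
      rw [norm_real, Real.norm_eq_abs, abs_mul, hσ, mul_one, abs_of_pos hε']
    have h2 : Real.cos θ * ‖z‖ ≤ |z.re| := h
    nlinarith

end Planes

/-! ### The resolvents of a bisectorial operator -/

section Bisectorial

open Complex Filter Topology

variable {n : ℕ} {X : Type*} [NormedAddCommGroup X] [NormedSpace ℝ X]
  {T : CliffMod n X →ₗ.[ℝ] CliffMod n X} {ω φ : ℝ} {J : Cl n} (hJ : J ∈ Sph n)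

theorem lmul_planeEmb (z : ℂ) : (lmul (planeEmb hJ z) : CliffMod n X →L[ℝ] CliffMod n X) =
    z.re • ContinuousLinearMap.id ℝ (CliffMod n X) + z.im • lmul J := by
  ext v C
  have h1 := congrArg (fun u : CliffMod n X => u C) (one_lmul v)
  simp only [lmul_apply] at h1
  simp only [add_apply, smul_apply,
    ContinuousLinearMap.id_apply, PiLp.add_apply, PiLp.smul_apply, lmul_apply]
  rw [← h1, Finset.smul_sum, Finset.smul_sum, ← Finset.sum_add_distrib]
  refine Finset.sum_congr rfl fun B _ => ?_
  rw [planeEmb_apply, PiLp.add_apply, PiLp.smul_apply, PiLp.smul_apply, smul_eq_mul, smul_eq_mul,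
    smul_smul, smul_smul, ← add_smul]
  congr 1
  ring

theorem lmul_comp_lmul_self (hJ : J ∈ Sph n) :
    (lmul J : CliffMod n X →L[ℝ] CliffMod n X).comp (lmul J) =
    -ContinuousLinearMap.id ℝ (CliffMod n X) := by
  ext1 v
  rw [ContinuousLinearMap.comp_apply, lmul_lmul, ← mul_def, sph_mul_self hJ]
  have : (-1 : Cl n) = planeEmb hJ (-1) := by rw [map_neg, map_one]
  rw [this, lmul_planeEmb]
  simp

theorem norm_lmul_planeEmb_le (z : ℂ) :
    ‖(lmul (planeEmb hJ z) : CliffMod n X →L[ℝ] CliffMod n X)‖ ≤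
      ‖z‖ * (1 + ‖(lmul J : CliffMod n X →L[ℝ] CliffMod n X)‖) := by
  rw [lmul_planeEmb]
  refine (norm_add_le _ _).trans ?_
  rw [norm_smul, norm_smul, Real.norm_eq_abs, Real.norm_eq_abs, mul_add, mul_one]
  refine add_le_add ?_ (mul_le_mul_of_nonneg_right (abs_im_le_norm z) (norm_nonneg _))
  calc |z.re| * ‖ContinuousLinearMap.id ℝ (CliffMod n X)‖ ≤ |z.re| * 1 :=
        mul_le_mul_of_nonneg_left ContinuousLinearMap.norm_id_le (abs_nonneg _)
    _ ≤ ‖z‖ := by rw [mul_one]; exact abs_re_le_norm z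

theorem continuous_lmul_planeEmb :
    Continuous fun z => (lmul (planeEmb hJ z) : CliffMod n X →L[ℝ] CliffMod n X) := by
  simp only [lmul_planeEmb]
  fun_prop

theorem Qop_planeEmb (z : ℂ) : Qop T (planeEmb hJ z) = polyOp T (quadPoly z.re (‖z‖ ^ 2)) := by
  rw [Qop, planeEmb_coeff_empty, norm_planeEmb, quadPoly]

theorem notMem_closedBisector_of_mem_outerSector (hω : 0 < ω) (hφ : ω < φ)
    (hφ' : φ < Real.pi / 2) {z : ℂ} (hz : z ∈ outerSector φ) : z ∉ closedBisector ω := by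
  intro h
  have h1 := Real.cos_lt_cos_of_nonneg_of_le_pi_div_two hω.le hφ'.le hφ
  have h2 : Real.cos ω * ‖z‖ ≤ |z.re| := h
  nlinarith [hz.2, norm_pos_of_mem_outerSector hz]

theorem IsBisectorial.quadInv [CompleteSpace X] (hJ : J ∈ Sph n) (hT : IsBisectorial T ω)
    (hω : ω ∈ Set.Ioo 0 (Real.pi / 2)) {z : ℂ} (hz : z ∉ closedBisector ω) :
    QuadInv T z.re (‖z‖ ^ 2) (quadRes T z) (mulQuadRes T z) := by
  have h1 : planeEmb hJ z ∈ resolventSet T := by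
    by_contra h
    exact hz ((planeEmb_mem_closure hJ hω).1 (hT.spectrum_subset ⟨planeEmb_mem_para hJ z, h⟩))
  have h2 := h1.2
  rw [Qop_planeEmb] at h2
  obtain ⟨R, S, h⟩ := exists_quadInv hT.closedOp.closed h2
  exact h.quadRes

theorem QuadInv.SLres_planeEmb {z : ℂ}
    (h : QuadInv T z.re (‖z‖ ^ 2) (CliffordCalculus.quadRes T z) (mulQuadRes T z)) :
    SLres T (planeEmb hJ z) = (CliffordCalculus.quadRes T z).comp
      (lmul (planeEmb hJ ((starRingEnd ℂ) z))) - mulQuadRes T z := by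
  rw [SLres, Qop_planeEmb, conj_planeEmb]
  exact h.toBounded_resolvent _

theorem quadRes_conj (z : ℂ) : quadRes T ((starRingEnd ℂ) z) = quadRes T z := by
  rw [quadRes, quadRes, conj_re, norm_conj]

theorem mulQuadRes_conj (z : ℂ) : mulQuadRes T ((starRingEnd ℂ) z) = mulQuadRes T z := by
  rw [mulQuadRes, mulQuadRes, conj_re, norm_conj]

theorem QuadInv.SLres_planeEmb_conj {z : ℂ}
    (h : QuadInv T z.re (‖z‖ ^ 2) (CliffordCalculus.quadRes T z) (mulQuadRes T z)) :
    SLres T (planeEmb hJ ((starRingEnd ℂ) z)) =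
      (CliffordCalculus.quadRes T z).comp (lmul (planeEmb hJ z)) - mulQuadRes T z := by
  have h' : QuadInv T ((starRingEnd ℂ) z).re (‖(starRingEnd ℂ) z‖ ^ 2)
      (CliffordCalculus.quadRes T ((starRingEnd ℂ) z)) (mulQuadRes T ((starRingEnd ℂ) z)) := by
    rwa [quadRes_conj, mulQuadRes_conj, conj_re, norm_conj]
  rw [h'.SLres_planeEmb, quadRes_conj, mulQuadRes_conj, conj_conj]

theorem planeEmb_mem_compl {z : ℂ} (hφ : φ ∈ Set.Ioo 0 (Real.pi / 2)) (hz0 : z ≠ 0)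
    (hz : |z.re| ≤ Real.cos φ * ‖z‖) : planeEmb hJ z ∈ Para n \ (dblSector n φ ∪ {0}) := by
  refine ⟨planeEmb_mem_para hJ z, ?_⟩
  rintro (h | h)
  · exact absurd ((planeEmb_mem_dblSector hJ hφ).1 h) (not_lt.2 hz)
  · have h1 := norm_planeEmb hJ z
    rw [Set.mem_singleton_iff.1 h, norm_zero, eq_comm, norm_eq_zero] at h1
    exact hz0 h1

theorem sin_mul_norm_le_im {z : ℂ} (hz : z ∈ outerSector φ) : Real.sin φ * ‖z‖ ≤ z.im := by
  have h1 : z.re ^ 2 + z.im ^ 2 = ‖z‖ ^ 2 := by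
    rw [← normSq_eq_norm_sq, normSq_apply]; ring
  have h2 : z.re ^ 2 ≤ (Real.cos φ * ‖z‖) ^ 2 := by
    rw [← sq_abs z.re]; exact pow_le_pow_left₀ (abs_nonneg _) hz.2 2
  refine le_of_sq_le_sq ?_ hz.1.le
  have := Real.sin_sq_add_cos_sq φ
  nlinarith

/-- In the difference of `S_L⁻¹` at `s` and `s̄` the terms `T Q_s[T]⁻¹` cancel, leaving `Q_s[T]⁻¹
(s̄ - s)`. Composing with `J` removes the imaginary unit. This is how bounds on `S_L⁻¹` become
bounds on `Q_s[T]⁻¹`. -/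
theorem QuadInv.smul_quadRes {z : ℂ}
    (h : QuadInv T z.re (‖z‖ ^ 2) (CliffordCalculus.quadRes T z) (mulQuadRes T z)) :
    (2 * z.im) • CliffordCalculus.quadRes T z =
      (SLres T (planeEmb hJ z) - SLres T (planeEmb hJ ((starRingEnd ℂ) z))).comp (lmul J) := by
  rw [h.SLres_planeEmb, h.SLres_planeEmb_conj, sub_sub_sub_cancel_right,
    ← ContinuousLinearMap.comp_sub, lmul_planeEmb, lmul_planeEmb, conj_re, conj_im]
  have : z.re • ContinuousLinearMap.id ℝ (CliffMod n X) + -z.im • lmul J -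
      (z.re • ContinuousLinearMap.id ℝ (CliffMod n X) + z.im • lmul J) =
      (-(2 * z.im)) • lmul J := by module
  rw [this, ContinuousLinearMap.comp_assoc, ContinuousLinearMap.smul_comp,
    lmul_comp_lmul_self hJ]
  ext1 v
  simp

/-- The estimates of `S_L⁻¹` at `s` and `s̄` give estimates of `Q_s[T]⁻¹` and `T Q_s[T]⁻¹`. -/
theorem norm_quadRes_le {z : ℂ} {C : ℝ} (hφ : φ ∈ Set.Ioo 0 (Real.pi / 2))
    (hz : z ∈ outerSector φ)
    (h : QuadInv T z.re (‖z‖ ^ 2) (quadRes T z) (mulQuadRes T z))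
    (b1 : ‖SLres T (planeEmb hJ z)‖ ≤ C / ‖z‖)
    (b2 : ‖SLres T (planeEmb hJ ((starRingEnd ℂ) z))‖ ≤ C / ‖z‖) :
    ‖quadRes T z‖ ≤
      (C * ‖(lmul J : CliffMod n X →L[ℝ] CliffMod n X)‖ / Real.sin φ) / ‖z‖ ^ 2 := by
  have hpos := norm_pos_of_mem_outerSector hz
  have hsin : 0 < Real.sin φ := Real.sin_pos_of_pos_of_lt_pi hφ.1 (by linarith [hφ.2, Real.pi_pos])
  have him := sin_mul_norm_le_im hz
  have h4 := congrArg norm (h.smul_quadRes hJ)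
  rw [norm_smul, Real.norm_of_nonneg (by linarith [hz.1])] at h4
  have h3 := ContinuousLinearMap.opNorm_comp_le
    (SLres T (planeEmb hJ z) - SLres T (planeEmb hJ ((starRingEnd ℂ) z))) (lmul J)
  rw [← h4] at h3
  have h8 := (norm_sub_le (SLres T (planeEmb hJ z))
    (SLres T (planeEmb hJ ((starRingEnd ℂ) z)))).trans (add_le_add b1 b2)
  have hm0 : 0 ≤ ‖(lmul J : CliffMod n X →L[ℝ] CliffMod n X)‖ := norm_nonneg _
  have hx0 : 0 ≤ ‖quadRes T z‖ := norm_nonneg _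
  generalize ‖(lmul J : CliffMod n X →L[ℝ] CliffMod n X)‖ = m at *
  generalize ‖quadRes T z‖ = x at *
  generalize ‖SLres T (planeEmb hJ z) - SLres T (planeEmb hJ ((starRingEnd ℂ) z))‖ = y at *
  have e1 : 2 * (Real.sin φ * ‖z‖) * x ≤ 2 * (C / ‖z‖) * m := by
    have := mul_le_mul_of_nonneg_right him hx0
    have := mul_le_mul_of_nonneg_right h8 hm0
    linarith
  rw [div_div, le_div_iff₀ (by positivity)]
  have e2 := mul_le_mul_of_nonneg_right e1 hpos.le
  have e3 : 2 * (C / ‖z‖) * m * ‖z‖ = 2 * (C * m) := by field_simp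
  rw [e3] at e2
  linarith

theorem IsBisectorial.resolventBound [CompleteSpace X] (hJ : J ∈ Sph n) (hT : IsBisectorial T ω)
    (hω : ω ∈ Set.Ioo 0 (Real.pi / 2)) (hφ : φ ∈ Set.Ioo ω (Real.pi / 2)) :
    ResolventBound T φ := by
  have hφ0 : φ ∈ Set.Ioo 0 (Real.pi / 2) := ⟨hω.1.trans hφ.1, hφ.2⟩
  have hquad : ∀ z ∈ outerSector φ,
      QuadInv T z.re (‖z‖ ^ 2) (quadRes T z) (mulQuadRes T z) := fun z hz =>
    hT.quadInv hJ hω (notMem_closedBisector_of_mem_outerSector hω.1 hφ.1 hφ.2 hz)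
  refine ⟨hquad, ?_⟩
  obtain ⟨C, hC, hb⟩ := hT.resolvent_bound φ hφ
  have hsin : 0 < Real.sin φ := Real.sin_pos_of_pos_of_lt_pi hφ0.1 (by linarith [hφ.2, Real.pi_pos])
  obtain ⟨m, hm⟩ : ∃ m, m = ‖(lmul J : CliffMod n X →L[ℝ] CliffMod n X)‖ := ⟨_, rfl⟩
  have hm0 : 0 ≤ m := hm ▸ norm_nonneg _
  obtain ⟨D, hD⟩ : ∃ D, D = C * m / Real.sin φ := ⟨_, rfl⟩
  have hD0 : 0 ≤ D := by rw [hD]; positivity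
  refine ⟨D * (1 + m) + C + D, by positivity, fun z hz => ?_⟩
  have hpos := norm_pos_of_mem_outerSector hz
  have hz0 := norm_pos_iff.1 hpos
  have b1 := hb _ (planeEmb_mem_compl hJ hφ0 hz0 hz.2)
  have b2 := hb _ (planeEmb_mem_compl hJ hφ0 (z := (starRingEnd ℂ) z)
    (by simpa using hz0) (by rw [conj_re, norm_conj]; exact hz.2))
  rw [norm_planeEmb] at b1 b2
  rw [norm_conj] at b2
  have k1 := norm_quadRes_le hJ hφ0 hz (hquad z hz) b1 b2
  rw [← hm, ← hD] at k1
  have hle : ∀ a b c : ℝ, 0 ≤ c → a ≤ b → a / c ≤ b / c := fun a b c hc h =>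
    div_le_div_of_nonneg_right h hc
  constructor
  · refine k1.trans (hle _ _ _ (by positivity) ?_)
    nlinarith
  -- Once `Q_s[T]⁻¹` is estimated, the definition of `S_L⁻¹` can be solved for `T Q_s[T]⁻¹`.
  · have h1 : mulQuadRes T z = (quadRes T z).comp (lmul (planeEmb hJ ((starRingEnd ℂ) z))) -
        SLres T (planeEmb hJ z) := by
      rw [(hquad z hz).SLres_planeEmb hJ, sub_sub_cancel]
    have h2 := norm_lmul_planeEmb_le (X := X) hJ ((starRingEnd ℂ) z)
    rw [norm_conj, ← hm] at h2
    have h3 := (ContinuousLinearMap.opNorm_comp_le (quadRes T z)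
      (lmul (planeEmb hJ ((starRingEnd ℂ) z)))).trans
        (mul_le_mul k1 h2 (norm_nonneg _) (by positivity))
    have h4 : D / ‖z‖ ^ 2 * (‖z‖ * (1 + m)) + C / ‖z‖ = (D * (1 + m) + C) / ‖z‖ := by field_simp
    rw [h1]
    refine (norm_sub_le _ _).trans ((add_le_add h3 b1).trans ?_)
    rw [h4]
    exact hle _ _ _ hpos.le (by linarith)

end Bisectorial

/-! ### The `ω`-functional calculus of rational functions -/

section OmegaCalculus

open Complex Filter Topology

theorem integrable_and_integral_of_Ioi {F : Type*} [NormedAddCommGroup F] [NormedSpace ℝ F]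
    {f : ℝ → F} (h1 : IntegrableOn f (Set.Ioi 0))
        (h2 : IntegrableOn (fun t => f (-t)) (Set.Ioi 0)) :
    Integrable f ∧ ∫ t, f t = ∫ t in Set.Ioi (0 : ℝ), (f t + f (-t)) := by
  have h3 : IntegrableOn f (Set.Iic 0) := by
    rw [← Measure.map_neg_eq_self (volume : Measure ℝ)]
    have m : MeasurableEmbedding fun x : ℝ => -x := (Homeomorph.neg ℝ).measurableEmbedding
    rw [m.integrableOn_map_iff]
    simp only [Set.neg_preimage, Set.neg_Iic, neg_zero]
    exact Iff.mpr integrableOn_Ici_iff_integrableOn_Ioi h2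
  constructor
  · rw [← integrableOn_univ, ← Set.Iic_union_Ioi (a := (0 : ℝ))]
    exact h3.union h1
  · rw [integral_add h1 h2, integral_comp_neg_Ioi, neg_zero, add_comm,
      intervalIntegral.integral_Iic_add_Ioi h3 h1]

variable {n : ℕ} {X : Type*} [NormedAddCommGroup X] [NormedSpace ℝ X]
  {T : CliffMod n X →ₗ.[ℝ] CliffMod n X} {ω φ : ℝ} {J : Cl n} (hJ : J ∈ Sph n)

/-- The operator `S_L⁻¹(u, T) κ` for `u` and `κ` in `ℂ_J`. -/
noncomputable def planeOp (T : CliffMod n X →ₗ.[ℝ] CliffMod n X) (κ u : ℂ) :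
    CliffMod n X →L[ℝ] CliffMod n X :=
  (SLres T (planeEmb hJ u)).comp (lmul (planeEmb hJ κ))

theorem lmul_planeEmb_comp (a b : ℂ) :
    (lmul (planeEmb hJ a) : CliffMod n X →L[ℝ] CliffMod n X).comp (lmul (planeEmb hJ b)) =
      lmul (planeEmb hJ (a * b)) := by
  ext1 v
  rw [ContinuousLinearMap.comp_apply, lmul_lmul, ← mul_def, map_mul]

/-- In the sum of the two conjugate contributions the left multiplications by `J` cancel, leaving
real multiples of `Q_u[T]⁻¹` and `T Q_u[T]⁻¹`. Thus `T` need not commute with `J`, and complex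
analysis applies. -/
theorem planeOp_add_conj {u : ℂ} (h : QuadInv T u.re (‖u‖ ^ 2) (quadRes T u) (mulQuadRes T u))
    (κ : ℂ) (l : CliffMod n X →L[ℝ] ℝ) (v : CliffMod n X) :
    l ((planeOp hJ T κ u + planeOp hJ T ((starRingEnd ℂ) κ) ((starRingEnd ℂ) u)) v) =
      2 * (κ * resFun T l u v).re := by
  have h1 : planeOp hJ T κ u + planeOp hJ T ((starRingEnd ℂ) κ) ((starRingEnd ℂ) u) =
      (2 * ((starRingEnd ℂ) u * κ).re) • quadRes T u - (2 * κ.re) • mulQuadRes T u := by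
    rw [planeOp, planeOp, h.SLres_planeEmb, h.SLres_planeEmb_conj, ContinuousLinearMap.sub_comp,
      ContinuousLinearMap.sub_comp, ContinuousLinearMap.comp_assoc, ContinuousLinearMap.comp_assoc,
      lmul_planeEmb_comp, lmul_planeEmb_comp]
    have e : u * (starRingEnd ℂ) κ = (starRingEnd ℂ) ((starRingEnd ℂ) u * κ) := by simp
    rw [e]
    ext1 v
    simp only [lmul_planeEmb, add_apply, sub_apply, smul_apply, ContinuousLinearMap.comp_apply,
      ContinuousLinearMap.id_apply, map_add, map_smul, conj_re, conj_im]
    module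
  rw [h1]
  simp only [sub_apply, smul_apply, map_sub, map_smul, smul_eq_mul, resFun_apply]
  simp only [mul_re, sub_re, sub_im, mul_im, ofReal_re, ofReal_im, conj_re, conj_im]
  ring

theorem planeOp_continuousOn {φ' : ℝ} (hRB : ResolventBound T φ') {u κ : ℝ → ℂ}
    (hu : ContinuousOn u (Set.Ioi 0)) (hκ : ContinuousOn κ (Set.Ioi 0))
    (hmem : ∀ r, 0 < r → outerSector φ' ∈ 𝓝 (u r)) :
    ContinuousOn (fun r => planeOp hJ T (κ r) (u r)) (Set.Ioi 0) ∧
      ContinuousOn (fun r => planeOp hJ T ((starRingEnd ℂ) (κ r)) ((starRingEnd ℂ) (u r)))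
        (Set.Ioi 0) := by
  have hq : ∀ r, 0 < r → QuadInv T (u r).re (‖u r‖ ^ 2) (quadRes T (u r)) (mulQuadRes T (u r)) :=
    fun r hr => hRB.quad _ (mem_of_mem_nhds (hmem r hr))
  have hR : ContinuousOn (fun r => quadRes T (u r)) (Set.Ioi 0) := fun r hr =>
    (hRB.continuousAt (hmem r hr)).1.comp_continuousWithinAt (hu r hr)
  have hS : ContinuousOn (fun r => mulQuadRes T (u r)) (Set.Ioi 0) := fun r hr =>
    (hRB.continuousAt (hmem r hr)).2.comp_continuousWithinAt (hu r hr)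
  have hl : ∀ z : ℝ → ℂ, ContinuousOn z (Set.Ioi 0) → ContinuousOn
      (fun r => (lmul (planeEmb hJ (z r)) : CliffMod n X →L[ℝ] CliffMod n X)) (Set.Ioi 0) :=
    fun z hz => (continuous_lmul_planeEmb hJ).comp_continuousOn hz
  have hconj : ∀ z : ℝ → ℂ, ContinuousOn z (Set.Ioi 0) →
      ContinuousOn (fun r => (starRingEnd ℂ) (z r)) (Set.Ioi 0) :=
    fun z hz => continuous_conj.comp_continuousOn hz
  constructor
  · refine ContinuousOn.congr (((hR.clm_comp (hl _ (hconj u hu))).sub hS).clm_comp (hl κ hκ))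
      fun r hr => ?_
    rw [planeOp, (hq r hr).SLres_planeEmb]
    rfl
  · refine ContinuousOn.congr (((hR.clm_comp (hl _ hu)).sub hS).clm_comp (hl _ (hconj κ hκ)))
      fun r hr => ?_
    rw [planeOp, (hq r hr).SLres_planeEmb_conj]
    rfl

theorem norm_planeOp_le {C : ℝ} (hφ : φ ∈ Set.Ioo 0 (Real.pi / 2))
    (hb : ∀ s ∈ Para n \ (dblSector n φ ∪ {0}), ‖SLres T s‖ ≤ C / ‖s‖) {u κ : ℂ} (hu0 : u ≠ 0)
    (hu : |u.re| ≤ Real.cos φ * ‖u‖) :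
    ‖planeOp hJ T κ u‖ ≤ C / ‖u‖ * (‖κ‖ * (1 + ‖(lmul J : CliffMod n X →L[ℝ] CliffMod n X)‖)) := by
  have h1 := hb _ (planeEmb_mem_compl hJ hφ hu0 hu)
  rw [norm_planeEmb] at h1
  refine (ContinuousLinearMap.opNorm_comp_le _ _).trans ?_
  exact mul_le_mul h1 (norm_lmul_planeEmb_le hJ κ) (norm_nonneg _) ((norm_nonneg _).trans h1)

theorem planeOp_integrableOn {φ' C D : ℝ} (hφ : φ ∈ Set.Ioo 0 (Real.pi / 2))
    (hRB : ResolventBound T φ')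
    (hb : ∀ s ∈ Para n \ (dblSector n φ ∪ {0}), ‖SLres T s‖ ≤ C / ‖s‖) {u κ : ℝ → ℂ}
    (hu : ContinuousOn u (Set.Ioi 0)) (hκ : ContinuousOn κ (Set.Ioi 0))
    (hmem : ∀ r, 0 < r → outerSector φ' ∈ 𝓝 (u r)) (hmem' : ∀ r, 0 < r → u r ∈ outerSector φ)
    (hnorm : ∀ r, 0 < r → ‖u r‖ = r) (hbound : ∀ r, 0 < r → ‖κ r‖ ≤ D * r / (1 + r ^ 2))
        (hC : 0 ≤ C) :
    IntegrableOn (fun r => planeOp hJ T (κ r) (u r)) (Set.Ioi 0) ∧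
      IntegrableOn (fun r => planeOp hJ T ((starRingEnd ℂ) (κ r)) ((starRingEnd ℂ) (u r)))
        (Set.Ioi 0) := by
  obtain ⟨c1, c2⟩ := planeOp_continuousOn hJ hRB hu hκ hmem
  obtain ⟨m, hm⟩ : ∃ m, m = 1 + ‖(lmul J : CliffMod n X →L[ℝ] CliffMod n X)‖ := ⟨_, rfl⟩
  have hm0 : 0 ≤ m := by rw [hm]; positivity
  have key : ∀ r, 0 < r → C / r * (‖κ r‖ * m) ≤ C * D * m / (1 + r ^ 2) := fun r hr => by
    calc C / r * (‖κ r‖ * m) ≤ C / r * (D * r / (1 + r ^ 2) * m) := by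
          have := hbound r hr
          gcongr
      _ = _ := by field_simp
  refine ⟨integrableOn_of_le_inv_one_add_sq (C := C * D * m) c1 fun r hr => ?_,
    integrableOn_of_le_inv_one_add_sq (C := C * D * m) c2 fun r hr => ?_⟩
  · have h0 := hmem' r hr
    have := norm_planeOp_le hJ (κ := κ r) hφ hb
        (norm_pos_iff.1 (norm_pos_of_mem_outerSector h0)) h0.2
    rw [hnorm r hr, ← hm] at this
    exact this.trans (key r hr)
  · have h0 := hmem' r hr
    have := norm_planeOp_le hJ (κ := (starRingEnd ℂ) (κ r)) (u := (starRingEnd ℂ) (u r)) hφ hb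
      (by simpa using norm_pos_iff.1 (norm_pos_of_mem_outerSector h0))
      (by rw [conj_re, norm_conj]; exact h0.2)
    rw [norm_conj, norm_conj, hnorm r hr, ← hm] at this
    exact this.trans (key r hr)

/-! The integrand on the two branches of the contour. -/

theorem contour_of_pos {ε t : ℝ} (ht : 0 < t) :
    contour J φ ε t = t • planeEmb hJ (ε * exp ((-φ : ℝ) * I)) := by
  rw [contour, Real.sign_of_pos ht, abs_of_pos ht, one_mul, pol_eq_planeEmb hJ, ← map_smul,
    ← map_smul, real_smul, real_smul]
  congr 1; ring

theorem contour_of_neg {ε t : ℝ} (ht : t < 0) :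
    contour J φ ε t = t • planeEmb hJ (-(ε * exp (φ * I))) := by
  rw [contour, Real.sign_of_neg ht, abs_of_neg ht, pol_eq_planeEmb hJ, ← map_smul,
    ← map_smul, real_smul, real_smul, neg_one_mul, neg_neg]
  push_cast
  congr 1; ring

theorem deriv_contour_of_pos {ε t : ℝ} (ht : 0 < t) :
    deriv (contour J φ ε) t = planeEmb hJ (ε * exp ((-φ : ℝ) * I)) := by
  have h : contour J φ ε =ᶠ[𝓝 t] fun t => t • planeEmb hJ (ε * exp ((-φ : ℝ) * I)) := by
    filter_upwards [lt_mem_nhds ht] with x hx using contour_of_pos hJ hx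
  rw [h.deriv_eq, ((hasDerivAt_id' t).smul_const _).deriv, one_smul]

theorem deriv_contour_of_neg {ε t : ℝ} (ht : t < 0) :
    deriv (contour J φ ε) t = planeEmb hJ (-(ε * exp (φ * I))) := by
  have h : contour J φ ε =ᶠ[𝓝 t] fun t => t • planeEmb hJ (-(ε * exp (φ * I))) := by
    filter_upwards [gt_mem_nhds ht] with x hx using contour_of_neg hJ hx
  rw [h.deriv_eq, ((hasDerivAt_id' t).smul_const _).deriv, one_smul]

theorem omegaIntegrand_eq {g : Cl n → Cl n} {ε t : ℝ} {c s γ : ℂ}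
    (hs : contour J φ ε t = planeEmb hJ s) (hd : deriv (contour J φ ε) t = planeEmb hJ c)
    (hg : g (planeEmb hJ s) = planeEmb hJ γ) :
    omegaIntegrand T J φ g ε t = planeOp hJ T (c * -I * γ) s := by
  have h1 : Ring.inverse J = planeEmb hJ (-I) := by
    rw [← inv_I, ← inverse_planeEmb, planeEmb_I]
  rw [omegaIntegrand, hs, hd, hg, h1, ← map_mul, ← map_mul, planeOp]

theorem exp_pi_sub (φ : ℝ) : exp ((Real.pi - φ : ℝ) * I) = -exp ((-φ : ℝ) * I) := by
  push_cast
  rw [sub_mul, exp_sub, exp_pi_mul_I, neg_mul, exp_neg, neg_div, one_div]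

theorem conj_exp_ray (φ : ℝ) : (starRingEnd ℂ) (exp (φ * I)) = exp ((-φ : ℝ) * I) := by
  rw [← exp_conj, map_mul, conj_I, conj_ofReal]
  congr 1
  push_cast
  ring

variable {G : ℂ → ℂ} {g : Cl n → Cl n}

/-- Each branch meets one ray of the upper half plane and its conjugate: for `ε = 1` the argument
`φ` is met at negative parameters, for `ε = -1` the argument `π - φ` at positive ones. Hence the
derivative has opposite signs relative to the outward direction, and division by `J` gives the
factors `I` and `-I`. -/
theorem omegaIntegrand_one_neg
    (hg : ∀ z ∈ closedBisector φ, z ≠ 0 → g (planeEmb hJ z) = planeEmb hJ (G z))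
    {t : ℝ} (ht : 0 < t) (hmem : (t : ℂ) * exp (φ * I) ∈ closedBisector φ) :
    omegaIntegrand T J φ g 1 (-t) =
      planeOp hJ T (I * (G (t * exp (φ * I)) * exp (φ * I))) (t * exp (φ * I)) := by
  have hne : (t : ℂ) * exp (φ * I) ≠ 0 := mul_ne_zero (by exact_mod_cast ht.ne') (exp_ne_zero _)
  rw [omegaIntegrand_eq hJ (s := t * exp (φ * I)) (c := -exp (φ * I)) (γ := G (t * exp (φ * I)))]
  · congr 1; ring
  · rw [contour_of_neg hJ (by linarith), ← map_smul, real_smul]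
    push_cast; congr 1; ring
  · rw [deriv_contour_of_neg hJ (by linarith)]
    push_cast; congr 1; ring
  · exact hg _ hmem hne

theorem omegaIntegrand_one_pos
    (hg : ∀ z ∈ closedBisector φ, z ≠ 0 → g (planeEmb hJ z) = planeEmb hJ (G z))
    (hG : ∀ z, G ((starRingEnd ℂ) z) = (starRingEnd ℂ) (G z))
    {t : ℝ} (ht : 0 < t) (hmem : (t : ℂ) * exp (φ * I) ∈ closedBisector φ) :
    omegaIntegrand T J φ g 1 t =
      planeOp hJ T ((starRingEnd ℂ) (I * (G (t * exp (φ * I)) * exp (φ * I))))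
        ((starRingEnd ℂ) (t * exp (φ * I))) := by
  have hne : (t : ℂ) * exp (φ * I) ≠ 0 := mul_ne_zero (by exact_mod_cast ht.ne') (exp_ne_zero _)
  have hmem' : (starRingEnd ℂ) ((t : ℂ) * exp (φ * I)) ∈ closedBisector φ := by
    rw [closedBisector, Set.mem_ofPred_eq, norm_conj, conj_re]; exact hmem
  rw [omegaIntegrand_eq hJ (s := (starRingEnd ℂ) (t * exp (φ * I))) (c := exp ((-φ : ℝ) * I))
    (γ := (starRingEnd ℂ) (G (t * exp (φ * I))))]
  · simp only [map_mul, conj_exp_ray, conj_I]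
    congr 1; ring
  · have hs : (starRingEnd ℂ) (t * exp (φ * I)) = t * exp ((-φ : ℝ) * I) := by
      rw [map_mul, conj_exp_ray, conj_ofReal]
    rw [contour_of_pos hJ ht, ← map_smul, real_smul, hs]
    push_cast; congr 1; ring
  · rw [deriv_contour_of_pos hJ ht]
    push_cast; congr 1; ring
  · rw [← hG]
    exact hg _ hmem' (by simpa using hne)

theorem omegaIntegrand_neg_one_pos
    (hg : ∀ z ∈ closedBisector φ, z ≠ 0 → g (planeEmb hJ z) = planeEmb hJ (G z))
    {t : ℝ} (ht : 0 < t) (hmem : (t : ℂ) * exp ((Real.pi - φ : ℝ) * I) ∈ closedBisector φ) :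
    omegaIntegrand T J φ g (-1) t =
      planeOp hJ T (-I * (G (t * exp ((Real.pi - φ : ℝ) * I)) * exp ((Real.pi - φ : ℝ) * I)))
        (t * exp ((Real.pi - φ : ℝ) * I)) := by
  have hne : (t : ℂ) * exp ((Real.pi - φ : ℝ) * I) ≠ 0 :=
    mul_ne_zero (by exact_mod_cast ht.ne') (exp_ne_zero _)
  rw [omegaIntegrand_eq hJ (s := t * exp ((Real.pi - φ : ℝ) * I))
    (c := exp ((Real.pi - φ : ℝ) * I)) (γ := G (t * exp ((Real.pi - φ : ℝ) * I)))]
  · congr 1; ring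
  · rw [contour_of_pos hJ ht, ← map_smul, real_smul, exp_pi_sub]
    push_cast; congr 1; ring
  · rw [deriv_contour_of_pos hJ ht, exp_pi_sub]
    push_cast; congr 1; ring
  · exact hg _ hmem hne

theorem omegaIntegrand_neg_one_neg
    (hg : ∀ z ∈ closedBisector φ, z ≠ 0 → g (planeEmb hJ z) = planeEmb hJ (G z))
    (hG : ∀ z, G ((starRingEnd ℂ) z) = (starRingEnd ℂ) (G z))
    {t : ℝ} (ht : 0 < t) (hmem : (t : ℂ) * exp ((Real.pi - φ : ℝ) * I) ∈ closedBisector φ) :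
    omegaIntegrand T J φ g (-1) (-t) = planeOp hJ T
      ((starRingEnd ℂ)
        (-I * (G (t * exp ((Real.pi - φ : ℝ) * I)) * exp ((Real.pi - φ : ℝ) * I))))
      ((starRingEnd ℂ) (t * exp ((Real.pi - φ : ℝ) * I))) := by
  have hne : (t : ℂ) * exp ((Real.pi - φ : ℝ) * I) ≠ 0 :=
    mul_ne_zero (by exact_mod_cast ht.ne') (exp_ne_zero _)
  have hmem' : (starRingEnd ℂ) ((t : ℂ) * exp ((Real.pi - φ : ℝ) * I)) ∈ closedBisector φ := by
    rw [closedBisector, Set.mem_ofPred_eq, norm_conj, conj_re]; exact hmem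
  have hexp : (starRingEnd ℂ) (exp ((Real.pi - φ : ℝ) * I)) = -exp (φ * I) := by
    rw [exp_pi_sub, map_neg, conj_exp_ray, neg_neg]
  rw [omegaIntegrand_eq hJ (s := (starRingEnd ℂ) (t * exp ((Real.pi - φ : ℝ) * I)))
    (c := exp (φ * I)) (γ := (starRingEnd ℂ) (G (t * exp ((Real.pi - φ : ℝ) * I))))]
  · rw [map_mul, map_mul, map_mul, map_neg, conj_I, hexp]
    congr 1; ring
  · have hs : (starRingEnd ℂ) (t * exp ((Real.pi - φ : ℝ) * I)) = t * -exp (φ * I) := by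
      rw [map_mul, hexp, conj_ofReal]
    rw [contour_of_neg hJ (by linarith), ← map_smul, real_smul, hs]
    push_cast; congr 1; ring
  · rw [deriv_contour_of_neg hJ (by linarith)]
    push_cast; congr 1; ring
  · rw [← hG]
    exact hg _ hmem' (by simpa using hne)

end OmegaCalculus

/-! ### From the operator-valued contour integral to the scalar one. -/

section OmegaCalculusValue

open Complex Filter Topology

variable {n : ℕ} {X : Type*} [NormedAddCommGroup X] [NormedSpace ℝ X]
  {T : CliffMod n X →ₗ.[ℝ] CliffMod n X} {ω φ : ℝ} {J : Cl n}

/-- A function on the line whose values are paired by complex conjugation: its integral is the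
real part of an integral along a ray. -/
theorem integral_conj_pair [CompleteSpace X] (hJ : J ∈ Sph n) {φ' α C D : ℝ} {c : ℂ} (hc : ‖c‖ = 1)
    {G : ℂ → ℂ} (hφ : φ ∈ Set.Ioo 0 (Real.pi / 2)) (h0 : 0 < φ') (hφ' : φ' < φ)
    (hα : α ∈ Set.Icc φ (Real.pi - φ)) (hRB : ResolventBound T φ') (hC : 0 ≤ C) (hD : 0 ≤ D)
    (hb : ∀ s ∈ Para n \ (dblSector n φ ∪ {0}), ‖SLres T s‖ ≤ C / ‖s‖)
    (hGd : ∀ r : ℝ, 0 < r → ContinuousAt G (r * exp (α * I)))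
    (hGb : ∀ r : ℝ, 0 < r → ‖G (r * exp (α * I))‖ ≤ D * r / (1 + r ^ 2))
    {f : ℝ → CliffMod n X →L[ℝ] CliffMod n X}
    (hf : ∀ r : ℝ, 0 < r → f r = planeOp hJ T (c * (G (r * exp (α * I)) * exp (α * I)))
      (r * exp (α * I)))
    (hf' : ∀ r : ℝ, 0 < r → f (-r) = planeOp hJ T
      ((starRingEnd ℂ) (c * (G (r * exp (α * I)) * exp (α * I))))
      ((starRingEnd ℂ) (r * exp (α * I)))) :
    Integrable f ∧ ∀ (l : CliffMod n X →L[ℝ] ℝ) (v : CliffMod n X),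
      l ((∫ t, f t) v) = 2 * (c * rayIntegral (fun s => G s * resFun T l s v) α).re := by
  set u : ℝ → ℂ := fun r => r * exp (α * I) with hu
  set κ : ℝ → ℂ := fun r => c * (G (u r) * exp (α * I)) with hκ
  have hmem' : ∀ r, 0 < r → u r ∈ outerSector φ := fun r hr => ray_mem_outerSector hr hφ.1 hα
  have hmem : ∀ r, 0 < r → outerSector φ' ∈ 𝓝 (u r) := fun r hr =>
    outerSector_mem_nhds h0 hφ' hφ.2 (hmem' r hr)
  have hnorm : ∀ r, 0 < r → ‖u r‖ = r := fun r hr => norm_ray r α hr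
  have huc : ContinuousOn u (Set.Ioi 0) := by fun_prop
  have hκc : ContinuousOn κ (Set.Ioi 0) := fun r hr =>
    continuousWithinAt_const.mul ((ContinuousAt.comp_continuousWithinAt (f := u) (hGd r hr)
      (huc r hr)).mul continuousWithinAt_const)
  have hκb : ∀ r, 0 < r → ‖κ r‖ ≤ D * r / (1 + r ^ 2) := fun r hr => by
    rw [hκ, norm_mul, hc, norm_mul, norm_exp_ofReal_mul_I, one_mul, mul_one]
    exact hGb r hr
  obtain ⟨i1, i2⟩ := planeOp_integrableOn hJ hφ hRB hb huc hκc hmem hmem' hnorm hκb hC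
  have j1 : IntegrableOn f (Set.Ioi 0) := i1.congr_fun
      (fun r hr => (hf r hr).symm) measurableSet_Ioi
  have j2 : IntegrableOn (fun t => f (-t)) (Set.Ioi 0) :=
    i2.congr_fun (fun r hr => (hf' r hr).symm) measurableSet_Ioi
  obtain ⟨k1, k2⟩ := integrable_and_integral_of_Ioi j1 j2
  refine ⟨k1, fun l v => ?_⟩
  have h1 : l ((∫ t, f t) v) = ∫ r in Set.Ioi (0 : ℝ), 2 * (κ r * resFun T l (u r) v).re := by
    rw [k2]
    have := (l.comp (ContinuousLinearMap.apply ℝ (CliffMod n X) v)).integral_comp_comm (j1.add j2)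
    refine Eq.trans this.symm (setIntegral_congr_fun measurableSet_Ioi fun r hr => ?_)
    change l ((f r + f (-r)) v) = _
    rw [hf r hr, hf' r hr]
    exact planeOp_add_conj hJ (hRB.quad _ (mem_of_mem_nhds (hmem r hr))) _ l v
  have h2 : IntegrableOn (fun r => κ r * resFun T l (u r) v) (Set.Ioi 0) := by
    obtain ⟨C', hC', hb'⟩ := hRB.bound_resFun l v
    refine integrableOn_of_le_inv_one_add_sq (C := D * C') (fun r hr => ?_) fun r hr => ?_
    · exact (hκc r hr).mul ((hRB.differentiableAt_resFun l (hmem r hr) v).continuousAt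
        |>.comp_continuousWithinAt (huc r hr))
    · have h3 := hb' _ (mem_of_mem_nhds (hmem r hr))
      rw [hnorm r hr] at h3
      rw [norm_mul]
      calc ‖κ r‖ * ‖resFun T l (u r) v‖ ≤ D * r / (1 + r ^ 2) * (C' / r) :=
            mul_le_mul (hκb r hr) h3 (norm_nonneg _) (by positivity)
        _ = _ := by field_simp
  rw [h1, integral_const_mul]
  have h3 : ∫ r in Set.Ioi (0 : ℝ), (κ r * resFun T l (u r) v).re =
      (∫ r in Set.Ioi (0 : ℝ), κ r * resFun T l (u r) v).re := integral_re h2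
  rw [h3, rayIntegral, ← integral_const_mul]
  congr 3
  funext r
  simp only [hκ, hu]
  ring

/-- The `ω`-functional calculus of a real rational function that vanishes at `0` and, of second
order, at `∞` agrees with the rational functional calculus. -/
theorem omegaCalc_evalSeq [CompleteSpace X] (hJ : J ∈ Sph n) (hT : IsBisectorial T ω)
    (hω : ω ∈ Set.Ioo 0 (Real.pi / 2)) (hφ : φ ∈ Set.Ioo ω (Real.pi / 2)) {R Q : ℝ[X]}
    (hQ : ∀ z ∈ closedBisector φ, Polynomial.aeval z Q ≠ 0) (hQ0 : Q ≠ 0)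
    (hd : R.natDegree + 2 ≤ Q.natDegree) {g : Cl n → Cl n}
    (hg : ∀ z ∈ closedBisector φ, z ≠ 0 → g (planeEmb hJ z) = planeEmb hJ
      (Polynomial.aeval z (Polynomial.X * R) / Polynomial.aeval z Q)) :
    Integrable (omegaIntegrand T J φ g 1) ∧ Integrable (omegaIntegrand T J φ g (-1)) ∧
      ∀ w, IsOrbit T Q.natDegree w →
        omegaCalc T J φ g (evalSeq w Q) = evalSeq w (Polynomial.X * R) := by
  have hφ0 : φ ∈ Set.Ioo 0 (Real.pi / 2) := ⟨hω.1.trans hφ.1, hφ.2⟩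
  have hpi := Real.pi_pos
  -- The contour at angle `φ` needs resolvent estimates in a neighbourhood, which an intermediate
  -- angle supplies.
  obtain ⟨φ', hφ1, hφ2⟩ := exists_between hφ.1
  have hφ'0 : 0 < φ' := hω.1.trans hφ1
  have hRB := hT.resolventBound hJ hω ⟨hφ1, hφ2.trans hφ.2⟩
  obtain ⟨C, hC, hb⟩ := hT.resolvent_bound φ hφ
  obtain ⟨D, hD, hDb⟩ := exists_norm_div_le (isClosed_closedBisector φ) R Q hQ hQ0
    (d := Q.natDegree - 2) (e := 2) (by omega) (by omega)
  set G : ℂ → ℂ := fun z =>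
    Polynomial.aeval z (Polynomial.X * R) / Polynomial.aeval z Q with hGdef
  have hG : ∀ z, G ((starRingEnd ℂ) z) = (starRingEnd ℂ) (G z) := fun z => by
    simp only [hGdef, map_div₀]
    rw [← Polynomial.aeval_conj, ← Polynomial.aeval_conj]
  have hGb : ∀ z ∈ closedBisector φ, ∀ r : ℝ, 0 < r → ‖z‖ = r → ‖G z‖ ≤ D * r / (1 + r ^ 2) := by
    intro z hz r hr hzr
    have h1 := hDb z hz
    rw [hzr] at h1
    simp only [hGdef]
    rw [map_mul, Polynomial.aeval_X, mul_div_assoc, norm_mul, hzr]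
    calc r * _ ≤ r * (D / (1 + r) ^ 2) := by gcongr
      _ ≤ r * (D / (1 + r ^ 2)) := by gcongr; nlinarith
      _ = _ := by ring
  have hGc : ∀ z ∈ closedBisector φ, ContinuousAt G z := fun z hz =>
    (differentiableAt_aeval_div (hQ z hz)).continuousAt
  have hm1 : ∀ r : ℝ, 0 < r → (r : ℂ) * exp (φ * I) ∈ closedBisector φ := fun r hr =>
    ray_mem_closedBisector_right hr ⟨hφ0.1.le, le_rfl⟩ (by linarith [hφ.2])
  have hm2 : ∀ r : ℝ, 0 < r → (r : ℂ) * exp ((Real.pi - φ : ℝ) * I) ∈ closedBisector φ :=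
    fun r hr => ray_mem_closedBisector_left hr ⟨le_rfl, by linarith [hφ0.1]⟩ (by linarith [hφ.2])
  -- The branch `ε = 1` is reflected, so that its upper ray is run through at positive parameters.
  obtain ⟨i1, e1⟩ := integral_conj_pair hJ (c := I) (by simp) hφ0 hφ'0 hφ2
    (α := φ) ⟨le_rfl, by linarith [hφ.2]⟩ hRB hC hD hb (fun r hr => hGc _ (hm1 r hr))
    (fun r hr => hGb _ (hm1 r hr) r hr (norm_ray r _ hr))
    (f := fun t => omegaIntegrand T J φ g 1 (-t))
    (fun r hr => omegaIntegrand_one_neg hJ hg hr (hm1 r hr))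
    (fun r hr => by
      rw [neg_neg]; exact omegaIntegrand_one_pos hJ hg hG hr (hm1 r hr))
  obtain ⟨i2, e2⟩ := integral_conj_pair hJ (c := -I) (by simp) hφ0 hφ'0 hφ2
    (α := Real.pi - φ) ⟨by linarith [hφ.2], le_rfl⟩ hRB hC hD hb (fun r hr => hGc _ (hm2 r hr))
    (fun r hr => hGb _ (hm2 r hr) r hr (norm_ray r _ hr))
    (f := omegaIntegrand T J φ g (-1))
    (fun r hr => omegaIntegrand_neg_one_pos hJ hg hr (hm2 r hr))
    (fun r hr => omegaIntegrand_neg_one_neg hJ hg hG hr (hm2 r hr))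
  refine ⟨by simpa using i1.comp_neg, i2, fun w hw => ?_⟩
  rw [SeparatingDual.eq_iff_forall_dual_eq (R := ℝ)]
  intro l
  -- The branches contribute `2 Re (I A) = -2 Im A` and `2 Re (-I B) = 2 Im B`, with `A` and `B` the
  -- ray integrals at `φ` and `π - φ`. The scalar result turns their sum into `2π ℓ ((X R)[T] u)`,
  -- which cancels the prefactor.
  have key := (hRB.isResolventSeq hφ'0 hφ2 hφ.2 l hw).rayIntegral_eq (R := R) hφ0 rfl
    (by omega) hQ hQ0
  have hl := map_evalSeq (l : CliffMod n X →ₗ[ℝ] ℝ) w (Polynomial.X * R)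
  simp only [← map_evalSeq (resFun T l _) w Q] at key
  rw [show evalSeq (fun k => l (w k)) (Polynomial.X * R) = l (evalSeq w (Polynomial.X * R))
    from hl.symm] at key
  have e1' := e1 l (evalSeq w Q)
  have e2' := e2 l (evalSeq w Q)
  rw [integral_neg_eq_self (fun t => omegaIntegrand T J φ g 1 t) volume] at e1'
  rw [omegaCalc, smul_apply, add_apply, map_smul, map_add, e1', e2', smul_eq_mul]
  rw [sub_im] at key
  simp only [neg_mul, neg_re, I_mul_re]
  have : l (evalSeq w (Polynomial.X * R)) * Real.pi = _ := (mul_comm _ _).trans key.symm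
  field_simp
  linarith

end OmegaCalculusValue

/-! ### Rational functions in `𝒩^bnd` -/

section RationalFunctions

open Complex Filter Topology

/-- There are finitely many zeros, and each stays outside the closed sector for slightly larger
angles by continuity of the cosine. -/
theorem exists_angle_forall_aeval_ne_zero {ω : ℝ} (hω : ω ∈ Set.Ioo 0 (Real.pi / 2)) {q : ℝ[X]}
    (hq : ∀ z ∈ closedBisector ω, Polynomial.aeval z q ≠ 0) (hq0 : q ≠ 0) :
    ∃ θ ∈ Set.Ioo ω (Real.pi / 2), ∀ z ∈ closedBisector θ, Polynomial.aeval z q ≠ 0 := by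
  have hfin : {z : ℂ | Polynomial.aeval z q = 0}.Finite := by
    refine (q.rootSet_finite ℂ).subset fun z hz => ?_
    rw [Polynomial.mem_rootSet]
    exact ⟨hq0, hz⟩
  have h1 : ∀ᶠ θ in 𝓝[>] ω, ∀ z ∈ {z : ℂ | Polynomial.aeval z q = 0}, z ∉ closedBisector θ := by
    rw [eventually_all_finite hfin]
    intro z hz
    have h2 : |z.re| < Real.cos ω * ‖z‖ := not_le.1 fun h => hq z h hz
    have h3 : Tendsto (fun θ => Real.cos θ * ‖z‖) (𝓝[>] ω) (𝓝 (Real.cos ω * ‖z‖)) :=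
      ((Real.continuous_cos.mul continuous_const).tendsto ω).mono_left nhdsWithin_le_nhds
    filter_upwards [h3.eventually_const_lt h2] with θ hθ using not_le.2 hθ
  obtain ⟨θ, h2, h3⟩ := (h1.and (Ioo_mem_nhdsGT hω.2)).exists
  exact ⟨θ, h3, fun z hz h0 => h2 z h0 hz⟩

theorem one_add_X_sq_eq_quadPoly : (1 + Polynomial.X ^ 2 : ℝ[X]) = quadPoly 0 1 := by
  simp [quadPoly, add_comm]

/-- The constants are the values of `p / q` at `0` and at `∞`: the first makes the remainder
divisible by `X`, the second removes its coefficient of degree `deg q + 2`. -/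
theorem exists_bounded_decomposition {p q : ℝ[X]} (hdeg : p.natDegree ≤ q.natDegree)
    (hq : q.coeff 0 ≠ 0) : ∃ (c₀ c_inf : ℝ) (R : ℝ[X]), R.natDegree ≤ q.natDegree ∧
      p * (1 + Polynomial.X ^ 2) = Polynomial.C c_inf * (q * (1 + Polynomial.X ^ 2)) +
        Polynomial.C (c₀ - c_inf) * q + Polynomial.X * R := by
  have hlead : q.coeff q.natDegree ≠ 0 := by
    have : q ≠ 0 := by rintro rfl; simp at hq
    simpa using this
  set c₀ := p.coeff 0 / q.coeff 0 with hc₀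
  set c := p.coeff q.natDegree / q.coeff q.natDegree with hc
  set P := p * (1 + Polynomial.X ^ 2) - Polynomial.C c * (q * (1 + Polynomial.X ^ 2)) -
    Polynomial.C (c₀ - c) * q with hP
  obtain ⟨R, hR⟩ : Polynomial.X ∣ P := by
    rw [Polynomial.X_dvd_iff]
    simp only [hP, mul_add, mul_one, Polynomial.coeff_sub, Polynomial.coeff_add,
      Polynomial.coeff_C_mul, Polynomial.coeff_mul_X_pow', hc₀]
    field_simp
    norm_num
  refine ⟨c₀, c, R, ?_, by rw [← hR, hP]; ring⟩
  rw [Polynomial.natDegree_le_iff_coeff_eq_zero]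
  intro k hk
  obtain ⟨j, rfl⟩ : ∃ j, k = j + 1 := ⟨k - 1, by omega⟩
  rw [← Polynomial.coeff_X_mul, ← hR]
  have hz : ∀ m, q.natDegree < m → p.coeff m = 0 ∧ q.coeff m = 0 := fun m hm =>
    ⟨Polynomial.coeff_eq_zero_of_natDegree_lt (hdeg.trans_lt hm),
      Polynomial.coeff_eq_zero_of_natDegree_lt hm⟩
  have hj : p.coeff j - c * q.coeff j = 0 := by
    rcases (Nat.lt_succ_iff.1 hk).eq_or_lt with h | h
    · rw [← h, hc]; field_simp; ring
    · rw [(hz j h).1, (hz j h).2]; ring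
  simp only [hP, mul_add, mul_one, Polynomial.coeff_sub, Polynomial.coeff_add,
    Polynomial.coeff_C_mul, Polynomial.coeff_mul_X_pow]
  rw [(hz (j + 1 + 1) (by omega)).1, (hz (j + 1 + 1) (by omega)).2]
  linear_combination hj

variable {n : ℕ} {θ : ℝ}

theorem mem_params_dblSector (hn : 1 ≤ n) (hθ : θ ∈ Set.Ioo 0 (Real.pi / 2)) {z : ℝ × ℝ} :
    z ∈ params (dblSector n θ) ↔
      Real.cos θ * ‖equivRealProdCLM.symm z‖ < |(equivRealProdCLM.symm z).re| := by
  have h : ∀ J (hJ : J ∈ Sph n), z.1 • (1 : Cl n) + z.2 • J =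
      planeEmb hJ (equivRealProdCLM.symm z) := fun J hJ => by
    rw [planeEmb_apply]; simp
  constructor
  · intro hz
    obtain ⟨J, hJ⟩ := exists_sph hn
    have := hz J hJ
    rwa [h J hJ, planeEmb_mem_dblSector hJ hθ] at this
  · intro hz J hJ
    rw [h J hJ, planeEmb_mem_dblSector hJ hθ]
    exact hz

theorem aeval_div_conj (P Q : ℝ[X]) (z : ℂ) :
    Polynomial.aeval ((starRingEnd ℂ) z) P / Polynomial.aeval ((starRingEnd ℂ) z) Q =
      (starRingEnd ℂ) (Polynomial.aeval z P / Polynomial.aeval z Q) := by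
  rw [map_div₀, Polynomial.aeval_conj, Polynomial.aeval_conj]

/-- The components of the intrinsic function `p / q` with values `l(p(x + iy) / q(x + iy))`. -/
theorem hasFDerivAt_comp_aeval_div {P Q : ℝ[X]} (l : ℂ →L[ℝ] Cl n) {z : ℝ × ℝ}
    (hz : Polynomial.aeval (equivRealProdCLM.symm z) Q ≠ 0) :
    HasFDerivAt (fun z : ℝ × ℝ => l (Polynomial.aeval (equivRealProdCLM.symm z) P /
        Polynomial.aeval (equivRealProdCLM.symm z) Q))
      (l.comp ((ContinuousLinearMap.toSpanSingleton ℂ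
        (deriv (fun s : ℂ => Polynomial.aeval s P / Polynomial.aeval s Q)
          (equivRealProdCLM.symm z))).restrictScalars ℝ |>.comp
            (equivRealProdCLM.symm : ℝ × ℝ →L[ℝ] ℂ))) z := by
  have h1 := (differentiableAt_aeval_div (P := P) hz).hasDerivAt.hasFDerivAt.restrictScalars ℝ
  exact l.hasFDerivAt.comp z
    (h1.comp z (equivRealProdCLM.symm : ℝ × ℝ →L[ℝ] ℂ).hasFDerivAt)

theorem contDiffAt_comp_aeval_div {P Q : ℝ[X]} (l : ℂ →L[ℝ] Cl n) {z : ℝ × ℝ}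
    (hz : Polynomial.aeval (equivRealProdCLM.symm z) Q ≠ 0) :
    ContDiffAt ℝ 1 (fun z : ℝ × ℝ => l (Polynomial.aeval (equivRealProdCLM.symm z) P /
        Polynomial.aeval (equivRealProdCLM.symm z) Q)) z := by
  have h1 : ContDiffAt ℂ 1 (fun s : ℂ => Polynomial.aeval s P / Polynomial.aeval s Q)
      (equivRealProdCLM.symm z) :=
    (Polynomial.contDiff_aeval P 1).contDiffAt.div (Polynomial.contDiff_aeval Q 1).contDiffAt hz
  exact l.contDiff.contDiffAt.comp z ((h1.restrict_scalars ℝ).comp z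
    (equivRealProdCLM.symm : ℝ × ℝ →L[ℝ] ℂ).contDiff.contDiffAt)

/-- The components are the real and imaginary parts of the complex function `P / Q`: the
Cauchy–Riemann equations are its complex differentiability, and the parities come from its real
coefficients. -/
theorem ratFun_mem_Intr (hn : 1 ≤ n) (hθ : θ ∈ Set.Ioo 0 (Real.pi / 2)) {P Q : ℝ[X]}
    (hQ : ∀ z ∈ closedBisector θ, Polynomial.aeval z Q ≠ 0) :
    ratFun P Q ∈ Intr (dblSector n θ) := by
  set l₀ : ℂ →L[ℝ] Cl n := reCLM.smulRight (1 : Cl n) with hl₀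
  set l₁ : ℂ →L[ℝ] Cl n := imCLM.smulRight (1 : Cl n) with hl₁
  have hne : ∀ z ∈ params (dblSector n θ),
      Polynomial.aeval (equivRealProdCLM.symm z) Q ≠ 0 := fun z hz =>
    hQ _ ((mem_params_dblSector hn hθ).1 hz).le
  have hconj : ∀ z : ℝ × ℝ, equivRealProdCLM.symm (z.1, -z.2) =
      (starRingEnd ℂ) (equivRealProdCLM.symm z) := fun z => by
    apply Complex.ext <;> simp
  refine ⟨fun z => l₀ (Polynomial.aeval (equivRealProdCLM.symm z) P /
      Polynomial.aeval (equivRealProdCLM.symm z) Q),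
    fun z => l₁ (Polynomial.aeval (equivRealProdCLM.symm z) P /
      Polynomial.aeval (equivRealProdCLM.symm z) Q),
    ⟨fun z hz => (contDiffAt_comp_aeval_div l₀ (hne z hz)).contDiffWithinAt,
      fun z hz => (contDiffAt_comp_aeval_div l₁ (hne z hz)).contDiffWithinAt,
      fun z hz J hJ => ?_, fun z hz => ?_, fun z hz => ?_, fun z hz => ?_, fun z hz => ?_⟩,
    fun z _ => ⟨⟨(Polynomial.aeval (equivRealProdCLM.symm z) P /
        Polynomial.aeval (equivRealProdCLM.symm z) Q).re,
        by rw [Algebra.algebraMap_eq_smul_one]; rfl⟩,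
      ⟨(Polynomial.aeval (equivRealProdCLM.symm z) P /
        Polynomial.aeval (equivRealProdCLM.symm z) Q).im,
        by rw [Algebra.algebraMap_eq_smul_one]; rfl⟩⟩⟩
  · have h : z.1 • (1 : Cl n) + z.2 • J = planeEmb hJ (equivRealProdCLM.symm z) := by
      rw [planeEmb_apply]; simp
    rw [h, ratFun_planeEmb, planeEmb_apply]
    simp [hl₀, hl₁]
  · simp only [hconj, aeval_div_conj, hl₀]
    simp [-map_div₀]
  · simp only [hconj, aeval_div_conj, hl₁]
    simp [-map_div₀]
  · rw [(hasFDerivAt_comp_aeval_div l₀ (hne z hz)).fderiv,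
      (hasFDerivAt_comp_aeval_div l₁ (hne z hz)).fderiv]
    simp [hl₀, hl₁, equivRealProdCLM_symm_apply]
  · rw [(hasFDerivAt_comp_aeval_div l₀ (hne z hz)).fderiv,
      (hasFDerivAt_comp_aeval_div l₁ (hne z hz)).fderiv]
    simp [hl₀, hl₁, equivRealProdCLM_symm_apply]

theorem ratFun_mem_Nzero (hn : 1 ≤ n) (hθ : θ ∈ Set.Ioo 0 (Real.pi / 2)) {R Q : ℝ[X]}
    (hQ : ∀ z ∈ closedBisector θ, Polynomial.aeval z Q ≠ 0) (hQ0 : Q ≠ 0)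
    (hd : R.natDegree + 2 ≤ Q.natDegree) : ratFun (Polynomial.X * R) Q ∈ Nzero n θ := by
  refine ⟨ratFun_mem_Intr hn hθ hQ, ?_⟩
  obtain ⟨D, hD, hDb⟩ := exists_norm_div_le (isClosed_closedBisector θ) R Q hQ hQ0
    (d := Q.natDegree - 2) (e := 2) (by omega) (by omega)
  have hb : ∀ z ∈ closedBisector θ, ‖Polynomial.aeval z (Polynomial.X * R) /
      Polynomial.aeval z Q‖ ≤ ‖z‖ * (D / (1 + ‖z‖) ^ 2) := fun z hz => by
    rw [map_mul, Polynomial.aeval_X, mul_div_assoc, norm_mul]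
    exact mul_le_mul_of_nonneg_left (hDb z hz) (norm_nonneg z)
  constructor
  · refine ⟨D, fun s hs => ?_⟩
    obtain ⟨J, hJ, z, rfl⟩ := exists_planeEmb_of_mem_dblSector hs
    rw [ratFun_planeEmb, norm_planeEmb]
    refine (hb z ((planeEmb_mem_dblSector hJ hθ).1 hs).le).trans ?_
    have := norm_nonneg z
    rw [mul_div_assoc', div_le_iff₀ (by positivity), mul_comm]
    exact mul_le_mul_of_nonneg_left (by nlinarith) hD
  · intro J hJ φ hφ
    have hmem : ∀ t : ℝ, 0 < t → (t : ℂ) * exp (φ * I) ∈ closedBisector θ := fun t ht => by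
      rw [closedBisector, Set.mem_ofPred_eq, norm_ray t φ ht, ray_re, abs_mul, abs_of_pos ht,
        mul_comm]
      exact mul_le_mul_of_nonneg_left (cos_lt_abs_cos_of_mem_angles hθ hφ).le ht.le
    simp only [pol_eq_planeEmb hJ, ratFun_planeEmb, norm_planeEmb]
    refine integrableOn_of_le_inv_one_add_sq (C := D) (fun t ht => ?_) fun t ht => ?_
    · refine ContinuousAt.continuousWithinAt (ContinuousAt.div (ContinuousAt.norm ?_)
        continuousAt_id (Set.mem_Ioi.1 ht).ne')
      have hu : Continuous fun t : ℝ => (t : ℂ) * exp (φ * I) := by fun_prop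
      exact ContinuousAt.comp (f := fun t : ℝ => (t : ℂ) * exp (φ * I))
        (differentiableAt_aeval_div (hQ _ (hmem t ht))).continuousAt hu.continuousAt
    · have h := hb _ (hmem t ht)
      rw [norm_ray t φ ht] at h
      rw [norm_div, norm_norm, Real.norm_of_nonneg ht.le, div_le_iff₀ ht]
      refine h.trans ?_
      rw [mul_comm]
      gcongr
      nlinarith

theorem Intr_subset_SHL (U : Set (Cl n)) : Intr U ⊆ SHL U := fun _ ⟨f₀, f₁, h, _⟩ => ⟨f₀, f₁, h⟩

theorem isBndDecomp_ratFun (hθ : θ ∈ Set.Ioo 0 (Real.pi / 2)) {p q R : ℝ[X]} {c₀ c_inf : ℝ}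
    (hq : ∀ z ∈ closedBisector θ, Polynomial.aeval z q ≠ 0)
    (h : p * (1 + Polynomial.X ^ 2) = Polynomial.C c_inf * (q * (1 + Polynomial.X ^ 2)) +
        Polynomial.C (c₀ - c_inf) * q + Polynomial.X * R) :
    IsBndDecomp θ (ratFun p q) (algebraMap ℝ (Cl n) c₀) (algebraMap ℝ (Cl n) c_inf)
      (ratFun (Polynomial.X * R) (q * (1 + Polynomial.X ^ 2))) := by
  intro s hs
  obtain ⟨J, hJ, z, rfl⟩ := exists_planeEmb_of_mem_dblSector hs
  have hz : z ∈ closedBisector θ := ((planeEmb_mem_dblSector hJ hθ).1 hs).le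
  have h1 := hq z hz
  have h2 := one_add_sq_ne_zero hθ hz
  have e : (1 : Cl n) + planeEmb hJ z ^ 2 = planeEmb hJ (1 + z ^ 2) := by simp
  rw [ratFun_planeEmb, ratFun_planeEmb, e, inverse_planeEmb, ← (planeEmb hJ).commutes c₀,
    ← (planeEmb hJ).commutes c_inf, ← map_sub, ← map_mul, ← map_add, ← map_add]
  congr 1
  have h3 := congrArg (Polynomial.aeval z) h
  simp only [map_mul, map_add, map_one, map_pow, Polynomial.aeval_X, Polynomial.aeval_C,
    map_sub] at h3 ⊢
  field_simp
  linear_combination h3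

/-! Uniqueness of the decomposition. -/

/-- A nonzero limit would make `F` dominate a multiple of `1 / t`, the derivative of `log`, which is
unbounded along the filter. -/
theorem eq_zero_of_integrableOn_of_tendsto {E : Type*} [NormedAddCommGroup E] {F : ℝ → ℝ}
    {h : ℝ → E} {l : Filter ℝ} [l.NeBot] [TendstoIxxClass Set.Icc l l] {c : E}
    (hl : Set.Ioi 0 ∈ l) (hlog : Tendsto (fun t => ‖Real.log t‖) l atTop)
    (hF : IntegrableOn F (Set.Ioi 0)) (hle : ∀ t, 0 < t → ‖h t‖ / t ≤ F t)
    (hc : Tendsto h l (𝓝 c)) : c = 0 := by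
  by_contra hc0
  have hpos : 0 < ‖c‖ := norm_pos_iff.2 hc0
  refine not_integrableOn_of_tendsto_norm_atTop_of_deriv_isBigO_filter (f := Real.log) l hl ?_
    hlog ?_ hF
  · filter_upwards [hl] with t ht using Real.differentiableAt_log (ne_of_gt ht)
  · refine Asymptotics.IsBigO.of_bound (2 / ‖c‖) ?_
    filter_upwards [hl, hc.norm.eventually_const_lt (half_lt_self hpos)] with t ht h1
    have ht' : 0 < t := ht
    have h2 : ‖c‖ / 2 / t ≤ F t := (div_le_div_of_nonneg_right h1.le ht'.le).trans (hle t ht)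
    rw [Real.deriv_log, norm_inv, Real.norm_of_nonneg ht'.le]
    calc t⁻¹ = 2 / ‖c‖ * (‖c‖ / 2 / t) := by field_simp
      _ ≤ 2 / ‖c‖ * ‖F t‖ := by gcongr; exact h2.trans (le_abs_self _)

/-- On the positive half-axis the difference of the two decaying parts is the explicit function `H`.
Its limits at `∞` and at `0` are the differences of the constants, and integrability against `dt /
t` forces both to vanish. -/
theorem IsBndDecomp.unique (hn : 1 ≤ n) (hθ : θ ∈ Set.Ioo 0 (Real.pi / 2)) {f g g' : Cl n → Cl n}
    {c₀ c_inf c₀' c_inf' : Cl n} (h : IsBndDecomp θ f c₀ c_inf g)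
    (h' : IsBndDecomp θ f c₀' c_inf' g') (hg : HasDecay θ g) (hg' : HasDecay θ g') :
    c₀' = c₀ ∧ c_inf' = c_inf ∧ Set.EqOn g' g (dblSector n θ) := by
  obtain ⟨J, hJ⟩ := exists_sph hn
  have h0 : (0 : ℝ) ∈ angles θ := Or.inl ⟨by linarith [hθ.1], hθ.1⟩
  have hF := (hg.2 J hJ 0 h0).add (hg'.2 J hJ 0 h0)
  set H : ℝ → Cl n := fun t =>
    (c_inf' - c_inf) + (1 + t ^ 2)⁻¹ • ((c₀' - c_inf') - (c₀ - c_inf)) with hH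
  have hle : ∀ t, 0 < t → ‖H t‖ / t ≤ ‖g (pol J t 0)‖ / t + ‖g' (pol J t 0)‖ / t := by
    intro t ht
    have hs : pol J t 0 ∈ dblSector n θ := ⟨J, hJ, t, ht, 0, h0, rfl⟩
    have e : Ring.inverse (1 + pol J t 0 ^ 2) = (1 + t ^ 2)⁻¹ • (1 : Cl n) := by
      have e1 : (1 : Cl n) + pol J t 0 ^ 2 = planeEmb hJ ((1 + t ^ 2 : ℝ) : ℂ) := by
        rw [pol_eq_planeEmb hJ]; simp
      rw [e1, inverse_planeEmb, ← ofReal_inv, planeEmb_apply, ofReal_re, ofReal_im, zero_smul,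
        add_zero]
    have h1 := (h _ hs).symm.trans (h' _ hs)
    rw [e, smul_one_mul, smul_one_mul] at h1
    have h2 : H t = g (pol J t 0) - g' (pol J t 0) := by
      rw [hH, ← sub_eq_zero]
      rw [← sub_eq_zero] at h1
      rw [← neg_eq_zero, ← h1]
      module
    rw [h2, ← add_div]
    gcongr
    exact norm_sub_le _ _
  have hinf : c_inf' - c_inf = 0 := by
    refine eq_zero_of_integrableOn_of_tendsto (h := H) (l := atTop) (Ioi_mem_atTop 0)
      (tendsto_norm_atTop_atTop.comp Real.tendsto_log_atTop) hF hle ?_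
    have h1 : Tendsto (fun t : ℝ => (1 + t ^ 2)⁻¹) atTop (𝓝 0) :=
      (tendsto_atTop_add_const_left _ _ (tendsto_pow_atTop two_ne_zero)).inv_tendsto_atTop
    simpa using (h1.smul_const ((c₀' - c_inf') - (c₀ - c_inf))).const_add (c_inf' - c_inf)
  have hzero : c₀' - c₀ = 0 := by
    refine eq_zero_of_integrableOn_of_tendsto (h := H) (l := 𝓝[>] 0) self_mem_nhdsWithin
      (tendsto_abs_atBot_atTop.comp Real.tendsto_log_nhdsGT_zero) hF hle ?_
    have h1 : Continuous fun t : ℝ => (1 + t ^ 2)⁻¹ :=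
      Continuous.inv₀ (by fun_prop) fun t => by positivity
    have h2 : Continuous H := continuous_const.add (h1.smul continuous_const)
    exact (h2.tendsto' 0 (c₀' - c₀) (by simp [hH]; abel)).mono_left nhdsWithin_le_nhds
  have e1 : c_inf' = c_inf := sub_eq_zero.1 hinf
  have e2 : c₀' = c₀ := sub_eq_zero.1 hzero
  refine ⟨e2, e1, fun s hs => ?_⟩
  have h1 := (h s hs).symm.trans (h' s hs)
  rw [e1, e2] at h1
  exact (add_left_cancel h1).symm

end RationalFunctions

/-! ### The extended calculus of a rational function, evaluated on orbits. -/

section RationalCalculus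

open Complex

theorem mul_one_add_X_sq_natDegree {q : ℝ[X]} (hq : q ≠ 0) :
    (q * (1 + Polynomial.X ^ 2)).natDegree = q.natDegree + 2 := by
  rw [one_add_X_sq_eq_quadPoly, mul_comm,
      (monic_quadPoly 0 1).natDegree_mul' hq, natDegree_quadPoly, add_comm]

theorem algebraMap_lmul {n : ℕ} {X : Type*} [NormedAddCommGroup X] [NormedSpace ℝ X] (c : ℝ)
    (v : CliffMod n X) : lmul (algebraMap ℝ (Cl n) c) v = c • v := by
  ext C
  rw [Algebra.algebraMap_eq_smul_one, lmul_apply, PiLp.smul_apply]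
  have h := congrArg (fun u : CliffMod n X => c • u C) (one_lmul v)
  simp only [lmul_apply, Finset.smul_sum, smul_smul] at h
  rw [← h]
  refine Finset.sum_congr rfl fun B _ => ?_
  rw [PiLp.smul_apply, smul_eq_mul, mul_assoc]

variable {E : Type*} [NormedAddCommGroup E] [NormedSpace ℝ E] {T : E →ₗ.[ℝ] E}

/-- `(1 + T²)⁻¹ ((q (1 + X²))[T] u) = q[T] u`. -/
theorem toBounded_inverse_evalSeq {q : ℝ[X]} (hq : q ≠ 0)
    (h : QuadInv T 0 1 (quadRes T I) (mulQuadRes T I)) {w : ℕ → E}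
    (hw : IsOrbit T (q * (1 + Polynomial.X ^ 2)).natDegree w) :
    toBounded (polyOp T (1 + Polynomial.X ^ 2)).inverse
      (evalSeq w (q * (1 + Polynomial.X ^ 2))) = evalSeq w q := by
  rw [mul_one_add_X_sq_natDegree hq] at hw
  rw [one_add_X_sq_eq_quadPoly, h.toBounded_inverse]
  have h1 := hw.evalSeq_mem_graph (p := q) (by omega)
  have h2 := hw.evalSeq_mem_graph (p := Polynomial.X * q)
    (by rw [Polynomial.natDegree_X_mul hq]; omega)
  have h3 := h.left_inv _ _ _ h1 h2
  convert h3 using 2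
  rw [← one_add_X_sq_eq_quadPoly, mul_add, mul_one, map_add, ← mul_assoc, ← sq, mul_comm q]
  module

/-- The values of `p[T] q[T]⁻¹` in terms of an orbit of length `deg q + 2`. -/
theorem mem_graph_opMul_inverse {p q : ℝ[X]} (hq : q ≠ 0) (hdeg : p.natDegree ≤ q.natDegree)
    (hinj : Function.Injective (polyOp T q).toFun) {w : ℕ → E}
    (hw : IsOrbit T (q * (1 + Polynomial.X ^ 2)).natDegree w) :
    (evalSeq w (q * (1 + Polynomial.X ^ 2)), evalSeq w (p * (1 + Polynomial.X ^ 2))) ∈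
      (opMul (polyOp T p) (polyOp T q).inverse).graph := by
  rw [mul_one_add_X_sq_natDegree hq] at hw
  -- This is the orbit of `(1 + T²) (w 0)`, two steps shorter than `w`, so evaluating `q` along it
  -- amounts to evaluating `q (1 + X²)` along `w`.
  set w' : ℕ → E := fun k => w (k + 2) - (2 * (0 : ℝ)) • w (k + 1) + (1 : ℝ) • w k with hw'
  have horb : IsOrbit T q.natDegree w' := fun i hi =>
    T.graph.add_mem (T.graph.sub_mem (hw (i + 2) (by omega))
      (T.graph.smul_mem _ (hw (i + 1) (by omega)))) (T.graph.smul_mem _ (hw i (by omega)))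
  have hev : ∀ r : ℝ[X], evalSeq w (r * (1 + Polynomial.X ^ 2)) = evalSeq w' r := fun r => by
    rw [one_add_X_sq_eq_quadPoly, mul_comm, evalSeq_quadPoly_mul]
  rw [hev, hev, mem_graph_opMul]
  exact ⟨w' 0, (mem_graph_inverse hinj).2 (mem_graph_polyOp.2 ⟨w', horb, rfl, rfl⟩),
    mem_graph_polyOp.2 ⟨w', horb.mono hdeg, rfl, rfl⟩⟩

variable {n : ℕ} {X : Type*} [NormedAddCommGroup X] [NormedSpace ℝ X] [CompleteSpace X]
  {T : CliffMod n X →ₗ.[ℝ] CliffMod n X} {ω : ℝ} {J : Cl n}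

/-- The closed double sector contains the real axis, so a root outside it is not real, and it
corresponds to a point of the `S`-resolvent set. -/
theorem IsBisectorial.quadInv_of_root (hJ : J ∈ Sph n) (hT : IsBisectorial T ω)
    (hω : ω ∈ Set.Ioo 0 (Real.pi / 2)) {q : ℝ[X]}
    (hq : ∀ z ∈ closedBisector ω, Polynomial.aeval z q ≠ 0) {z : ℂ}
    (hz : Polynomial.aeval z q = 0) : z.im ≠ 0 ∧ ∃ R S, QuadInv T z.re (‖z‖ ^ 2) R S := by
  have hz' : z ∉ closedBisector ω := fun h => hq z h hz
  refine ⟨fun h => hz' ?_, _, _, hT.quadInv hJ hω hz'⟩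
  rw [closedBisector, Set.mem_ofPred_eq, abs_re_eq_norm.2 h]
  exact mul_le_of_le_one_left (norm_nonneg z) (Real.cos_le_one ω)

theorem mul_one_add_X_sq_aeval_ne_zero {θ : ℝ} (hθ : θ ∈ Set.Ioo 0 (Real.pi / 2)) {q : ℝ[X]}
    (hq : ∀ z ∈ closedBisector θ, Polynomial.aeval z q ≠ 0) :
    ∀ z ∈ closedBisector θ, Polynomial.aeval z (q * (1 + Polynomial.X ^ 2)) ≠ 0 := fun z hz => by
  rw [map_mul, aeval_one_add_X_sq]
  exact mul_ne_zero (hq z hz) (one_add_sq_ne_zero hθ hz)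

/-- The value of the extended `ω`-functional calculus at a rational function. -/
theorem extendedCalculus_ratFun_apply {θ φ c₀ c_inf : ℝ} {p q R : ℝ[X]} (hJ : J ∈ Sph n)
    (hT : IsBisectorial T ω) (hω : ω ∈ Set.Ioo 0 (Real.pi / 2))
    (hθ : θ ∈ Set.Ioo 0 (Real.pi / 2)) (hφ : φ ∈ Set.Ioo ω θ)
    (hq : ∀ z ∈ closedBisector θ, Polynomial.aeval z q ≠ 0) (hq0 : q ≠ 0)
    (hR : R.natDegree ≤ q.natDegree)
    (h : p * (1 + Polynomial.X ^ 2) = Polynomial.C c_inf * (q * (1 + Polynomial.X ^ 2)) +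
        Polynomial.C (c₀ - c_inf) * q + Polynomial.X * R) {g : Cl n → Cl n}
    (hg : Set.EqOn g (ratFun (Polynomial.X * R) (q * (1 + Polynomial.X ^ 2))) (dblSector n θ)) :
    Integrable (omegaIntegrand T J φ g 1) ∧ Integrable (omegaIntegrand T J φ g (-1)) ∧
      ∀ w, IsOrbit T (q * (1 + Polynomial.X ^ 2)).natDegree w →
        (lmul (algebraMap ℝ (Cl n) c_inf) +
            (toBounded (polyOp T (1 + Polynomial.X ^ 2)).inverse).comp
              (lmul (algebraMap ℝ (Cl n) c₀ - algebraMap ℝ (Cl n) c_inf)) +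
            omegaCalc T J φ g : CliffMod n X →L[ℝ] CliffMod n X) (evalSeq w
                (q * (1 + Polynomial.X ^ 2))) =
          evalSeq w (p * (1 + Polynomial.X ^ 2)) := by
  have hφ0 : φ ∈ Set.Ioo 0 (Real.pi / 2) := ⟨hω.1.trans hφ.1, hφ.2.trans hθ.2⟩
  have hcos : Real.cos θ < Real.cos φ :=
    Real.cos_lt_cos_of_nonneg_of_le_pi hφ0.1.le (by linarith [hθ.2, Real.pi_pos]) hφ.2
  have hsub : closedBisector φ ⊆ closedBisector θ := fun z hz =>
    (mul_le_mul_of_nonneg_right hcos.le (norm_nonneg z)).trans hz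
  have hdeg := mul_one_add_X_sq_natDegree hq0
  obtain ⟨i1, i2, hval⟩ := omegaCalc_evalSeq hJ hT hω ⟨hφ.1, hφ0.2⟩ (R := R)
    (Q := q * (1 + Polynomial.X ^ 2)) (g := g)
    (fun z hz => mul_one_add_X_sq_aeval_ne_zero hθ hq z (hsub hz))
    (mul_ne_zero hq0 one_add_X_sq_ne_zero) (by omega) fun z hz hz0 => by
      rw [hg, ratFun_planeEmb]
      rw [planeEmb_mem_dblSector hJ hθ]
      exact (mul_lt_mul_of_pos_right hcos (norm_pos_iff.2 hz0)).trans_le hz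
  refine ⟨i1, i2, fun w hw => ?_⟩
  have hI : I ∉ closedBisector ω := fun hI => one_add_sq_ne_zero hω hI (by simp)
  have hQI : QuadInv T 0 1 (quadRes T I) (mulQuadRes T I) := by
    simpa using hT.quadInv hJ hω hI
  rw [add_apply, add_apply, ContinuousLinearMap.comp_apply, hval w hw, ← map_sub, algebraMap_lmul,
    algebraMap_lmul, map_smul, toBounded_inverse_evalSeq hq0 hQI hw, h, map_add, map_add,
    evalSeq_C_mul, evalSeq_C_mul]

end RationalCalculus

end CliffordCalculus

theorem mainTheorem6 {n : ℕ} (hn : 1 ≤ n)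
    {X : Type*} [NormedAddCommGroup X] [NormedSpace ℝ X] [CompleteSpace X]
    (T : CliffMod n X →ₗ.[ℝ] CliffMod n X) (ω : ℝ) (hω : ω ∈ Set.Ioo 0 (Real.pi / 2))
    (hT : IsBisectorial T ω) (p q : ℝ[X]) (hdeg : p.degree ≤ q.degree)
    (hq : ∀ s ∈ closure (dblSector n ω), Polynomial.aeval s q ≠ 0) :
    Function.Bijective (polyOp T q).toFun ∧
      ∃ θ ∈ Set.Ioo ω (Real.pi / 2),
        (∀ s ∈ dblSector n θ, Polynomial.aeval s q ≠ 0) ∧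
        ratFun p q ∈ Nbnd n θ ∧
        ∃ F : CliffMod n X →L[ℝ] CliffMod n X,
          IsExtendedCalculus T ω θ (ratFun p q) F ∧
            everywhere F = opMul (polyOp T p) (polyOp T q).inverse := by
  obtain ⟨J, hJ⟩ := exists_sph hn
  have hqB : ∀ z ∈ closedBisector ω, Polynomial.aeval z q ≠ 0 := fun z hz h0 =>
    hq _ ((planeEmb_mem_closure hJ hω).2 hz) (by rw [aeval_planeEmb, h0, map_zero])
  -- The vertex `0` belongs to the closed double sector.
  have hqc : q.coeff 0 ≠ 0 := fun h0 => hqB 0 (by simp [closedBisector])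
    (by rw [Polynomial.aeval_def, Polynomial.eval₂_at_zero, h0, map_zero])
  have hq0 : q ≠ 0 := by rintro rfl; simp at hqc
  have hdeg' : p.natDegree ≤ q.natDegree := Polynomial.natDegree_le_natDegree hdeg
  have hbij := polyOp_bijective hq0 fun z hz => hT.quadInv_of_root hJ hω hqB hz
  refine ⟨hbij, ?_⟩
  obtain ⟨θ, hθ, hqθ⟩ := exists_angle_forall_aeval_ne_zero hω hqB hq0
  have hθ0 : θ ∈ Set.Ioo 0 (Real.pi / 2) := ⟨hω.1.trans hθ.1, hθ.2⟩
  obtain ⟨c₀, c_inf, R, hR, hdec⟩ := exists_bounded_decomposition hdeg' hqc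
  have hQ0 : q * (1 + Polynomial.X ^ 2) ≠ 0 := mul_ne_zero hq0 one_add_X_sq_ne_zero
  have hQdeg := mul_one_add_X_sq_natDegree hq0
  have hmem := ratFun_mem_Nzero (n := n) hn hθ0 (R := R)
    (mul_one_add_X_sq_aeval_ne_zero hθ0 hqθ) hQ0 (by omega)
  have hbnd := isBndDecomp_ratFun (n := n) hθ0 hqθ hdec
  obtain ⟨φ, hφ⟩ := exists_between hθ.1
  -- `F` is built from one choice of `φ` and `J`; of it only the action on vectors `Q[T] u` is kept,
  -- which mentions neither.
  obtain ⟨F, hF⟩ : ∃ F : CliffMod n X →L[ℝ] CliffMod n X,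
      ∀ w, IsOrbit T (q * (1 + Polynomial.X ^ 2)).natDegree w →
        F (evalSeq w (q * (1 + Polynomial.X ^ 2))) = evalSeq w (p * (1 + Polynomial.X ^ 2)) :=
    ⟨_, (extendedCalculus_ratFun_apply hJ hT hω hθ0 hφ hqθ hq0 hR hdec
      (Set.eqOn_refl _ _)).2.2⟩
  have hsurj := (exists_orbit_of_roots (T := T) (q * (1 + Polynomial.X ^ 2)) hQ0 fun z hz =>
    hT.quadInv_of_root hJ hω (mul_one_add_X_sq_aeval_ne_zero hω hqB) hz).1
  refine ⟨θ, hθ, fun s hs h0 => ?_, ⟨c₀, c_inf, _, hmem, hbnd⟩, F,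
    ⟨⟨_, _, _, ⟨Intr_subset_SHL _ hmem.1, hmem.2⟩, hbnd⟩, ?_⟩, eq_everywhere_iff.2 fun v => ?_⟩
  · obtain ⟨K, hK, z, rfl⟩ := exists_planeEmb_of_mem_dblSector hs
    rw [aeval_planeEmb, ← norm_eq_zero, norm_planeEmb, norm_eq_zero] at h0
    exact hqθ z ((planeEmb_mem_dblSector hK hθ0).1 hs).le h0
  -- Any other admissible decomposition, angle and imaginary unit leads to the same values on the
  -- vectors `Q[T] u`, and by `hsurj` these exhaust the space.
  · intro c₀' c_inf' g hg hdec' φ' hφ' K hK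
    obtain ⟨h₀, h_inf, hgg⟩ := hbnd.unique hn hθ0 hdec' hmem.2 hg.2
    obtain ⟨i1, i2, hF'⟩ := extendedCalculus_ratFun_apply hK hT hω hθ0 hφ' hqθ hq0 hR hdec hgg
    rw [h₀, h_inf]
    refine ⟨i1, i2, ContinuousLinearMap.ext fun v => ?_⟩
    obtain ⟨w, hw, rfl⟩ := hsurj v
    rw [hF w hw, hF' w hw]
  · obtain ⟨w, hw, rfl⟩ := hsurj v
    rw [hF w hw]
    exact mem_graph_opMul_inverse hq0 hdeg' hbij.1 hw
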